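/- **Theorem (privacy upper bound for Noisy-SGD, strongly convex setting).** There is a universal constant $C>0$ such that the following holds for all parameters below. Let $\mathcal K\subset\mathbb R^d$ be a nonempty closed bounded convex set of diameter $D$, let $0<m\le M$ and $L>0$, and suppose that every data point $x$ defines a differentiable loss $f_x:\mathcal K\to\mathbb R$ that is $L$-Lipschitz, $m$-strongly convex and $M$-smooth on $\mathcal K$. Given a dataset $X=(x_1,\dots,x_n)$, an initialization $\omega_0\in\mathcal K$, a number of iterations $T\ge 0$, a batch size $1\le b\le n$, a stepsize $0<\eta<2/M$ and a noise parameter $\sigma>8\sqrt2\,L/b$, Noisy-SGD outputs $\omega_T$, where $$\omega_{t+1}=\Pi_{\mathcal K}\Big[\omega_t-\eta\Big(\tfrac1b\sum_{i\in B_t}\nabla f_{x_i}(\omega_t)+Z_t\Big)\Big],$$ $\Pi_{\mathcal K}$ is the Euclidean projection onto $\mathcal K$, the $B_t$ are uniformly random $b$-element subsets of $\{1,\dots,n\}$, $Z_t\sim\mathcal N(0,\sigma^2I_d)$, and all $B_t,Z_t$ are independent. For $q\in(0,1]$ and $s>0$ let $\alpha^*(q,s)$ be the largest $\alpha>1$ such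 that, with $\ell=\log\big(1+\tfrac1{q(\alpha-1)}\big)$, $$\alpha\le \tfrac12\ell s^2-\log(s^2)\qquad\text{and}\qquad \alpha\le\frac{\tfrac12\ell^2s^2-\log(5s^2)}{\ell+\log(q\alpha)+1/(2s^2)} .$$ Let $1<\alpha\le\alpha^*\big(\tfrac bn,\tfrac{b\sigma}{2\sqrt2L}\big)$ and $c=\max_{\lambda\in\{m,M\}}|1-\eta\lambda|$. Then: 1. $c<1$. 2. Noisy-SGD is $(\alpha,\varepsilon)$-RDP with $$\varepsilon\le C\,\frac{\alpha L^2}{n^2\sigma^2}\,\min\{T,\bar T\},\qquad \bar T=\left\lceil\frac1{\log(1/c)}\,\max\Big\{1,\ \log\Big(\frac{n^2D^2}{\eta^2L^2}\log\frac1c\Big)\Big\}\right\rceil ,$$ that is, $\mathcal D_\alpha(\mathbb P_{\omega_T}\,\|\,\mathbb P_{\omega_T'})\le\varepsilon$ for the outputs on any two datasets $X,X'$ of size $n$ that differ in at most one entry, where $\mathcal D_\alpha(\mu\|\nu)=\frac1{\alpha-1}\log\int(\frac{d\mu}{d\nu})^\alpha d\nu$ if $\mu\ll\nu$ and $\infty$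 otherwise. Here $\bar T:=1$ if $c=0$, and the logarithm inside the maximum is omitted (the maximum is $1$) if $D=0$. In particular $\bar T=\tilde O(1/\log(1/c))$. 3. If moreover $\eta\le 1/M$, then $\bar T\le C\,\frac1{\eta m}\max\big\{1,\log\frac{n^2D^2m}{\eta L^2}\big\}$ (with the same convention if $D=0$). So the burn-in is $\tilde O(1/(\eta m))$, and it depends on $n$ only logarithmically. -/

import Mathlib

open MeasureTheory ProbabilityTheory
open scoped ENNReal

namespace NoisySGD

/-- The Rényi divergence `D_α(μ ‖ ν)` of order `α > 1`, with values in `[-∞, ∞]`: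
`(α - 1)⁻¹ log ∫ (dμ/dν)^α dν` if `μ ≪ ν`, and `∞` otherwise. -/
noncomputable def renyiDiv {Ω : Type*} [MeasurableSpace Ω] (α : ℝ) (μ ν : Measure Ω) : EReal :=
  open Classical in
  if μ ≪ ν then
    (((α - 1)⁻¹ : ℝ) : EReal) * ENNReal.log (∫⁻ x, (μ.rnDeriv ν x) ^ α ∂ν)
  else ⊤

/-- Two datasets of size `n` are adjacent (replace adjacency) if they agree on all indices but at
most one. -/
def Adjacent {n : ℕ} {𝒳 : Type*} (X X' : Fin n → 𝒳) : Prop :=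
  ∃ i₀ : Fin n, ∀ i : Fin n, i ≠ i₀ → X i = X' i

/-- `(α, ε)`-Rényi differential privacy of a randomized algorithm, which maps a dataset to the law
of its output. -/
def IsRDP {n : ℕ} {𝒳 Ω : Type*} [MeasurableSpace Ω] (A : (Fin n → 𝒳) → Measure Ω)
    (α ε : ℝ) : Prop :=
  ∀ X X' : Fin n → 𝒳, Adjacent X X' → renyiDiv α (A X) (A X') ≤ (ε : EReal)

/-- `f` is a loss on `K` with gradient field `g` that is `L`-Lipschitz, `m`-strongly convex and
`M`-smooth on `K`. Only the behaviour on `K` matters: at each point of `K` the gradient is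
taken relative to `K`. -/
structure IsLoss {d : ℕ} (K : Set (EuclideanSpace ℝ (Fin d))) (L m M : ℝ)
    (f : EuclideanSpace ℝ (Fin d) → ℝ)
    (g : EuclideanSpace ℝ (Fin d) → EuclideanSpace ℝ (Fin d)) : Prop where
  hasGradient : ∀ w ∈ K, HasGradientWithinAt f (g w) K w
  lipschitz : ∀ w ∈ K, ∀ w' ∈ K, |f w - f w'| ≤ L * ‖w - w'‖
  stronglyConvex : StrongConvexOn K m f
  smooth : ∀ w ∈ K, ∀ w' ∈ K, ‖g w - g w'‖ ≤ M * ‖w - w'‖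

/-- The Euclidean projection onto `K`: the point of `K` nearest to `x` (it exists and is unique
if `K` is nonempty, closed and convex). -/
noncomputable def proj {d : ℕ} (K : Set (EuclideanSpace ℝ (Fin d)))
    (x : EuclideanSpace ℝ (Fin d)) : EuclideanSpace ℝ (Fin d) :=
  Classical.epsilon fun y => y ∈ K ∧ ∀ z ∈ K, dist x y ≤ dist x z

/-- The isotropic Gaussian `N(0, σ² I_d)`. -/
noncomputable def gaussian (d : ℕ) (σ : ℝ) : Measure (EuclideanSpace ℝ (Fin d)) :=
  (stdGaussian (EuclideanSpace ℝ (Fin d))).map fun z => σ • z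

/-- One update with batch `B` of size `b`, current iterate `w` and noise `z`:
`Π_K [w - η (b⁻¹ ∑_{i ∈ B} ∇f_i(w) + z)]`, where `g i` is the gradient field of `f_i`. -/
noncomputable def update {d n : ℕ} (K : Set (EuclideanSpace ℝ (Fin d))) (η : ℝ) (b : ℕ)
    (g : Fin n → EuclideanSpace ℝ (Fin d) → EuclideanSpace ℝ (Fin d)) (B : Finset (Fin n))
    (w z : EuclideanSpace ℝ (Fin d)) : EuclideanSpace ℝ (Fin d) :=
  proj K (w - η • ((b : ℝ)⁻¹ • ∑ i ∈ B, g i w + z))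

/-- The law of the next iterate if the current one has law `μ`: the batch is uniform among the
`b`-element subsets of the `n` indices, the noise has law `N(0, σ² I_d)`, and the current
iterate, the batch and the noise are independent. -/
noncomputable def step {d n : ℕ} (K : Set (EuclideanSpace ℝ (Fin d))) (η σ : ℝ) (b : ℕ)
    (g : Fin n → EuclideanSpace ℝ (Fin d) → EuclideanSpace ℝ (Fin d))
    (μ : Measure (EuclideanSpace ℝ (Fin d))) : Measure (EuclideanSpace ℝ (Fin d)) :=
  ((n.choose b : ℝ≥0∞)⁻¹) • ∑ B ∈ Finset.powersetCard b (Finset.univ : Finset (Fin n)),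
    (μ.prod (gaussian d σ)).map fun p => update K η b g B p.1 p.2

/-- The law of the last iterate of Noisy-SGD, run for `T` iterations from `w₀`. -/
noncomputable def noisySGD {d n : ℕ} (K : Set (EuclideanSpace ℝ (Fin d))) (η σ : ℝ) (b : ℕ)
    (g : Fin n → EuclideanSpace ℝ (Fin d) → EuclideanSpace ℝ (Fin d))
    (w₀ : EuclideanSpace ℝ (Fin d)) (T : ℕ) : Measure (EuclideanSpace ℝ (Fin d)) :=
  (step K η σ b g)^[T] (Measure.dirac w₀)

/-- The quantity `log (1 + 1 / (q (α - 1)))`. -/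
noncomputable def logTerm (q α : ℝ) : ℝ := Real.log (1 + 1 / (q * (α - 1)))

/-- The threshold `α*(q, s)`: the largest order `α > 1` that satisfies both inequalities. -/
noncomputable def alphaStar (q s : ℝ) : ℝ :=
  sSup {α : ℝ | 1 < α ∧
    α ≤ logTerm q α * s ^ 2 / 2 - Real.log (s ^ 2) ∧
    α ≤ (logTerm q α ^ 2 * s ^ 2 / 2 - Real.log (5 * s ^ 2)) /
      (logTerm q α + Real.log (q * α) + 1 / (2 * s ^ 2))}

/-- The contraction factor `c = max_{λ ∈ {m, M}} |1 - η λ|`. -/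
noncomputable def contractionFactor (η m M : ℝ) : ℝ := max |1 - η * m| |1 - η * M|

/-- The burn-in time
`⌈(1 / log (1/c)) * max {1, log ((n D / (η L))² log (1/c))}⌉`,
with the limiting value `1` for `c = 0`. -/
noncomputable def burnIn (n D L η c : ℝ) : ℝ :=
  open Classical in
  if c = 0 then 1
  else ((⌈1 / Real.log (1 / c) *
    max 1 (Real.log ((n * D / (η * L)) ^ 2 * Real.log (1 / c)))⌉ : ℤ) : ℝ)

end NoisySGD

/-! A bound on the Rényi divergence of order α follows from a bound for integration against μ as a
functional on L^β(ν), where β is conjugate to α (`HolderBound`). In this dual form composition is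
transparent: constants of successive transitions multiply (`HolderBound.mixMap`), and a transition
may use extra randomness that the compared process does not see.

This freedom yields amplification by iteration (`holderBound_iterate_mixStep`). Start two chains for
adjacent datasets at distance at most r. Beside the first chain runs an auxiliary chain that begins
where the second one does, but uses the labels, coins, noise and data-dependent shifts of the first.
The distance of this pair shrinks by the factor c in each step. The auxiliary chain differs from the
second chain only in its shifts, so each of its steps costs one subsampled Gaussian mechanism. The
remaining distance c^(k+1) r is hidden once, by the noise of the last step. With r = 0 this gives
the bound linear in T. For large T all but the last k + 1 iterations are forgotten and r is the
diameter; the burn-in is long enough that the square of the remaining distance, in units of ηL/n, is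
at most k + 1 (`exists_burnIn_eq`), so that hiding it costs no more, up to constants, than the k + 1
mechanisms.

In one step (`lintegral_noisy_step_le`) a quarter of the variance hides the distance and the rest
hides the shift. Given the label, the laws to be compared are mixtures with densities 1 - q + q t,
where t is a Gaussian likelihood ratio. Their Rényi moment is 1 + O(α(α-1)q²/s²)
(`lintegral_subsampled_le`): linear terms have mean zero, quadratic terms are variances, and
Chernoff bounds handle the events where the Taylor expansion fails. The inequalities that define α*
make these tails small. Since q = b/n and 1/s² = 8L²/(b²σ²), the batch size cancels. If q > 1/2000,
then q² is bounded below and the bound without subsampling suffices.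

The contraction must be proved from the behaviour on K alone. Cocoercivity needs auxiliary points in
the domain, so it is proved for nearby interior points and summed along segments
(`norm_gradient_step_le`). If K is lower-dimensional, only tangential gradients are controlled
(`IsLoss.tangential`), but the projection onto K ignores normal parts. -/

namespace NoisySGD

/-! ### Duality between Rényi divergence and L^β norms -/

/-- Dual form of a bound on the Rényi divergence of order `α`: integration against `μ` is a
functional of norm at most `k` on `L^β(ν)`, where `β = α / (α - 1)`. -/
def HolderBound {Ω : Type*} [MeasurableSpace Ω] (α : ℝ) (μ ν : Measure Ω) (k : ℝ≥0∞) : Prop :=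
  ∀ h : Ω → ℝ≥0∞, Measurable h →
    ∫⁻ x, h x ∂μ ≤ k * (∫⁻ x, h x ^ (α / (α - 1)) ∂ν) ^ ((α - 1) / α)

section HolderBound

variable {Ω : Type*} [MeasurableSpace Ω] {α : ℝ} {μ ν : Measure Ω} {k : ℝ≥0∞}

lemma HolderBound.absolutelyContinuous (hα : 1 < α) (h : HolderBound α μ ν k) :
    μ ≪ ν := by
  refine Measure.AbsolutelyContinuous.mk fun s hs hν => ?_
  have h1 := h (s.indicator 1) (measurable_one.indicator hs)
  have h2 : ∀ x, (s.indicator (1 : Ω → ℝ≥0∞) x) ^ (α / (α - 1)) = s.indicator 1 x := by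
    intro x
    have : 0 < α / (α - 1) := by apply div_pos <;> linarith
    by_cases hx : x ∈ s <;> simp [hx, this]
  simp only [h2, lintegral_indicator_one hs, hν] at h1
  have : 0 < (α - 1) / α := by apply div_pos <;> linarith
  simpa [ENNReal.zero_rpow_of_pos this] using h1

/-- The extremal test function is the density to the power α - 1. Truncating the density at N makes
I = ∫ min(p, N)^α finite, so I ≤ k I^(1/β) can be divided by I^(1/β); monotone convergence removes
the truncation. -/
lemma HolderBound.lintegral_rnDeriv_le [IsFiniteMeasure μ] [IsFiniteMeasure ν]
    (hα : 1 < α) (h : HolderBound α μ ν k) :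
    ∫⁻ x, μ.rnDeriv ν x ^ α ∂ν ≤ k ^ α := by
  have hα0 : 0 < α := by linarith
  have hα1 : 0 < α - 1 := by linarith
  have hac := h.absolutelyContinuous hα
  set p := μ.rnDeriv ν with hp
  have hpm : Measurable p := Measure.measurable_rnDeriv μ ν
  have key : ∀ N : ℕ, ∫⁻ x, min (p x) N ^ α ∂ν ≤ k ^ α := by
    intro N
    set I := ∫⁻ x, min (p x) N ^ α ∂ν with hI
    have hfin : I ≠ ∞ := by
      refine ne_top_of_le_ne_top ?_ (lintegral_mono (g := fun _ => (N : ℝ≥0∞) ^ α) fun x => ?_)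
      · simp only [lintegral_const]
        exact ENNReal.mul_ne_top (by simp [hα0.le]) (measure_ne_top _ _)
      · exact ENNReal.rpow_le_rpow (min_le_right _ _) hα0.le
    have hm : Measurable fun x => min (p x) (N : ℝ≥0∞) ^ (α - 1) :=
      (hpm.min measurable_const).pow_const _
    have h1 := h _ hm
    have h2 : ∫⁻ x, min (p x) (N : ℝ≥0∞) ^ (α - 1) ∂μ
        = ∫⁻ x, p x * min (p x) (N : ℝ≥0∞) ^ (α - 1) ∂ν := by
      conv_lhs => rw [← Measure.withDensity_rnDeriv_eq μ ν hac]
      rw [lintegral_withDensity_eq_lintegral_mul _ hpm hm]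
      rfl
    have h3 : I ≤ ∫⁻ x, min (p x) (N : ℝ≥0∞) ^ (α - 1) ∂μ := by
      rw [h2]
      refine lintegral_mono fun x => ?_
      have : min (p x) (N : ℝ≥0∞) ^ α
          = min (p x) (N : ℝ≥0∞) * min (p x) (N : ℝ≥0∞) ^ (α - 1) := by
        conv_lhs => rw [show α = 1 + (α - 1) by ring]
        rw [ENNReal.rpow_add_of_nonneg _ _ zero_le_one hα1.le, ENNReal.rpow_one]
      simp only [this]
      gcongr
      exact min_le_left _ _
    have h4 : ∀ x, (min (p x) (N : ℝ≥0∞) ^ (α - 1)) ^ (α / (α - 1)) = min (p x) (N : ℝ≥0∞) ^ α := by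
      intro x
      rw [← ENNReal.rpow_mul]
      congr 1
      field_simp
    simp only [h4, ← hI] at h1
    have h5 : I ≤ k * I ^ ((α - 1) / α) := h3.trans h1
    by_cases h0 : I = 0
    · simp [h0]
    have h6 : I ^ (1 / α) ≤ k := by
      have hne : I ^ ((α - 1) / α) ≠ 0 := by
        simp [ENNReal.rpow_eq_zero_iff, h0, hfin]
      have hnt : I ^ ((α - 1) / α) ≠ ∞ := ENNReal.rpow_ne_top_of_nonneg (by positivity) hfin
      have h7 : I = I ^ (1 / α) * I ^ ((α - 1) / α) := by
        rw [← ENNReal.rpow_add _ _ h0 hfin, ← add_div, add_sub_cancel, div_self hα0.ne',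
          ENNReal.rpow_one]
      have h8 : I ^ (1 / α) * I ^ ((α - 1) / α) ≤ k * I ^ ((α - 1) / α) := by rwa [← h7]
      exact (ENNReal.mul_le_mul_iff_left hne hnt).1 h8
    calc I = (I ^ (1 / α)) ^ α := by
          rw [← ENNReal.rpow_mul, one_div, inv_mul_cancel₀ hα0.ne', ENNReal.rpow_one]
      _ ≤ k ^ α := ENNReal.rpow_le_rpow h6 hα0.le
  have hmono : Filter.Tendsto (fun N : ℕ => ∫⁻ x, min (p x) N ^ α ∂ν) Filter.atTop
      (nhds (∫⁻ x, p x ^ α ∂ν)) := by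
    refine lintegral_tendsto_of_tendsto_of_monotone
      (fun N => ((hpm.min measurable_const).pow_const _).aemeasurable) ?_ ?_
    · refine Filter.Eventually.of_forall fun x N N' hN => ?_
      exact ENNReal.rpow_le_rpow (min_le_min le_rfl (by exact_mod_cast hN)) hα0.le
    · refine Filter.Eventually.of_forall fun x => ?_
      have : Filter.Tendsto (fun N : ℕ => min (p x) (N : ℝ≥0∞)) Filter.atTop
          (nhds (min (p x) ∞)) := tendsto_const_nhds.min ENNReal.tendsto_nat_nhds_top
      simp only [le_top, inf_of_le_left] at this
      exact ((ENNReal.continuous_rpow_const).tendsto _).comp this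
  exact le_of_tendsto' hmono key

theorem HolderBound.renyiDiv_le [IsFiniteMeasure μ] [IsFiniteMeasure ν] (hα : 1 < α) {ε : ℝ}
    (h : HolderBound α μ ν (ENNReal.ofReal (Real.exp ((α - 1) / α * ε)))) :
    renyiDiv α μ ν ≤ (ε : EReal) := by
  have hα1 : 0 < α - 1 := by linarith
  rw [renyiDiv, if_pos (h.absolutelyContinuous hα)]
  have h1 := h.lintegral_rnDeriv_le hα
  rw [ENNReal.ofReal_rpow_of_pos (Real.exp_pos _), ← Real.exp_mul,
    show (α - 1) / α * ε * α = (α - 1) * ε by field_simp] at h1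
  have h2 := ENNReal.log_monotone h1
  rw [ENNReal.log_ofReal_of_pos (Real.exp_pos _), Real.log_exp] at h2
  calc (((α - 1)⁻¹ : ℝ) : EReal) * ENNReal.log (∫⁻ x, (μ.rnDeriv ν x) ^ α ∂ν)
      ≤ (((α - 1)⁻¹ : ℝ) : EReal) * (((α - 1) * ε : ℝ) : EReal) := by
        apply mul_le_mul_of_nonneg_left h2
        exact_mod_cast (inv_pos.2 hα1).le
    _ = (ε : EReal) := by
        rw [← EReal.coe_mul, ← mul_assoc, inv_mul_cancel₀ hα1.ne', one_mul]

lemma holderBound_self [IsProbabilityMeasure μ] (hα : 1 < α) : HolderBound α μ μ 1 := by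
  intro h hh
  have hα1 : 0 < α - 1 := by linarith
  have hc : (α / (α - 1)).HolderConjugate α := by
    refine Real.holderConjugate_iff.2 ⟨by rw [lt_div_iff₀ hα1]; linarith, ?_⟩
    field_simp
    ring
  have := ENNReal.lintegral_mul_le_Lp_mul_Lq μ hc hh.aemeasurable
    (aemeasurable_const (b := (1 : ℝ≥0∞)))
  simpa using this

end HolderBound

/-! ### Randomized transitions and their composition -/

section MixMap

variable {Ω Ω' Ξ ι : Type*} [MeasurableSpace Ω] [MeasurableSpace Ω'] [MeasurableSpace Ξ]

/-- The law of the next state of a randomized update: a label `i ∈ s` is drawn with weight `w`, a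
coin shows `0` or `1` with weights `p₀`, `p₁`, the noise has law `γ`, and the update is `F₀ i` or
`F₁ i` according to the coin. -/
noncomputable def mixMap (γ : Measure Ξ) (s : Finset ι) (w p₀ p₁ : ℝ≥0∞)
    (F₀ F₁ : ι → Ω → Ξ → Ω') (μ : Measure Ω) : Measure Ω' :=
  ∑ i ∈ s, w • (p₀ • (μ.prod γ).map (fun x => F₀ i x.1 x.2) +
    p₁ • (μ.prod γ).map (fun x => F₁ i x.1 x.2))

variable {γ : Measure Ξ} {s : Finset ι} {w p₀ p₁ : ℝ≥0∞}

lemma lintegral_mixMap [SFinite γ] {F₀ F₁ : ι → Ω → Ξ → Ω'} {μ : Measure Ω}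
    (h₀ : ∀ i, Measurable fun x : Ω × Ξ => F₀ i x.1 x.2)
    (h₁ : ∀ i, Measurable fun x : Ω × Ξ => F₁ i x.1 x.2) {h : Ω' → ℝ≥0∞} (hh : Measurable h) :
    ∫⁻ y, h y ∂(mixMap γ s w p₀ p₁ F₀ F₁ μ) =
      ∫⁻ x, ∑ i ∈ s, w * (p₀ * ∫⁻ z, h (F₀ i x z) ∂γ + p₁ * ∫⁻ z, h (F₁ i x z) ∂γ) ∂μ := by
  have m₀ : ∀ i, Measurable fun x => ∫⁻ z, h (F₀ i x z) ∂γ := fun i =>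
    Measurable.lintegral_prod_right' (f := fun x : Ω × Ξ => h (F₀ i x.1 x.2)) (hh.comp (h₀ i))
  have m₁ : ∀ i, Measurable fun x => ∫⁻ z, h (F₁ i x z) ∂γ := fun i =>
    Measurable.lintegral_prod_right' (f := fun x : Ω × Ξ => h (F₁ i x.1 x.2)) (hh.comp (h₁ i))
  rw [mixMap, lintegral_finsetSum_measure, lintegral_finsetSum]
  · refine Finset.sum_congr rfl fun i _ => ?_
    rw [lintegral_smul_measure, lintegral_add_measure, lintegral_smul_measure,
      lintegral_smul_measure, lintegral_map hh (h₀ i), lintegral_map hh (h₁ i),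
      lintegral_prod (fun x : Ω × Ξ => h (F₀ i x.1 x.2)) (hh.comp (h₀ i)).aemeasurable,
      lintegral_prod (fun x : Ω × Ξ => h (F₁ i x.1 x.2)) (hh.comp (h₁ i)).aemeasurable,
      lintegral_const_mul, lintegral_add_left, lintegral_const_mul _ (m₀ i),
      lintegral_const_mul _ (m₁ i)]
    · simp only [smul_eq_mul]
    · exact (m₀ i).const_mul _
    · exact ((m₀ i).const_mul _).add ((m₁ i).const_mul _)
  · intro i _
    exact (((m₀ i).const_mul _).add ((m₁ i).const_mul _)).const_mul _

lemma isProbabilityMeasure_mixMap [IsProbabilityMeasure γ] {F₀ F₁ : ι → Ω → Ξ → Ω'}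
    {μ : Measure Ω} [IsProbabilityMeasure μ] (hw : s.card * w = 1) (hp : p₀ + p₁ = 1)
    (h₀ : ∀ i, Measurable fun x : Ω × Ξ => F₀ i x.1 x.2)
    (h₁ : ∀ i, Measurable fun x : Ω × Ξ => F₁ i x.1 x.2) :
    IsProbabilityMeasure (mixMap γ s w p₀ p₁ F₀ F₁ μ) := by
  constructor
  rw [← lintegral_one]
  refine (lintegral_mixMap h₀ h₁ (measurable_const (a := (1 : ℝ≥0∞)))).trans ?_
  simp [hp, hw]

lemma map_mixMap_eq [SFinite γ] {Θ Θ' : Type*} [MeasurableSpace Θ] [MeasurableSpace Θ']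
    {F₀ F₁ : ι → Ω → Ξ → Ω'} {G₀ G₁ : ι → Θ → Ξ → Θ'} {μ : Measure Ω}
    (h₀ : ∀ i, Measurable fun x : Ω × Ξ => F₀ i x.1 x.2)
    (h₁ : ∀ i, Measurable fun x : Ω × Ξ => F₁ i x.1 x.2)
    (k₀ : ∀ i, Measurable fun x : Θ × Ξ => G₀ i x.1 x.2)
    (k₁ : ∀ i, Measurable fun x : Θ × Ξ => G₁ i x.1 x.2)
    {f : Ω → Θ} {f' : Ω' → Θ'} (hf : Measurable f) (hf' : Measurable f')
    (e₀ : ∀ i x z, f' (F₀ i x z) = G₀ i (f x) z) (e₁ : ∀ i x z, f' (F₁ i x z) = G₁ i (f x) z) :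
    (mixMap γ s w p₀ p₁ F₀ F₁ μ).map f' = mixMap γ s w p₀ p₁ G₀ G₁ (μ.map f) := by
  refine Measure.ext_of_lintegral _ fun h hh => ?_
  have m₀ : ∀ i, Measurable fun x => ∫⁻ z, h (G₀ i x z) ∂γ := fun i =>
    Measurable.lintegral_prod_right' (f := fun x : Θ × Ξ => h (G₀ i x.1 x.2)) (hh.comp (k₀ i))
  have m₁ : ∀ i, Measurable fun x => ∫⁻ z, h (G₁ i x z) ∂γ := fun i =>
    Measurable.lintegral_prod_right' (f := fun x : Θ × Ξ => h (G₁ i x.1 x.2)) (hh.comp (k₁ i))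
  rw [lintegral_map hh hf', lintegral_mixMap h₀ h₁ (h := fun y => h (f' y)) (hh.comp hf'), lintegral_mixMap k₀ k₁ hh,
    lintegral_map _ hf]
  · simp only [e₀, e₁]
  · exact Finset.measurable_sum _ fun i _ =>
      (((m₀ i).const_mul _).add ((m₁ i).const_mul _)).const_mul _

/-- Jensen for the concave power θ. With θ = 1/β it moves the average over labels inside the L^β
norm, so a bound for each label gives the same bound for the mixture. -/
lemma sum_weight_mul_rpow_le (hw : s.card * w = 1) {θ : ℝ} (hθ : 0 < θ) (hθ1 : θ ≤ 1)
    (a : ι → ℝ≥0∞) : ∑ i ∈ s, w * a i ^ θ ≤ (∑ i ∈ s, w * a i) ^ θ := by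
  have h := ENNReal.rpow_arith_mean_le_arith_mean_rpow s (fun _ => w) (fun i => a i ^ θ)
    (by simpa using hw) (p := 1 / θ) (by rw [le_div_iff₀ hθ]; linarith)
  simp only [← ENNReal.rpow_mul, mul_one_div_cancel hθ.ne', ENNReal.rpow_one] at h
  calc ∑ i ∈ s, w * a i ^ θ = ((∑ i ∈ s, w * a i ^ θ) ^ (1 / θ)) ^ θ := by
        rw [← ENNReal.rpow_mul, one_div_mul_cancel hθ.ne', ENNReal.rpow_one]
    _ ≤ _ := ENNReal.rpow_le_rpow h hθ.le

/-- Composition: a bound for the current states and a bound for the transitions, uniform over the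
current states, multiply. -/
lemma HolderBound.mixMap [SFinite γ] {α : ℝ} (hα : 1 < α) {Θ : Type*} [MeasurableSpace Θ]
    {F₀ F₁ : ι → Ω → Ξ → Ω'} {G₀ G₁ : ι → Θ → Ξ → Ω'} {π : Measure Ω} {ν : Measure Θ}
    (hw : s.card * w = 1)
    (h₀ : ∀ i, Measurable fun x : Ω × Ξ => F₀ i x.1 x.2)
    (h₁ : ∀ i, Measurable fun x : Ω × Ξ => F₁ i x.1 x.2)
    (k₀ : ∀ i, Measurable fun x : Θ × Ξ => G₀ i x.1 x.2)
    (k₁ : ∀ i, Measurable fun x : Θ × Ξ => G₁ i x.1 x.2)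
    {f : Ω → Θ} (hf : Measurable f) {k k' : ℝ≥0∞}
    (hπ : HolderBound α (π.map f) ν k)
    (hstep : ∀ᵐ x ∂π, ∀ i ∈ s, ∀ h : Ω' → ℝ≥0∞, Measurable h →
      p₀ * ∫⁻ z, h (F₀ i x z) ∂γ + p₁ * ∫⁻ z, h (F₁ i x z) ∂γ ≤
        k' * (p₀ * ∫⁻ z, h (G₀ i (f x) z) ^ (α / (α - 1)) ∂γ +
          p₁ * ∫⁻ z, h (G₁ i (f x) z) ^ (α / (α - 1)) ∂γ) ^ ((α - 1) / α)) :
    HolderBound α (mixMap γ s w p₀ p₁ F₀ F₁ π) (NoisySGD.mixMap γ s w p₀ p₁ G₀ G₁ ν) (k * k') := by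
  intro h hh
  have hα1 : 0 < α - 1 := by linarith
  have hhβ : Measurable fun y => h y ^ (α / (α - 1)) := hh.pow_const _
  set S : ι → Θ → ℝ≥0∞ := fun i y => p₀ * ∫⁻ z, h (G₀ i y z) ^ (α / (α - 1)) ∂γ +
    p₁ * ∫⁻ z, h (G₁ i y z) ^ (α / (α - 1)) ∂γ with hS
  have mS : ∀ i, Measurable (S i) := fun i =>
    ((Measurable.lintegral_prod_right' (f := fun x : Θ × Ξ => h (G₀ i x.1 x.2) ^ (α / (α - 1)))
      (hhβ.comp (k₀ i))).const_mul _).add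
    ((Measurable.lintegral_prod_right' (f := fun x : Θ × Ξ => h (G₁ i x.1 x.2) ^ (α / (α - 1)))
      (hhβ.comp (k₁ i))).const_mul _)
  have mS' : Measurable fun y => ∑ i ∈ s, w * S i y :=
    Finset.measurable_sum _ fun i _ => (mS i).const_mul _
  have mH : Measurable fun y => (∑ i ∈ s, w * S i y) ^ ((α - 1) / α) := mS'.pow_const _
  rw [lintegral_mixMap h₀ h₁ hh, lintegral_mixMap k₀ k₁ hhβ]
  calc _ ≤ ∫⁻ x, k' * (∑ i ∈ s, w * S i (f x)) ^ ((α - 1) / α) ∂π := by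
        refine lintegral_mono_ae ?_
        filter_upwards [hstep] with x hx
        calc _ ≤ ∑ i ∈ s, w * (k' * S i (f x) ^ ((α - 1) / α)) :=
              Finset.sum_le_sum fun i hi => mul_le_mul_right (hx i hi h hh) _
          _ = k' * ∑ i ∈ s, w * S i (f x) ^ ((α - 1) / α) := by
              rw [Finset.mul_sum]
              exact Finset.sum_congr rfl fun i _ => by ring
          _ ≤ _ := mul_le_mul_right (sum_weight_mul_rpow_le hw (by positivity)
              (by rw [div_le_one] <;> linarith) _) _
    _ = k' * ∫⁻ y, (∑ i ∈ s, w * S i y) ^ ((α - 1) / α) ∂(π.map f) := by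
        rw [lintegral_const_mul (f := fun x => (∑ i ∈ s, w * S i (f x)) ^ ((α - 1) / α)) _ (mH.comp hf), lintegral_map mH hf]
    _ ≤ k' * (k * (∫⁻ y, ((∑ i ∈ s, w * S i y) ^ ((α - 1) / α)) ^ (α / (α - 1)) ∂ν) ^
          ((α - 1) / α)) := mul_le_mul_right (hπ _ mH) _
    _ = _ := by
        have : ∀ y : ℝ≥0∞, (y ^ ((α - 1) / α)) ^ (α / (α - 1)) = y := fun y => by
          rw [← ENNReal.rpow_mul, div_mul_div_cancel₀ (by linarith), div_self hα1.ne',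
            ENNReal.rpow_one]
        simp only [this, hS]
        ring

end MixMap

/-! ### Amplification by iteration -/

section Chain

variable {E ι : Type*} [NormedAddCommGroup E] [NormedSpace ℝ E] [MeasurableSpace E] [BorelSpace E]
  [SecondCountableTopology E]

/-- The law of the next iterate `P (ψ i w + [coin = 1] v i w - η z)`. -/
noncomputable def mixStep (γ : Measure E) (s : Finset ι) (w p₀ p₁ : ℝ≥0∞) (P : E → E) (η : ℝ)
    (ψ v : ι → E → E) (μ : Measure E) : Measure E :=
  mixMap γ s w p₀ p₁ (fun i x z => P (ψ i x - η • z)) (fun i x z => P (ψ i x + v i x - η • z)) μ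

variable {γ : Measure E} [IsProbabilityMeasure γ] {s : Finset ι} {w p₀ p₁ : ℝ≥0∞}
  {P : E → E} {η : ℝ} {ψ v v' : ι → E → E}

/-- Privacy amplification by iteration, through a coupling: along the way an auxiliary process
moves parallel to the first process with the increments of the second, and in the last step it is
moved onto the first process. -/
theorem holderBound_iterate_mixStep {α c ρ r : ℝ} (hα : 1 < α)
    (hw : s.card * w = 1) (hp : p₀ + p₁ = 1) (hP : LipschitzWith 1 P)
    (hψm : ∀ i, Measurable (ψ i)) (hvm : ∀ i, Measurable (v i)) (hvm' : ∀ i, Measurable (v' i))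
    (hc : 0 ≤ c) (hψ : ∀ i x y, ‖ψ i x - ψ i y‖ ≤ c * ‖x - y‖)
    (hv : ∀ i x, ‖v i x‖ ≤ ρ) (hv' : ∀ i x, ‖v' i x‖ ≤ ρ) (k : ℝ → ℝ≥0∞)
    (hstep : ∀ (a : ℝ) (x y u u' : E), ‖u‖ ≤ ρ → ‖u'‖ ≤ ρ → ‖x - y‖ ≤ a →
      ∀ h : E → ℝ≥0∞, Measurable h →
      p₀ * ∫⁻ z, h (x - η • z) ∂γ + p₁ * ∫⁻ z, h (x + u - η • z) ∂γ ≤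
        k a * (p₀ * ∫⁻ z, h (y - η • z) ^ (α / (α - 1)) ∂γ +
          p₁ * ∫⁻ z, h (y + u' - η • z) ^ (α / (α - 1)) ∂γ) ^ ((α - 1) / α))
    {π₀ : Measure (E × E)} [IsProbabilityMeasure π₀] (hπ₀ : ∀ᵐ x ∂π₀, ‖x.1 - x.2‖ ≤ r) (T : ℕ) :
    HolderBound α ((mixStep γ s w p₀ p₁ P η ψ v)^[T + 1] (π₀.map Prod.fst))
      ((mixStep γ s w p₀ p₁ P η ψ v')^[T + 1] (π₀.map Prod.snd))
      (k 0 ^ T * k (c ^ (T + 1) * r)) := by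
  have hPm : Measurable P := hP.continuous.measurable
  have hz : Measurable fun x : E × E => η • x.2 := measurable_snd.const_smul η
  have hm₀ : ∀ i, Measurable fun x : E × E => P (ψ i x.1 - η • x.2) := fun i =>
    hPm.comp (((hψm i).comp measurable_fst).sub hz)
  have hm₁ : ∀ i, Measurable fun x : E × E => P (ψ i x.1 + v i x.1 - η • x.2) := fun i =>
    hPm.comp ((((hψm i).comp measurable_fst).add ((hvm i).comp measurable_fst)).sub hz)
  have hm₁' : ∀ i, Measurable fun x : E × E => P (ψ i x.1 + v' i x.1 - η • x.2) := fun i =>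
    hPm.comp ((((hψm i).comp measurable_fst).add ((hvm' i).comp measurable_fst)).sub hz)
  have inv : ∀ t : ℕ, ∃ π : Measure (E × E), IsProbabilityMeasure π ∧
      π.map Prod.fst = (mixStep γ s w p₀ p₁ P η ψ v)^[t] (π₀.map Prod.fst) ∧
      (∀ᵐ x ∂π, ‖x.1 - x.2‖ ≤ c ^ t * r) ∧
      HolderBound α (π.map Prod.snd) ((mixStep γ s w p₀ p₁ P η ψ v')^[t] (π₀.map Prod.snd))
        (k 0 ^ t) := by
    intro t
    induction t with
    | zero =>
      have : IsProbabilityMeasure (π₀.map Prod.snd) :=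
        Measure.isProbabilityMeasure_map measurable_snd.aemeasurable
      exact ⟨π₀, inferInstance, rfl, by simpa using hπ₀, by simpa using holderBound_self hα⟩
    | succ t ih =>
      obtain ⟨π, hπ, hfst, hdist, hbound⟩ := ih
      -- Both coordinates receive the increment `v i x.1` of the first, so their difference sees
      -- only `ψ i` and contracts. The second coordinate thus carries a foreign increment; as only
      -- its norm matters, comparison with `v' i x.2` from the same base point costs `k 0`.
      set F₀ : ι → E × E → E → E × E := fun i x z => (P (ψ i x.1 - η • z), P (ψ i x.2 - η • z))
      set F₁ : ι → E × E → E → E × E := fun i x z =>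
        (P (ψ i x.1 + v i x.1 - η • z), P (ψ i x.2 + v i x.1 - η • z))
      have hz' : Measurable fun x : (E × E) × E => η • x.2 := measurable_snd.const_smul η
      have m₁ : ∀ i, Measurable fun x : (E × E) × E => ψ i x.1.1 := fun i =>
        (hψm i).comp (measurable_fst.comp measurable_fst)
      have m₂ : ∀ i, Measurable fun x : (E × E) × E => ψ i x.1.2 := fun i =>
        (hψm i).comp (measurable_snd.comp measurable_fst)
      have m₃ : ∀ i, Measurable fun x : (E × E) × E => v i x.1.1 := fun i =>
        (hvm i).comp (measurable_fst.comp measurable_fst)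
      have hF₀ : ∀ i, Measurable fun x : (E × E) × E => F₀ i x.1 x.2 := fun i =>
        (hPm.comp ((m₁ i).sub hz')).prodMk (hPm.comp ((m₂ i).sub hz'))
      have hF₁ : ∀ i, Measurable fun x : (E × E) × E => F₁ i x.1 x.2 := fun i =>
        (hPm.comp (((m₁ i).add (m₃ i)).sub hz')).prodMk (hPm.comp (((m₂ i).add (m₃ i)).sub hz'))
      refine ⟨mixMap γ s w p₀ p₁ F₀ F₁ π, isProbabilityMeasure_mixMap hw hp hF₀ hF₁, ?_, ?_, ?_⟩
      · rw [Function.iterate_succ_apply', ← hfst, mixStep]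
        exact map_mixMap_eq hF₀ hF₁ hm₀ hm₁ measurable_fst measurable_fst (fun _ _ _ => rfl)
          (fun _ _ _ => rfl)
      · have hset : MeasurableSet {x : E × E | ‖x.1 - x.2‖ ≤ c ^ (t + 1) * r} :=
          measurableSet_le (by fun_prop) measurable_const
        have hPle : ∀ i (x : E × E) (a z : E), ‖x.1 - x.2‖ ≤ c ^ t * r →
            ‖P (ψ i x.1 + a - η • z) - P (ψ i x.2 + a - η • z)‖ ≤ c ^ (t + 1) * r := by
          intro i x a z hx
          have h1 := hP.dist_le_mul (ψ i x.1 + a - η • z) (ψ i x.2 + a - η • z)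
          rw [dist_eq_norm, dist_eq_norm, NNReal.coe_one, one_mul, sub_sub_sub_cancel_right,
            add_sub_add_right_eq_sub] at h1
          calc _ ≤ c * ‖x.1 - x.2‖ := h1.trans (hψ i _ _)
            _ ≤ c * (c ^ t * r) := by gcongr
            _ = _ := by ring
        rw [ae_iff]
        change mixMap γ s w p₀ p₁ F₀ F₁ π {x : E × E | ‖x.1 - x.2‖ ≤ c ^ (t + 1) * r}ᶜ = 0
        rw [← lintegral_indicator_one hset.compl,
          lintegral_mixMap hF₀ hF₁ (measurable_one.indicator hset.compl)]
        refine lintegral_eq_zero_of_ae_eq_zero ?_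
        filter_upwards [hdist] with x hx
        refine Finset.sum_eq_zero fun i _ => ?_
        have h0 : ∀ z, F₀ i x z ∉ {x : E × E | ‖x.1 - x.2‖ ≤ c ^ (t + 1) * r}ᶜ := fun z => by
          simpa [F₀] using hPle i x 0 z hx
        have h1 : ∀ z, F₁ i x z ∉ {x : E × E | ‖x.1 - x.2‖ ≤ c ^ (t + 1) * r}ᶜ := fun z => by
          simpa [F₁] using hPle i x (v i x.1) z hx
        simp only [Set.indicator_of_notMem (h0 _), Set.indicator_of_notMem (h1 _), lintegral_zero,
          mul_zero, add_zero]
      · have key : HolderBound α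
            (mixMap γ s w p₀ p₁ (fun i x z => P (ψ i x.2 - η • z))
              (fun i x z => P (ψ i x.2 + v i x.1 - η • z)) π)
            (mixStep γ s w p₀ p₁ P η ψ v' ((mixStep γ s w p₀ p₁ P η ψ v')^[t] (π₀.map Prod.snd)))
            (k 0 ^ t * k 0) := by
          refine hbound.mixMap hα hw (fun i => measurable_snd.comp (hF₀ i))
            (fun i => measurable_snd.comp (hF₁ i)) hm₀ hm₁' measurable_snd ?_
          refine Filter.Eventually.of_forall fun x i _ h hh => ?_
          exact hstep 0 (ψ i x.2) (ψ i x.2) (v i x.1) (v' i x.2) (hv _ _) (hv' _ _) (by simp)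
            (fun y => h (P y)) (hh.comp hPm)
        rw [Function.iterate_succ_apply', pow_succ]
        convert key using 1
        have := map_mixMap_eq (γ := γ) (s := s) (w := w) (p₀ := p₀) (p₁ := p₁) (μ := π) hF₀ hF₁
          (fun i => measurable_snd.comp (hF₀ i)) (fun i => measurable_snd.comp (hF₁ i))
          (G₀ := fun i x z => P (ψ i x.2 - η • z))
          (G₁ := fun i x z => P (ψ i x.2 + v i x.1 - η • z))
          (f := id) measurable_id measurable_snd (fun _ _ _ => rfl) (fun _ _ _ => rfl)
        rw [this, Measure.map_id]
  obtain ⟨π, hπ, hfst, hdist, hbound⟩ := inv T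
  have hz' : Measurable fun x : (E × E) × E => η • x.2 := measurable_snd.const_smul η
  have m₁ : ∀ i, Measurable fun x : (E × E) × E => ψ i x.1.1 := fun i =>
    (hψm i).comp (measurable_fst.comp measurable_fst)
  have m₃ : ∀ i, Measurable fun x : (E × E) × E => v i x.1.1 := fun i =>
    (hvm i).comp (measurable_fst.comp measurable_fst)
  have hF₀ : ∀ i, Measurable fun x : (E × E) × E => P (ψ i x.1.1 - η • x.2) := fun i =>
    hPm.comp ((m₁ i).sub hz')
  have hF₁ : ∀ i, Measurable fun x : (E × E) × E => P (ψ i x.1.1 + v i x.1.1 - η • x.2) := fun i =>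
    hPm.comp (((m₁ i).add (m₃ i)).sub hz')
  -- The last step switches from the auxiliary chain to the first one: the output comes from `x.1`,
  -- while the comparison chain continues from `x.2`. Here the accumulated contraction is cashed in.
  have key : HolderBound α
      (mixMap γ s w p₀ p₁ (fun i x z => P (ψ i x.1 - η • z))
        (fun i x z => P (ψ i x.1 + v i x.1 - η • z)) π)
      (mixStep γ s w p₀ p₁ P η ψ v' ((mixStep γ s w p₀ p₁ P η ψ v')^[T] (π₀.map Prod.snd)))
      (k 0 ^ T * k (c ^ (T + 1) * r)) := by
    refine hbound.mixMap hα hw hF₀ hF₁ hm₀ hm₁' measurable_snd ?_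
    filter_upwards [hdist] with x hx i _ h hh
    refine hstep _ (ψ i x.1) (ψ i x.2) (v i x.1) (v' i x.2) (hv _ _) (hv' _ _) ?_
      (fun y => h (P y)) (hh.comp hPm)
    calc _ ≤ c * ‖x.1 - x.2‖ := hψ i _ _
      _ ≤ c * (c ^ T * r) := by gcongr
      _ = _ := by ring
  rw [Function.iterate_succ_apply', Function.iterate_succ_apply', ← hfst]
  convert key using 1
  have := map_mixMap_eq (γ := γ) (s := s) (w := w) (p₀ := p₀) (p₁ := p₁) (μ := π)
    (F₀ := fun i x z => P (ψ i x.1 - η • z)) (F₁ := fun i x z => P (ψ i x.1 + v i x.1 - η • z))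
    (G₀ := fun i x z => P (ψ i x - η • z)) (G₁ := fun i x z => P (ψ i x + v i x - η • z))
    hF₀ hF₁ hm₀ hm₁ measurable_fst (f' := id) measurable_id (fun _ _ _ => rfl) (fun _ _ _ => rfl)
  rw [Measure.map_id] at this
  exact this.symm

end Chain

/-! ### Gaussian shifts and one noisy step -/

section Gaussian

open scoped RealInnerProductSpace

variable {E : Type*} [NormedAddCommGroup E] [InnerProductSpace ℝ E]

/-- The density of the shifted Gaussian `N(v, I)` relative to `N(0, I)`. -/
noncomputable def shiftDensity (v z : E) : ℝ := Real.exp (⟪v, z⟫ - ‖v‖ ^ 2 / 2)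

lemma shiftDensity_pos (v z : E) : 0 < shiftDensity v z := Real.exp_pos _

lemma shiftDensity_zero (z : E) : shiftDensity 0 z = 1 := by simp [shiftDensity]

lemma shiftDensity_rpow (v z : E) (a : ℝ) :
    shiftDensity v z ^ a = Real.exp (-(a * ‖v‖ ^ 2 / 2)) * Real.exp ⟪a • v, z⟫ := by
  rw [shiftDensity, ← Real.exp_mul, ← Real.exp_add, inner_smul_left]
  congr 1
  simp
  ring

variable [FiniteDimensional ℝ E] [MeasurableSpace E] [BorelSpace E]

lemma map_inner_stdGaussian (w : E) :
    (stdGaussian E).map (fun z => ⟪w, z⟫) = gaussianReal 0 (‖w‖ ^ 2).toNNReal := by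
  have h := IsGaussian.map_eq_gaussianReal (μ := stdGaussian E) (innerSL ℝ w)
  rw [integral_strongDual_stdGaussian, variance_dual_stdGaussian, innerSL_apply_norm] at h
  exact h

lemma mgf_inner_stdGaussian (w : E) (t : ℝ) :
    mgf (fun z => ⟪w, z⟫) (stdGaussian E) t = Real.exp (‖w‖ ^ 2 * t ^ 2 / 2) := by
  rw [mgf_gaussianReal (map_inner_stdGaussian w), Real.coe_toNNReal _ (by positivity), zero_mul,
    zero_add]

lemma integral_exp_inner_stdGaussian (w : E) :
    ∫ z, Real.exp ⟪w, z⟫ ∂(stdGaussian E) = Real.exp (‖w‖ ^ 2 / 2) := by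
  simpa [mgf] using mgf_inner_stdGaussian w 1

lemma integrable_exp_inner_stdGaussian (w : E) :
    Integrable (fun z => Real.exp ⟪w, z⟫) (stdGaussian E) := by
  -- The integral of a nonintegrable function is 0 by convention, so a nonzero value proves
  -- integrability.
  refine Integrable.of_integral_ne_zero ?_
  rw [integral_exp_inner_stdGaussian]
  exact (Real.exp_pos _).ne'

@[fun_prop]
lemma measurable_shiftDensity (v : E) : Measurable (shiftDensity v) := by
  unfold shiftDensity; fun_prop

lemma integrable_shiftDensity_rpow (v : E) (a : ℝ) :
    Integrable (fun z => shiftDensity v z ^ a) (stdGaussian E) := by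
  simp only [shiftDensity_rpow]
  exact (integrable_exp_inner_stdGaussian _).const_mul _

lemma integral_shiftDensity_rpow (v : E) (a : ℝ) :
    ∫ z, shiftDensity v z ^ a ∂(stdGaussian E) = Real.exp (a * (a - 1) * ‖v‖ ^ 2 / 2) := by
  simp only [shiftDensity_rpow]
  rw [integral_const_mul, integral_exp_inner_stdGaussian, ← Real.exp_add, norm_smul, mul_pow,
    Real.norm_eq_abs, sq_abs]
  congr 1
  ring

lemma integrable_shiftDensity (v : E) : Integrable (shiftDensity v) (stdGaussian E) := by
  simpa using integrable_shiftDensity_rpow v 1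

lemma integral_shiftDensity (v : E) : ∫ z, shiftDensity v z ∂(stdGaussian E) = 1 := by
  simpa using integral_shiftDensity_rpow v 1

lemma lintegral_shiftDensity_rpow (v : E) (a : ℝ) :
    ∫⁻ z, ENNReal.ofReal (shiftDensity v z ^ a) ∂(stdGaussian E) =
      ENNReal.ofReal (Real.exp (a * (a - 1) * ‖v‖ ^ 2 / 2)) := by
  rw [← ofReal_integral_eq_lintegral_ofReal (integrable_shiftDensity_rpow v a)
    (Filter.Eventually.of_forall fun z => (Real.rpow_pos_of_pos (shiftDensity_pos v z) a).le),
    integral_shiftDensity_rpow]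

/-- The Cameron–Martin formula for the standard Gaussian. -/
theorem map_add_stdGaussian (v : E) :
    (stdGaussian E).map (fun z => z + v) =
      (stdGaussian E).withDensity fun z => ENNReal.ofReal (shiftDensity v z) := by
  have : CompleteSpace E := FiniteDimensional.complete ℝ E
  have hprob₁ : IsProbabilityMeasure ((stdGaussian E).map (fun z => z + v)) :=
    Measure.isProbabilityMeasure_map (by fun_prop)
  have hprob₂ : IsProbabilityMeasure
      ((stdGaussian E).withDensity fun z => ENNReal.ofReal (shiftDensity v z)) := by
    constructor
    rw [withDensity_apply _ MeasurableSet.univ, setLIntegral_univ]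
    simpa using lintegral_shiftDensity_rpow v 1
  apply Measure.ext_of_charFunDual
  ext L
  obtain ⟨w, rfl⟩ : ∃ w : E, innerSL ℝ w = L :=
    ⟨(InnerProductSpace.toDual ℝ E).symm L, by ext z; simp⟩
  rw [charFunDual_eq_charFun_map_one, charFunDual_eq_charFun_map_one]
  congr 1
  -- Along each functional both laws have the same moment generating function on all of ℝ. Its
  -- complex extension is then the same as well, and it determines the law.
  have hm₁ : ∀ t, mgf (innerSL ℝ w) ((stdGaussian E).map (fun z => z + v)) t =
      Real.exp (t * ⟪w, v⟫ + t ^ 2 * ‖w‖ ^ 2 / 2) := by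
    intro t
    rw [mgf, integral_map (by fun_prop) (by fun_prop)]
    have : ∀ z : E, Real.exp (t * (innerSL ℝ w) (z + v)) =
        Real.exp (t * ⟪w, v⟫) * Real.exp ⟪t • w, z⟫ := fun z => by
      rw [← Real.exp_add, innerSL_apply_apply, inner_add_right, real_inner_smul_left]
      ring_nf
    simp only [this]
    rw [integral_const_mul, integral_exp_inner_stdGaussian, ← Real.exp_add, norm_smul, mul_pow,
      Real.norm_eq_abs, sq_abs]
  have hm₂ : ∀ t, mgf (innerSL ℝ w)
      ((stdGaussian E).withDensity fun z => ENNReal.ofReal (shiftDensity v z)) t =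
      Real.exp (t * ⟪w, v⟫ + t ^ 2 * ‖w‖ ^ 2 / 2) := by
    intro t
    rw [mgf, integral_withDensity_eq_integral_toReal_smul (by fun_prop) (by simp)]
    have : ∀ z : E, (ENNReal.ofReal (shiftDensity v z)).toReal • Real.exp (t * (innerSL ℝ w) z) =
        Real.exp (-(‖v‖ ^ 2 / 2)) * Real.exp ⟪t • w + v, z⟫ := fun z => by
      rw [ENNReal.toReal_ofReal (shiftDensity_pos v z).le, smul_eq_mul, shiftDensity,
        ← Real.exp_add, ← Real.exp_add, innerSL_apply_apply, inner_add_left, real_inner_smul_left]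
      ring_nf
    simp only [this]
    rw [integral_const_mul, integral_exp_inner_stdGaussian, ← Real.exp_add, norm_add_sq_real,
      norm_smul, mul_pow, Real.norm_eq_abs, sq_abs, real_inner_smul_left]
    ring_nf
  refine Measure.ext_of_complexMGF_eq (by fun_prop) (by fun_prop) ?_
  have hset : integrableExpSet (innerSL ℝ w) ((stdGaussian E).map (fun z => z + v)) = Set.univ := by
    refine Set.eq_univ_of_forall fun t => ?_
    change Integrable _ _
    rw [← mgf_pos_iff, hm₁]
    exact Real.exp_pos _
  funext z
  refine eqOn_complexMGF_of_mgf (funext fun t => (hm₁ t).trans (hm₂ t).symm) ?_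
  change z.re ∈ interior (integrableExpSet (innerSL ℝ w) _)
  rw [hset, interior_univ]
  exact Set.mem_univ _

lemma lintegral_add_stdGaussian (v : E) {h : E → ℝ≥0∞} (hh : Measurable h) :
    ∫⁻ z, h (z + v) ∂(stdGaussian E) =
      ∫⁻ z, ENNReal.ofReal (shiftDensity v z) * h z ∂(stdGaussian E) := by
  rw [← lintegral_map (f := h) hh (by fun_prop : Measurable fun z => z + v), map_add_stdGaussian,
    lintegral_withDensity_eq_lintegral_mul _ (by fun_prop) hh]
  rfl

lemma map_smul_add_smul_stdGaussian {a b : ℝ} (hab : a ^ 2 + b ^ 2 = 1) :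
    ((stdGaussian E).prod (stdGaussian E)).map (fun p => a • p.1 + b • p.2) = stdGaussian E := by
  have : CompleteSpace E := FiniteDimensional.complete ℝ E
  have hprob : IsProbabilityMeasure
      (((stdGaussian E).prod (stdGaussian E)).map (fun p => a • p.1 + b • p.2)) :=
    Measure.isProbabilityMeasure_map (by fun_prop)
  apply Measure.ext_of_charFun
  ext t
  rw [charFun_apply, integral_map (by fun_prop) (by fun_prop)]
  have : ∀ p : E × E, Complex.exp (⟪a • p.1 + b • p.2, t⟫ * Complex.I) =
      Complex.exp (⟪p.1, a • t⟫ * Complex.I) * Complex.exp (⟪p.2, b • t⟫ * Complex.I) := by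
    intro p
    rw [← Complex.exp_add, inner_add_left, real_inner_smul_left, real_inner_smul_left,
      real_inner_smul_right, real_inner_smul_right]
    push_cast
    ring_nf
  simp only [this]
  rw [integral_prod_mul (fun z : E => Complex.exp (⟪z, a • t⟫ * Complex.I))
    (fun z : E => Complex.exp (⟪z, b • t⟫ * Complex.I)), ← charFun_apply, ← charFun_apply,
    charFun_stdGaussian, charFun_stdGaussian, charFun_stdGaussian, ← Complex.exp_add]
  congr 1
  rw [norm_smul, norm_smul, Real.norm_eq_abs, Real.norm_eq_abs]
  push_cast
  rw [mul_pow, mul_pow, ← Complex.ofReal_pow |a|, ← Complex.ofReal_pow |b|, sq_abs, sq_abs]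
  have : (a : ℂ) ^ 2 + (b : ℂ) ^ 2 = 1 := by exact_mod_cast hab
  push_cast
  linear_combination (-(‖t‖ : ℂ) ^ 2 / 2) * this

/-- Hölder's inequality for two mixtures of a Gaussian and its shifts. -/
lemma lintegral_mixture_le {α q K : ℝ} (hα : 1 < α) (hq : 0 ≤ q) (hq1 : q ≤ 1) (hK : 0 ≤ K)
    (v v' : E)
    (hKv : ∫⁻ z, ENNReal.ofReal ((1 - q + q * shiftDensity v z) ^ α *
      (1 - q + q * shiftDensity v' z) ^ (1 - α)) ∂(stdGaussian E) ≤ ENNReal.ofReal K)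
    {g : E → ℝ≥0∞} (hg : Measurable g) :
    ENNReal.ofReal (1 - q) * ∫⁻ z, g z ∂(stdGaussian E) +
      ENNReal.ofReal q * ∫⁻ z, g (z + v) ∂(stdGaussian E) ≤
    ENNReal.ofReal (K ^ (1 / α)) * (ENNReal.ofReal (1 - q) *
        ∫⁻ z, g z ^ (α / (α - 1)) ∂(stdGaussian E) +
      ENNReal.ofReal q * ∫⁻ z, g (z + v') ^ (α / (α - 1)) ∂(stdGaussian E)) ^ ((α - 1) / α) := by
  have hα1 : 0 < α - 1 := by linarith
  have hα0 : 0 < α := by linarith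
  have hpos : ∀ u z : E, 0 < 1 - q + q * shiftDensity u z := by
    intro u z
    have h1 := shiftDensity_pos u z
    rcases hq.eq_or_lt with h | h
    · simp [← h]
    · have := mul_pos h h1
      linarith
  have hmix : ∀ (u : E) {g : E → ℝ≥0∞}, Measurable g →
      ENNReal.ofReal (1 - q) * ∫⁻ z, g z ∂(stdGaussian E) +
        ENNReal.ofReal q * ∫⁻ z, g (z + u) ∂(stdGaussian E) =
      ∫⁻ z, ENNReal.ofReal (1 - q + q * shiftDensity u z) * g z ∂(stdGaussian E) := by
    intro u g hg
    rw [lintegral_add_stdGaussian u hg, ← lintegral_const_mul _ hg,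
      ← lintegral_const_mul _ (by fun_prop), ← lintegral_add_left (by fun_prop)]
    refine lintegral_congr fun z => ?_
    rw [ENNReal.ofReal_add (by linarith) (mul_nonneg hq (shiftDensity_pos u z).le),
      ENNReal.ofReal_mul hq]
    ring
  have hgβ : Measurable fun z => g z ^ (α / (α - 1)) := hg.pow_const _
  rw [hmix v hg, hmix v' hgβ]
  have hconj : α.HolderConjugate (α / (α - 1)) := Real.HolderConjugate.conjExponent hα
  -- With p, r the two mixture densities, p g = (p r^(-1/β)) (r^(1/β) g). Hölder then produces
  -- exactly the moment ∫ p^α r^(1-α) and the L^β norm of g under r.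
  set A : E → ℝ≥0∞ := fun z => ENNReal.ofReal ((1 - q + q * shiftDensity v z) *
    (1 - q + q * shiftDensity v' z) ^ (-((α - 1) / α)))
  set B : E → ℝ≥0∞ := fun z =>
    ENNReal.ofReal ((1 - q + q * shiftDensity v' z) ^ ((α - 1) / α)) * g z
  have hA : Measurable A := by unfold A; fun_prop
  have hB : Measurable B := by unfold B; fun_prop
  have hold := ENNReal.lintegral_mul_le_Lp_mul_Lq (stdGaussian E) hconj hA.aemeasurable
    hB.aemeasurable
  have hAB : ∀ z, (A * B) z = ENNReal.ofReal (1 - q + q * shiftDensity v z) * g z := by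
    intro z
    simp only [A, B, Pi.mul_apply]
    rw [← mul_assoc, ← ENNReal.ofReal_mul (mul_nonneg (hpos v z).le
      (Real.rpow_nonneg (hpos v' z).le _)), mul_assoc (1 - q + q * shiftDensity v z),
      ← Real.rpow_add (hpos v' z), neg_add_cancel, Real.rpow_zero, mul_one]
  have hAα : ∀ z, A z ^ α = ENNReal.ofReal ((1 - q + q * shiftDensity v z) ^ α *
      (1 - q + q * shiftDensity v' z) ^ (1 - α)) := by
    intro z
    simp only [A]
    rw [ENNReal.ofReal_rpow_of_nonneg (mul_nonneg (hpos v z).le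
      (Real.rpow_nonneg (hpos v' z).le _)) hα0.le, Real.mul_rpow (hpos v z).le
      (Real.rpow_nonneg (hpos v' z).le _), ← Real.rpow_mul (hpos v' z).le]
    congr 3
    field_simp
    ring
  have hBβ : ∀ z, B z ^ (α / (α - 1)) =
      ENNReal.ofReal (1 - q + q * shiftDensity v' z) * g z ^ (α / (α - 1)) := by
    intro z
    simp only [B]
    rw [ENNReal.mul_rpow_of_nonneg _ _ (by positivity), ENNReal.ofReal_rpow_of_nonneg
      (Real.rpow_nonneg (hpos v' z).le _) (by positivity), ← Real.rpow_mul (hpos v' z).le,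
      div_mul_div_cancel₀ hα0.ne', div_self hα1.ne', Real.rpow_one]
  simp only [hAB, hAα, hBβ] at hold
  refine hold.trans ?_
  rw [one_div_div]
  refine mul_le_mul_left ?_ _
  rw [← ENNReal.ofReal_rpow_of_nonneg hK (by positivity)]
  exact ENNReal.rpow_le_rpow hKv (by positivity)

lemma lintegral_shift_le {α : ℝ} (hα : 1 < α) (v : E) {g : E → ℝ≥0∞} (hg : Measurable g) :
    ∫⁻ z, g (z + v) ∂(stdGaussian E) ≤ ENNReal.ofReal (Real.exp ((α - 1) * ‖v‖ ^ 2 / 2)) *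
      (∫⁻ z, g z ^ (α / (α - 1)) ∂(stdGaussian E)) ^ ((α - 1) / α) := by
  have hα0 : 0 < α := by linarith
  have h := lintegral_mixture_le (q := 1) (K := Real.exp (α * (α - 1) * ‖v‖ ^ 2 / 2)) hα
    zero_le_one le_rfl (Real.exp_pos _).le v 0
    (by simp [shiftDensity_zero, lintegral_shiftDensity_rpow]) hg
  rw [← Real.exp_mul, show α * (α - 1) * ‖v‖ ^ 2 / 2 * (1 / α) = (α - 1) * ‖v‖ ^ 2 / 2 by
    field_simp] at h
  simpa using h

/-- One noisy step: a quarter of the variance of the noise hides the distance of the base points,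
the rest hides the subsampled shifts. -/
theorem lintegral_noisy_step_le {α q K δ τ r : ℝ} (hα : 1 < α) (hq : 0 ≤ q) (hq1 : q ≤ 1)
    (hK : 0 ≤ K) (hτ : 0 < τ)
    (hKv : ∀ v v' : E, ‖v‖ ≤ δ → ‖v'‖ ≤ δ →
      ∫⁻ z, ENNReal.ofReal ((1 - q + q * shiftDensity v z) ^ α *
        (1 - q + q * shiftDensity v' z) ^ (1 - α)) ∂(stdGaussian E) ≤ ENNReal.ofReal K)
    {x y u u' : E} (hu : ‖u‖ ≤ τ * (√3 / 2) * δ) (hu' : ‖u'‖ ≤ τ * (√3 / 2) * δ)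
    (hxy : ‖x - y‖ ≤ r) {h : E → ℝ≥0∞} (hh : Measurable h) :
    ENNReal.ofReal (1 - q) * ∫⁻ z, h (x - τ • z) ∂(stdGaussian E) +
      ENNReal.ofReal q * ∫⁻ z, h (x + u - τ • z) ∂(stdGaussian E) ≤
    ENNReal.ofReal (Real.exp (2 * (α - 1) * r ^ 2 / τ ^ 2) * K ^ (1 / α)) *
      (ENNReal.ofReal (1 - q) * ∫⁻ z, h (y - τ • z) ^ (α / (α - 1)) ∂(stdGaussian E) +
      ENNReal.ofReal q * ∫⁻ z, h (y + u' - τ • z) ^ (α / (α - 1)) ∂(stdGaussian E)) ^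
        ((α - 1) / α) := by
  have hα1 : 0 < α - 1 := by linarith
  have hα0 : 0 < α := by linarith
  have h3 : (0 : ℝ) < √3 / 2 := by positivity
  have hb : 0 < τ * (√3 / 2) := by positivity
  have hhβ : Measurable fun y => h y ^ (α / (α - 1)) := hh.pow_const _
  have hsplit : ∀ (g : E → ℝ≥0∞) (_ : Measurable g) (a : E),
      ∫⁻ z, g (a - τ • z) ∂(stdGaussian E) = ∫⁻ z₁, ∫⁻ z₂,
        g (a - (τ / 2) • z₁ - (τ * (√3 / 2)) • z₂) ∂(stdGaussian E) ∂(stdGaussian E) := by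
    intro g hg a
    conv_lhs => rw [← map_smul_add_smul_stdGaussian (E := E) (a := 1 / 2) (b := √3 / 2)
      (by rw [div_pow, div_pow, Real.sq_sqrt (by norm_num)]; norm_num)]
    rw [lintegral_map (by fun_prop) (by fun_prop), lintegral_prod _ (by fun_prop)]
    refine lintegral_congr fun z₁ => lintegral_congr fun z₂ => ?_
    congr 1
    module
  have hmeas : ∀ (g : E → ℝ≥0∞) (_ : Measurable g) (c : E), Measurable fun a =>
      ∫⁻ z₂, g (a + c - (τ * (√3 / 2)) • z₂) ∂(stdGaussian E) := by
    intro g hg c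
    exact Measurable.lintegral_prod_right'
      (f := fun p : E × E => g (p.1 + c - (τ * (√3 / 2)) • p.2)) (by fun_prop)
  set G : (E → ℝ≥0∞) → E → E → ℝ≥0∞ := fun g c a =>
    ENNReal.ofReal (1 - q) * ∫⁻ z, g (a + 0 - (τ * (√3 / 2)) • z) ∂(stdGaussian E) +
      ENNReal.ofReal q * ∫⁻ z, g (a + c - (τ * (√3 / 2)) • z) ∂(stdGaussian E) with hG
  have hGm : ∀ (g : E → ℝ≥0∞) (_ : Measurable g) (c : E), Measurable (G g c) := fun g hg c =>
    ((hmeas g hg 0).const_mul _).add ((hmeas g hg c).const_mul _)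
  have hmix : ∀ (g : E → ℝ≥0∞) (_ : Measurable g) (a c : E),
      ENNReal.ofReal (1 - q) * ∫⁻ z, g (a - τ • z) ∂(stdGaussian E) +
        ENNReal.ofReal q * ∫⁻ z, g (a + c - τ • z) ∂(stdGaussian E) =
      ∫⁻ z₁, G g c (a - (τ / 2) • z₁) ∂(stdGaussian E) := by
    intro g hg a c
    have m : ∀ c : E, Measurable fun z₁ : E => ∫⁻ z₂,
        g (a - (τ / 2) • z₁ + c - (τ * (√3 / 2)) • z₂) ∂(stdGaussian E) := fun c =>
      (hmeas g hg c).comp (f := fun z₁ => a - (τ / 2) • z₁) (by fun_prop)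
    rw [hsplit g hg, hsplit g hg, hG, lintegral_add_left ((m 0).const_mul _),
      lintegral_const_mul _ (m 0), lintegral_const_mul _ (m c)]
    simp only [add_zero]
    congr 4
    funext z₁
    congr 1
    funext z₂
    congr 1
    abel
  -- With the first part of the noise frozen, both mixtures start at the same point `a`, and only
  -- the shifts remain to be hidden.
  have hGle : ∀ a, G h u a ≤ ENNReal.ofReal (K ^ (1 / α)) *
      G (fun y => h y ^ (α / (α - 1))) u' a ^ ((α - 1) / α) := by
    intro a
    have hscale : ∀ c : E, ‖c‖ ≤ τ * (√3 / 2) * δ → ‖-((τ * (√3 / 2))⁻¹ • c)‖ ≤ δ := by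
      intro c hc
      rw [norm_neg, norm_smul, norm_inv, Real.norm_of_nonneg hb.le, inv_mul_le_iff₀ hb]
      exact hc
    have key := lintegral_mixture_le hα hq hq1 hK _ _ (hKv _ _ (hscale u hu) (hscale u' hu'))
      (g := fun z => h (a - (τ * (√3 / 2)) • z)) (by fun_prop)
    have e : ∀ c z : E, a - (τ * (√3 / 2)) • (z + -((τ * (√3 / 2))⁻¹ • c)) =
        a + c - (τ * (√3 / 2)) • z := by
      intro c z
      rw [smul_add, smul_neg, smul_smul, mul_inv_cancel₀ hb.ne', one_smul]
      abel
    simp only [e] at key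
    simpa only [hG, add_zero] using key
  rw [hmix h hh, hmix _ hhβ]
  set H := G (fun y => h y ^ (α / (α - 1))) u' with hH
  have hHm : Measurable H := hGm _ hhβ u'
  -- The displacement x - y is measured against standard deviation τ/2, which gives the exponent
  -- 2(α-1)‖x - y‖²/τ². The test function is H^(1/β), so that its β-th power is H again.
  have hshift := lintegral_shift_le hα (-((τ / 2)⁻¹ • (x - y)))
    (g := fun z => H (y - (τ / 2) • z) ^ ((α - 1) / α)) (by fun_prop)
  have e : ∀ z : E, y - (τ / 2) • (z + -((τ / 2)⁻¹ • (x - y))) = x - (τ / 2) • z := by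
    intro z
    rw [smul_add, smul_neg, smul_smul, mul_inv_cancel₀ (by positivity), one_smul]
    abel
  have hpow : ∀ y : ℝ≥0∞, (y ^ ((α - 1) / α)) ^ (α / (α - 1)) = y := fun y => by
    rw [← ENNReal.rpow_mul, div_mul_div_cancel₀ (by linarith), div_self hα1.ne',
      ENNReal.rpow_one]
  simp only [e, hpow] at hshift
  calc ∫⁻ z₁, G h u (x - (τ / 2) • z₁) ∂(stdGaussian E)
      ≤ ∫⁻ z₁, ENNReal.ofReal (K ^ (1 / α)) * H (x - (τ / 2) • z₁) ^ ((α - 1) / α)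
          ∂(stdGaussian E) := lintegral_mono fun z₁ => hGle _
    _ = ENNReal.ofReal (K ^ (1 / α)) * ∫⁻ z₁, H (x - (τ / 2) • z₁) ^ ((α - 1) / α)
          ∂(stdGaussian E) := lintegral_const_mul _ (by fun_prop)
    _ ≤ ENNReal.ofReal (K ^ (1 / α)) * (ENNReal.ofReal (Real.exp (2 * (α - 1) * r ^ 2 / τ ^ 2)) *
          (∫⁻ z, H (y - (τ / 2) • z) ∂(stdGaussian E)) ^ ((α - 1) / α)) := by
        refine mul_le_mul_right (hshift.trans (mul_le_mul_left ?_ _)) _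
        refine ENNReal.ofReal_le_ofReal (Real.exp_le_exp.2 ?_)
        rw [norm_neg, norm_smul, norm_inv, Real.norm_of_nonneg (by positivity), mul_pow]
        have : ‖x - y‖ ^ 2 ≤ r ^ 2 := by gcongr
        calc (α - 1) * ((τ / 2)⁻¹ ^ 2 * ‖x - y‖ ^ 2) / 2
            = 2 * (α - 1) * ‖x - y‖ ^ 2 / τ ^ 2 := by field_simp
          _ ≤ _ := by gcongr
    _ = _ := by
        rw [ENNReal.ofReal_mul (Real.exp_pos _).le]
        ring

end Gaussian

/-! ### Taylor bounds for powers of mixture densities -/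

section PowerInequalities

/-- The hypothesis on k keeps k^(α-1) below e^c, so the second-order coefficient stays of order
α(α-1), with no exponential growth in α. Bernoulli's inequality, in its concave form for α ≤ 2 and
its convex form for α ≥ 2, replaces differentiation. -/
lemma rpow_le_one_add_mul_add_sq {α c k : ℝ} (hα : 1 < α) (hc : 0 ≤ c) (hk : 0 ≤ k)
    (hkc : k - 1 ≤ c / (α - 1)) :
    k ^ α ≤ 1 + α * (k - 1) + Real.exp c * (α * (α - 1)) * (k - 1) ^ 2 := by
  have hθ : 0 < α - 1 := by linarith
  have hec : 1 ≤ Real.exp c := Real.one_le_exp hc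
  rcases hk.eq_or_lt with h0 | hk0
  · rw [← h0, Real.zero_rpow (by linarith)]
    nlinarith [mul_le_mul_of_nonneg_right hec (by positivity : 0 ≤ α * (α - 1))]
  have hsplit : k ^ α = k * k ^ (α - 1) := by
    conv_lhs => rw [show α = 1 + (α - 1) by ring, Real.rpow_add hk0, Real.rpow_one]
  rcases le_total α 2 with h2 | h2
  · have h1 := rpow_one_add_le_one_add_mul_self (s := k - 1) (p := α - 1) (by linarith) hθ.le
      (by linarith)
    rw [add_sub_cancel] at h1
    have h3 := mul_le_mul_of_nonneg_left h1 hk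
    have h4 : (α - 1) * (k - 1) ^ 2 ≤ Real.exp c * (α * (α - 1)) * (k - 1) ^ 2 := by
      have h5 : 1 ≤ Real.exp c * α := one_le_mul_of_one_le_of_one_le hec hα.le
      have h6 := mul_le_mul_of_nonneg_right h5 (mul_nonneg hθ.le (sq_nonneg (k - 1)))
      linarith
    rw [hsplit]
    nlinarith
  · have hθ1 : 1 ≤ α - 1 := by linarith
    set θ := α - 1 with hθdef
    have hkθ : 0 < k ^ θ := Real.rpow_pos_of_pos hk0 θ
    have hinv : k * (k ^ θ - 1) ≤ θ * k ^ θ * (k - 1) := by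
      have h1 := one_add_mul_self_le_rpow_one_add (s := k⁻¹ - 1) (p := θ)
        (by have := inv_pos.2 hk0; linarith) hθ1
      rw [add_sub_cancel, Real.inv_rpow hk] at h1
      have h5 := mul_le_mul_of_nonneg_right h1 (mul_pos hkθ hk0).le
      have e1 : (k ^ θ)⁻¹ * (k ^ θ * k) = k := by field_simp
      have e2 : (1 + θ * (k⁻¹ - 1)) * (k ^ θ * k) = k ^ θ * k + θ * k ^ θ * (1 - k) := by
        field_simp
      rw [e1, e2] at h5
      linarith
    have hmain : θ * (k - 1) * (k ^ θ - 1) ≤ Real.exp c * θ ^ 2 * (k - 1) ^ 2 := by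
      rcases le_total 1 k with h1 | h1
      · have hexp : k ^ θ ≤ Real.exp c := by
          have : k ≤ Real.exp (c / θ) := by
            have := Real.add_one_le_exp (c / θ)
            linarith
          calc k ^ θ ≤ Real.exp (c / θ) ^ θ := Real.rpow_le_rpow hk this hθ.le
            _ = Real.exp c := by rw [← Real.exp_mul, div_mul_cancel₀ _ hθ.ne']
        have h6 : k ^ θ - 1 ≤ θ * Real.exp c * (k - 1) := by
          have h7 : 0 ≤ k ^ θ - 1 := by
            have := Real.one_le_rpow h1 hθ.le
            linarith
          calc k ^ θ - 1 ≤ k * (k ^ θ - 1) := by nlinarith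
            _ ≤ θ * k ^ θ * (k - 1) := hinv
            _ ≤ θ * Real.exp c * (k - 1) := by
              have : 0 ≤ k - 1 := by linarith
              gcongr
        have h8 : 0 ≤ θ * (k - 1) := mul_nonneg hθ.le (by linarith)
        calc _ ≤ θ * (k - 1) * (θ * Real.exp c * (k - 1)) := by gcongr
          _ = _ := by ring
      · have h3 := one_add_mul_self_le_rpow_one_add (s := k - 1) (p := θ) (by linarith) hθ1
        rw [add_sub_cancel] at h3
        have h4 : 0 ≤ θ * (1 - k) := mul_nonneg hθ.le (by linarith)
        have h5 : θ * (1 - k) * (1 - k ^ θ) ≤ θ * (1 - k) * (θ * (1 - k)) := by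
          gcongr
          linarith
        have h6 : 0 ≤ θ ^ 2 * (k - 1) ^ 2 := by positivity
        nlinarith
    have h9 : Real.exp c * θ ^ 2 * (k - 1) ^ 2 ≤ Real.exp c * (α * θ) * (k - 1) ^ 2 := by
      gcongr
      nlinarith
    rw [hsplit]
    nlinarith

/-- The left side equals (1+b) k^α with k = (1+a)/(1+b), where the one-variable bound applies with c
= 3/2. The constant is 12 = 5 · 12/5, from e^(3/2) ≤ 5 and 1 + b ≥ 7/8. -/
lemma one_add_rpow_mul_rpow_le {α a b : ℝ} (hα : 1 < α) (hp0 : 0 < 1 + a)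
    (ha1 : a ≤ 1 / (α - 1)) (hb8 : -(1 / 8) ≤ b) (hbad : -(1 / (4 * α)) ≤ b) :
    (1 + a) ^ α * (1 + b) ^ (1 - α) ≤
      1 + α * a - (α - 1) * b + 12 * (α * (α - 1)) * (a ^ 2 + b ^ 2) := by
  have hθ : 0 < α - 1 := by linarith
  have hr0 : 0 < 1 + b := by linarith
  have hk0 : 0 ≤ (1 + a) / (1 + b) := by positivity
  have hk1 : (1 + a) / (1 + b) - 1 = (a - b) / (1 + b) := by field_simp; ring
  have hr78 : 7 / 8 ≤ 1 + b := by linarith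
  have hab : a - b ≤ 5 / 4 * (1 / (α - 1)) := by
    have : 1 / (4 * α) ≤ 1 / 4 * (1 / (α - 1)) := by
      rw [← one_div_mul_one_div]
      gcongr
      linarith
    linarith
  have hkc : (1 + a) / (1 + b) - 1 ≤ 3 / 2 / (α - 1) := by
    rw [hk1, div_le_iff₀ hr0]
    have h1 : 0 < 1 / (α - 1) := by positivity
    calc a - b ≤ 5 / 4 * (1 / (α - 1)) := hab
      _ ≤ 3 / 2 * (1 / (α - 1)) * (1 + b) := by nlinarith
      _ = _ := by ring
  have h := rpow_le_one_add_mul_add_sq hα (by norm_num) hk0 hkc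
  have hF : (1 + a) ^ α * (1 + b) ^ (1 - α) = (1 + b) * ((1 + a) / (1 + b)) ^ α := by
    rw [Real.div_rpow hp0.le hr0.le, Real.rpow_sub hr0, Real.rpow_one]
    field_simp
  have hexp : Real.exp (3 / 2) ≤ 5 := by
    have h1 : Real.exp (3 / 2) ^ 2 = Real.exp 1 ^ 3 := by
      rw [← Real.exp_nat_mul, ← Real.exp_nat_mul]; norm_num
    have h2 := Real.exp_one_lt_d9
    have h3 : Real.exp 1 ^ 3 ≤ 2.72 ^ 3 := by gcongr; linarith
    have h4 := Real.exp_pos (3 / 2)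
    nlinarith
  have hkey : (1 + b) * ((1 + a) / (1 + b)) ^ α ≤
      1 + α * a - (α - 1) * b + 12 * (α * (α - 1)) * (a ^ 2 + b ^ 2) := by
    calc (1 + b) * ((1 + a) / (1 + b)) ^ α
        ≤ (1 + b) * (1 + α * ((a - b) / (1 + b)) +
          Real.exp (3 / 2) * (α * (α - 1)) * ((a - b) / (1 + b)) ^ 2) := by
          rw [hk1] at h
          gcongr
      _ = 1 + α * a - (α - 1) * b +
          Real.exp (3 / 2) * (α * (α - 1)) * ((a - b) ^ 2 / (1 + b)) := by
          field_simp
          ring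
      _ ≤ 1 + α * a - (α - 1) * b +
          5 * (α * (α - 1)) * (12 / 5 * (a ^ 2 + b ^ 2)) := by
          have h1 : (a - b) ^ 2 / (1 + b) ≤ 12 / 5 * (a ^ 2 + b ^ 2) := by
            rw [div_le_iff₀ hr0]
            nlinarith [sq_nonneg (a + b), mul_nonneg (add_nonneg (sq_nonneg a) (sq_nonneg b))
              (sub_nonneg.2 hr78)]
          gcongr
      _ = _ := by ring
  rw [hF]
  exact hkey

lemma one_add_rpow_le_six {α a : ℝ} (hα : 2 < α) (hp0 : 0 < 1 + a) (ha1 : a ≤ 1 / (α - 1)) :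
    (1 + a) ^ α ≤ 6 := by
  have hθ : 0 < α - 1 := by linarith
  have h5 : 1 + a ≤ Real.exp (1 / (α - 1)) := by
    have := Real.add_one_le_exp (1 / (α - 1))
    linarith
  have h6 : 1 + a ≤ 2 := by
    have : 1 / (α - 1) ≤ 1 := by rw [div_le_one hθ]; linarith
    linarith
  have h7 : (1 + a) ^ (α - 1) ≤ Real.exp 1 := by
    calc (1 + a) ^ (α - 1) ≤ Real.exp (1 / (α - 1)) ^ (α - 1) :=
          Real.rpow_le_rpow hp0.le h5 hθ.le
      _ = Real.exp 1 := by rw [← Real.exp_mul, div_mul_cancel₀ _ hθ.ne']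
  have h8 : (1 + a) ^ α = (1 + a) * (1 + a) ^ (α - 1) := by
    conv_lhs => rw [show α = 1 + (α - 1) by ring, Real.rpow_add hp0, Real.rpow_one]
  have h9 := Real.exp_one_lt_d9
  have h10 : 0 ≤ (1 + a) ^ (α - 1) := by positivity
  rw [h8]
  nlinarith

/-- Where a Chernoff term alone dominates, the Taylor polynomial still stands in the bound, so it
must not be negative there. Completing a square shows this. -/
lemma taylor_nonneg_of_pos {α a b : ℝ} (hα : 1 < α) (ha : 0 < a) :
    0 ≤ 1 + α * a - (α - 1) * b + 12 * (α * (α - 1)) * (a ^ 2 + b ^ 2) := by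
  have hθ : 0 < α - 1 := by linarith
  have h1 : 0 ≤ α * a := by positivity
  have h2 : 0 ≤ 12 * (α * (α - 1)) * a ^ 2 := by positivity
  have h3 : (α - 1) * (α - 1) * b ^ 2 ≤ α * (α - 1) * b ^ 2 := by
    gcongr
    linarith
  nlinarith [sq_nonneg ((α - 1) * b - 1)]

lemma taylor_nonneg_of_neg {α a b : ℝ} (hα : 2 < α) (hb : b < 0) :
    0 ≤ 1 + α * a - (α - 1) * b + 12 * (α * (α - 1)) * (a ^ 2 + b ^ 2) := by
  have h1 : 0 ≤ -((α - 1) * b) := by nlinarith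
  have h2 : 0 ≤ 12 * (α * (α - 1)) * b ^ 2 := by
    have : 0 < α - 1 := by linarith
    positivity
  have h3 : α / 2 * α * a ^ 2 ≤ (α - 1) * α * a ^ 2 := by
    gcongr
    linarith
  nlinarith [sq_nonneg (α * a + 1)]

/-- A pointwise bound on `p ^ α * r ^ (1 - α)` for the densities `p = 1 - q + q t` and
`r = 1 - q + q t'`: the second-order Taylor polynomial, up to constants, and Chernoff terms for
the events that `t` is large or `t'` is small. -/
lemma mixture_rpow_mul_rpow_le {α q t t' B lam : ℝ} (hα : 1 < α) (hq : 0 < q) (hq8 : q ≤ 1 / 8)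
    (ht : 0 < t) (ht' : 0 < t') (hB : α ≤ B) (hlam : 0 ≤ lam) :
    (1 - q + q * t) ^ α * (1 - q + q * t') ^ (1 - α) ≤
      1 + α * q * (t - 1) - (α - 1) * q * (t' - 1) +
        12 * (α * (α - 1)) * q ^ 2 * ((t - 1) ^ 2 + (t' - 1) ^ 2) +
        Real.exp (2 * (q * (α - 1))) * (α * q) ^ α *
          Real.exp (-((B - α) * logTerm q α)) * t ^ B +
        (if 1 < 4 * α * q then 6 * Real.exp (2 * (q * (α - 1))) *
          Real.exp (-(lam * (1 / (4 * α * q)))) * t' ^ (-lam) else 0) := by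
  have hθ : 0 < α - 1 := by linarith
  have hqθ : 0 < q * (α - 1) := mul_pos hq hθ
  have hα0 : 0 < α := by linarith
  obtain ⟨a, ha⟩ : ∃ a, a = q * (t - 1) := ⟨_, rfl⟩
  obtain ⟨b, hb⟩ : ∃ b, b = q * (t' - 1) := ⟨_, rfl⟩
  have hp : 1 - q + q * t = 1 + a := by rw [ha]; ring
  have hr : 1 - q + q * t' = 1 + b := by rw [hb]; ring
  have haq : -q < a := by rw [ha]; nlinarith
  have hbq : -q < b := by rw [hb]; nlinarith
  have hquad : 1 + α * q * (t - 1) - (α - 1) * q * (t' - 1) +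
      12 * (α * (α - 1)) * q ^ 2 * ((t - 1) ^ 2 + (t' - 1) ^ 2) =
      1 + α * a - (α - 1) * b + 12 * (α * (α - 1)) * (a ^ 2 + b ^ 2) := by
    rw [ha, hb]; ring
  rw [hp, hr, hquad]
  have hp0 : 0 < 1 + a := by linarith
  have hr0 : 0 < 1 + b := by linarith
  have hC1 : 0 ≤ Real.exp (2 * (q * (α - 1))) * (α * q) ^ α *
      Real.exp (-((B - α) * logTerm q α)) * t ^ B := by positivity
  have hC2 : 0 ≤ (if 1 < 4 * α * q then 6 * Real.exp (2 * (q * (α - 1))) *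
      Real.exp (-(lam * (1 / (4 * α * q)))) * t' ^ (-lam) else 0) := by
    split_ifs <;> positivity
  have hr_rpow : (1 + b) ^ (1 - α) ≤ Real.exp (2 * (q * (α - 1))) := by
    have h1 : Real.exp (-(2 * q)) ≤ 1 + b := by
      rw [Real.exp_neg, inv_le_iff_one_le_mul₀ (Real.exp_pos _)]
      have := Real.add_one_le_exp (2 * q)
      nlinarith
    calc (1 + b) ^ (1 - α) ≤ Real.exp (-(2 * q)) ^ (1 - α) :=
          Real.rpow_le_rpow_of_nonpos (Real.exp_pos _) h1 (by linarith)
      _ = _ := by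
          rw [← Real.exp_mul]
          ring_nf
  -- The threshold is exp(`logTerm q α`). Above it, 1 + a ≤ α q t, and exponents are raised from α
  -- to B at the price e^(-(B-α) logTerm).
  by_cases htail : 1 + 1 / (q * (α - 1)) < t
  · have ha0 : 0 < a := by
      have : 0 < 1 / (q * (α - 1)) := by positivity
      rw [ha]
      exact mul_pos hq (by linarith)
    have hQ := taylor_nonneg_of_pos (b := b) hα ha0
    have hpt : 1 + a ≤ α * q * t := by
      have h1 : 1 + 1 / (q * (α - 1)) ≤ t := htail.le
      have h2 := mul_le_mul_of_nonneg_left h1 hqθ.le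
      have h3 : q * (α - 1) * (1 + 1 / (q * (α - 1))) = q * (α - 1) + 1 := by field_simp
      rw [ha]
      nlinarith
    have hF : (1 + a) ^ α * (1 + b) ^ (1 - α) ≤
        Real.exp (2 * (q * (α - 1))) * (α * q) ^ α *
          Real.exp (-((B - α) * logTerm q α)) * t ^ B := by
      have h1 : (1 + a) ^ α ≤ (α * q) ^ α * t ^ α := by
        rw [← Real.mul_rpow (by positivity) ht.le]
        exact Real.rpow_le_rpow hp0.le hpt hα0.le
      have h2 : t ^ α ≤ Real.exp (-((B - α) * logTerm q α)) * t ^ B := by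
        have h3 : Real.exp ((B - α) * logTerm q α) ≤ t ^ (B - α) := by
          rw [mul_comm, Real.exp_mul, logTerm, Real.exp_log (by positivity)]
          exact Real.rpow_le_rpow (by positivity) htail.le (by linarith)
        rw [Real.exp_neg, ← div_eq_inv_mul, le_div_iff₀ (Real.exp_pos _)]
        calc t ^ α * Real.exp ((B - α) * logTerm q α) ≤ t ^ α * t ^ (B - α) := by gcongr
          _ = t ^ B := by rw [← Real.rpow_add ht]; ring_nf
      calc (1 + a) ^ α * (1 + b) ^ (1 - α)
          ≤ ((α * q) ^ α * (Real.exp (-((B - α) * logTerm q α)) * t ^ B)) *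
            Real.exp (2 * (q * (α - 1))) := by
            gcongr
            exact h1.trans (by gcongr)
        _ = _ := by ring
    linarith
  · have ha1 : a ≤ 1 / (α - 1) := by
      have h1 : t - 1 ≤ 1 / (q * (α - 1)) := by linarith
      calc a ≤ q * (1 / (q * (α - 1))) := by rw [ha]; gcongr
        _ = _ := by field_simp
    -- As b > -q, this event is empty unless 4αq > 1, which explains the conditional term. On it t'
    -- ≤ e^(-1/(4αq)), hence the negative power of t'.
    by_cases hbad : b < -(1 / (4 * α))
    · have h4 : 1 < 4 * α * q := by
        have h1 : 1 / (4 * α) < q := by linarith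
        rw [div_lt_iff₀ (by positivity)] at h1
        linarith
      have hα2 : 2 < α := by nlinarith
      have hb0 : b < 0 := by
        have : 0 < 1 / (4 * α) := by positivity
        linarith
      have hQ := taylor_nonneg_of_neg (a := a) hα2 hb0
      have hF : (1 + a) ^ α * (1 + b) ^ (1 - α) ≤ 6 * Real.exp (2 * (q * (α - 1))) *
          Real.exp (-(lam * (1 / (4 * α * q)))) * t' ^ (-lam) := by
        have h1 : (1 + a) ^ α ≤ 6 := one_add_rpow_le_six hα2 hp0 ha1
        have h2 : 1 ≤ Real.exp (-(lam * (1 / (4 * α * q)))) * t' ^ (-lam) := by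
          have h5 : t' ≤ Real.exp (-(1 / (4 * α * q))) := by
            have h6 := Real.add_one_le_exp (-(1 / (4 * α * q)))
            have h7 : t' - 1 ≤ -(1 / (4 * α * q)) := by
              have h8 : q * (t' - 1) ≤ q * (-(1 / (4 * α * q))) := by
                have : q * (-(1 / (4 * α * q))) = -(1 / (4 * α)) := by field_simp
                rw [this]
                exact hb ▸ hbad.le
              exact le_of_mul_le_mul_left h8 hq
            linarith
          have h6 : Real.exp (lam * (1 / (4 * α * q))) ≤ t' ^ (-lam) := by
            calc Real.exp (lam * (1 / (4 * α * q)))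
                = Real.exp (-(1 / (4 * α * q))) ^ (-lam) := by
                  rw [← Real.exp_mul]; ring_nf
              _ ≤ t' ^ (-lam) := Real.rpow_le_rpow_of_nonpos ht' h5 (by linarith)
          rw [Real.exp_neg, ← div_eq_inv_mul, le_div_iff₀ (Real.exp_pos _), one_mul]
          exact h6
        calc (1 + a) ^ α * (1 + b) ^ (1 - α) ≤ 6 * Real.exp (2 * (q * (α - 1))) * 1 := by
              rw [mul_one]; gcongr
          _ ≤ 6 * Real.exp (2 * (q * (α - 1))) *
              (Real.exp (-(lam * (1 / (4 * α * q)))) * t' ^ (-lam)) := by gcongr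
          _ = _ := by ring
      rw [if_pos h4] at hC2 ⊢
      linarith
    · push Not at hbad
      have := one_add_rpow_mul_rpow_le hα hp0 ha1 (by linarith) hbad
      linarith

end PowerInequalities

/-! ### Integrating the pointwise bound -/

section Subsampled

variable {E : Type*} [NormedAddCommGroup E] [InnerProductSpace ℝ E] [FiniteDimensional ℝ E]
  [MeasurableSpace E] [BorelSpace E]

lemma integrable_shiftDensity_sub_one_sq (v : E) :
    Integrable (fun z => (shiftDensity v z - 1) ^ 2) (stdGaussian E) := by
  have h2 := integrable_shiftDensity_rpow v 2
  have h : ∀ z, (shiftDensity v z - 1) ^ 2 =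
      shiftDensity v z ^ (2 : ℝ) - 2 * shiftDensity v z + 1 := fun z => by
    rw [Real.rpow_two]; ring
  simp only [h]
  exact (h2.sub ((integrable_shiftDensity v).const_mul 2)).add (integrable_const _)

lemma integral_shiftDensity_sub_one_sq_le {v : E} {δ : ℝ} (hv : ‖v‖ ≤ δ) (hδ : δ ^ 2 ≤ 1) :
    ∫ z, (shiftDensity v z - 1) ^ 2 ∂(stdGaussian E) ≤ 2 * δ ^ 2 := by
  have h2 := integrable_shiftDensity_rpow v 2
  have h : ∀ z, (shiftDensity v z - 1) ^ 2 =
      shiftDensity v z ^ (2 : ℝ) - 2 * shiftDensity v z + 1 := fun z => by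
    rw [Real.rpow_two]; ring
  have h3 := (integrable_shiftDensity v).const_mul 2
  simp only [h]
  have s₁ := integral_add (h2.sub h3) (integrable_const (1 : ℝ))
  simp only [Pi.sub_apply] at s₁
  rw [s₁, integral_sub h2 h3, integral_const_mul,
    integral_shiftDensity, integral_shiftDensity_rpow]
  have hv2 : ‖v‖ ^ 2 ≤ δ ^ 2 := by gcongr
  have h4 := Real.abs_exp_sub_one_le (x := ‖v‖ ^ 2) (by rw [abs_of_nonneg (by positivity)]; linarith)
  rw [abs_of_nonneg (by positivity : 0 ≤ ‖v‖ ^ 2)] at h4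
  have h5 := le_abs_self (Real.exp (‖v‖ ^ 2) - 1)
  have h6 : (2 : ℝ) * (2 - 1) * ‖v‖ ^ 2 / 2 = ‖v‖ ^ 2 := by ring
  rw [h6]
  simp
  linarith

lemma integral_shiftDensity_rpow_le {v : E} {δ a : ℝ} (hv : ‖v‖ ≤ δ) (ha : 0 ≤ a * (a - 1)) :
    ∫ z, shiftDensity v z ^ a ∂(stdGaussian E) ≤ Real.exp (a * (a - 1) * δ ^ 2 / 2) := by
  rw [integral_shiftDensity_rpow]
  gcongr

/-- The linear terms vanish because shift densities have mean 1. Each square integrates to e^(‖v‖²)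
- 1 ≤ 2δ², so 12 becomes 48. -/
lemma lintegral_mixture_rpow_mul_rpow_le {α q δ B lam : ℝ} (hα : 1 < α) (hq : 0 < q)
    (hq8 : q ≤ 1 / 8) (hδ : δ ^ 2 ≤ 1) (hB : α ≤ B) (hlam : 0 ≤ lam) {v v' : E}
    (hv : ‖v‖ ≤ δ) (hv' : ‖v'‖ ≤ δ) :
    ∫⁻ z, ENNReal.ofReal ((1 - q + q * shiftDensity v z) ^ α *
      (1 - q + q * shiftDensity v' z) ^ (1 - α)) ∂(stdGaussian E) ≤
    ENNReal.ofReal (1 + 48 * (α * (α - 1)) * q ^ 2 * δ ^ 2 +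
      Real.exp (2 * (q * (α - 1))) * (α * q) ^ α * Real.exp (-((B - α) * logTerm q α)) *
        Real.exp (B * (B - 1) * δ ^ 2 / 2) +
      (if 1 < 4 * α * q then 6 * Real.exp (2 * (q * (α - 1))) *
        Real.exp (-(lam * (1 / (4 * α * q)))) else 0) *
        Real.exp (lam * (lam + 1) * δ ^ 2 / 2)) := by
  have hθ : 0 < α - 1 := by linarith
  obtain ⟨c₂, hc₂⟩ : ∃ c, c = 12 * (α * (α - 1)) * q ^ 2 := ⟨_, rfl⟩
  obtain ⟨c₃, hc₃⟩ : ∃ c, c = Real.exp (2 * (q * (α - 1))) * (α * q) ^ α *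
    Real.exp (-((B - α) * logTerm q α)) := ⟨_, rfl⟩
  obtain ⟨c₄, hc₄⟩ : ∃ c, c = if 1 < 4 * α * q then 6 * Real.exp (2 * (q * (α - 1))) *
        Real.exp (-(lam * (1 / (4 * α * q)))) else 0 := ⟨_, rfl⟩
  have h2 : 0 ≤ c₂ := by rw [hc₂]; positivity
  have h3 : 0 ≤ c₃ := by rw [hc₃]; positivity
  have h4 : 0 ≤ c₄ := by rw [hc₄]; split_ifs <;> positivity
  set g : E → ℝ := fun z => 1 + α * q * (shiftDensity v z - 1)
    - (α - 1) * q * (shiftDensity v' z - 1)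
    + c₂ * ((shiftDensity v z - 1) ^ 2 + (shiftDensity v' z - 1) ^ 2)
    + c₃ * shiftDensity v z ^ B + c₄ * shiftDensity v' z ^ (-lam) with hg
  have hle : ∀ z, (1 - q + q * shiftDensity v z) ^ α *
      (1 - q + q * shiftDensity v' z) ^ (1 - α) ≤ g z := by
    intro z
    have := mixture_rpow_mul_rpow_le hα hq hq8 (shiftDensity_pos v z) (shiftDensity_pos v' z)
      hB hlam
    rw [← hc₂, ← hc₃] at this
    refine this.trans (le_of_eq ?_)
    rw [hg, hc₄]
    split_ifs <;> ring
  have i₁ : ∀ u : E, Integrable (fun z => shiftDensity u z - 1) (stdGaussian E) := fun u =>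
    (integrable_shiftDensity u).sub (integrable_const _)
  have e₁ : ∀ u : E, ∫ z, (shiftDensity u z - 1) ∂(stdGaussian E) = 0 := fun u => by
    rw [integral_sub (integrable_shiftDensity u) (integrable_const _), integral_shiftDensity]
    simp
  have j₁ := (integrable_const (μ := stdGaussian E) (1 : ℝ)).add ((i₁ v).const_mul (α * q))
  have j₂ := j₁.sub ((i₁ v').const_mul ((α - 1) * q))
  have j₃ := ((integrable_shiftDensity_sub_one_sq v).add
    (integrable_shiftDensity_sub_one_sq v')).const_mul c₂
  have j₄ := (integrable_shiftDensity_rpow v B).const_mul c₃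
  have j₅ := (integrable_shiftDensity_rpow v' (-lam)).const_mul c₄
  have hgi : Integrable g (stdGaussian E) := ((j₂.add j₃).add j₄).add j₅
  calc _ ≤ ∫⁻ z, ENNReal.ofReal (g z) ∂(stdGaussian E) :=
        lintegral_mono fun z => ENNReal.ofReal_le_ofReal (hle z)
    _ = ENNReal.ofReal (∫ z, g z ∂(stdGaussian E)) := by
        refine (ofReal_integral_eq_lintegral_ofReal hgi (Filter.Eventually.of_forall fun z => ?_)).symm
        refine le_trans ?_ (hle z)
        have := shiftDensity_pos v z
        have := shiftDensity_pos v' z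
        have : 0 ≤ 1 - q := by linarith
        simp only [Pi.zero_apply]
        positivity
    _ ≤ _ := by
        refine ENNReal.ofReal_le_ofReal ?_
        have hint : ∫ z, g z ∂(stdGaussian E) = 1 +
            c₂ * (∫ z, (shiftDensity v z - 1) ^ 2 ∂(stdGaussian E) +
              ∫ z, (shiftDensity v' z - 1) ^ 2 ∂(stdGaussian E)) +
            c₃ * ∫ z, shiftDensity v z ^ B ∂(stdGaussian E) +
            c₄ * ∫ z, shiftDensity v' z ^ (-lam) ∂(stdGaussian E) := by
          have s₅ := integral_add ((j₂.add j₃).add j₄) j₅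
          have s₄ := integral_add (j₂.add j₃) j₄
          have s₃ := integral_add j₂ j₃
          have s₂ := integral_sub j₁ ((i₁ v').const_mul ((α - 1) * q))
          have s₁ := integral_add (integrable_const (μ := stdGaussian E) (1 : ℝ))
            ((i₁ v).const_mul (α * q))
          have s₆ := integral_add (integrable_shiftDensity_sub_one_sq v)
            (integrable_shiftDensity_sub_one_sq v')
          simp only [Pi.add_apply, Pi.sub_apply, integral_const_mul, e₁, mul_zero] at s₁ s₂ s₃ s₄ s₅ s₆
          rw [s₆] at s₃
          rw [hg, s₅, s₄, s₃, s₂, s₁]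
          simp
        rw [hint]
        have b₁ := integral_shiftDensity_sub_one_sq_le hv hδ
        have b₂ := integral_shiftDensity_sub_one_sq_le hv' hδ
        have b₃ := integral_shiftDensity_rpow_le (a := B) hv (by nlinarith)
        have b₄ := integral_shiftDensity_rpow_le (a := -lam) hv' (by nlinarith)
        rw [show -lam * (-lam - 1) = lam * (lam + 1) by ring] at b₄
        have b₅ : c₂ * (∫ z, (shiftDensity v z - 1) ^ 2 ∂(stdGaussian E) +
              ∫ z, (shiftDensity v' z - 1) ^ 2 ∂(stdGaussian E)) ≤ c₂ * (4 * δ ^ 2) := by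
          gcongr; linarith
        have b₆ := mul_le_mul_of_nonneg_left b₃ h3
        have b₇ := mul_le_mul_of_nonneg_left b₄ h4
        have b₈ : c₂ * (4 * δ ^ 2) = 48 * (α * (α - 1)) * q ^ 2 * δ ^ 2 := by rw [hc₂]; ring
        rw [← hc₃, ← hc₄]
        linarith

end Subsampled

/-! ### Chernoff terms below the threshold order -/

section Numerics

/-- The Chernoff term for large densities, in the range of orders where `q α ≤ 1 / 4`. -/
lemma upper_tail_le_of_small {α q S : ℝ} (hα : 1 < α) (hq : 0 < q) (hS : 16 < S)
    (hqα : 4 * α * q ≤ 1) (h1 : α ≤ logTerm q α * S / 2 - Real.log S) :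
    Real.exp (2 * (q * (α - 1))) * (α * q) ^ α *
      Real.exp (α * logTerm q α - 3 / 4 * S * logTerm q α ^ 2) ≤
    13 * (α * (α - 1)) * q ^ 2 / S := by
  have hθ : 0 < α - 1 := by linarith
  have hA : 0 < q * (α - 1) := mul_pos hq hθ
  have hA4 : q * (α - 1) ≤ 1 / 4 := by nlinarith
  have he := Real.exp_one_lt_d9
  have hℓ : 1 ≤ logTerm q α := by
    rw [logTerm, Real.le_log_iff_exp_le (by positivity)]
    have : 4 ≤ 1 / (q * (α - 1)) := by rw [le_div_iff₀ hA]; linarith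
    linarith
  have hlogS : 2 ≤ Real.log S := by
    rw [Real.le_log_iff_exp_le (by linarith), show (2 : ℝ) = 1 + 1 by norm_num, Real.exp_add]
    nlinarith [Real.exp_pos 1]
  have hexpℓ : Real.exp (-logTerm q α) ≤ q * (α - 1) := by
    rw [Real.exp_neg, logTerm, Real.exp_log (by positivity), inv_le_comm₀ (by positivity) hA,
      one_div]
    linarith
  have hpow : (α * q) ^ α ≤ 1 :=
    Real.rpow_le_one (by positivity) (by nlinarith) (by linarith)
  -- From (ℓ-1)(log S - 2) ≥ 0 the product ℓ log S is traded for 2ℓ + log S - 2. Since e^(-ℓ) ≤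
  -- q(α-1), this yields the factors q²(α-1)² and 1/S.
  have hexpo : α * logTerm q α - 3 / 4 * S * logTerm q α ^ 2 ≤
      2 + (-logTerm q α + -logTerm q α) + -Real.log S := by
    have h2 := mul_le_mul_of_nonneg_right h1 (by linarith : 0 ≤ logTerm q α)
    have h3 : 0 ≤ (logTerm q α - 1) * (Real.log S - 2) :=
      mul_nonneg (by linarith) (by linarith)
    have h4 : 0 ≤ S * logTerm q α ^ 2 := by positivity
    nlinarith
  have hfirst : Real.exp (2 * (q * (α - 1))) ≤ Real.exp (1 / 2) :=
    Real.exp_le_exp.2 (by linarith)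
  have hconst : Real.exp (1 / 2) * Real.exp 2 ≤ 13 := by
    rw [← Real.exp_add]
    have h5 : Real.exp (1 / 2 + 2) ^ 2 = Real.exp 1 ^ 5 := by
      rw [← Real.exp_nat_mul, ← Real.exp_nat_mul]; norm_num
    have h6 : Real.exp 1 ^ 5 ≤ 2.72 ^ 5 := by gcongr; linarith
    nlinarith [Real.exp_pos (1 / 2 + 2)]
  calc _ ≤ Real.exp (1 / 2) * 1 * Real.exp (2 + (-logTerm q α + -logTerm q α) + -Real.log S) := by
        gcongr
    _ = Real.exp (1 / 2) * Real.exp 2 * (Real.exp (-logTerm q α) * Real.exp (-logTerm q α)) / S := by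
        rw [Real.exp_add, Real.exp_add, Real.exp_add, Real.exp_neg (Real.log S),
          Real.exp_log (by linarith)]
        ring
    _ ≤ 13 * ((q * (α - 1)) * (q * (α - 1))) / S := by gcongr
    _ ≤ 13 * (α * (α - 1)) * q ^ 2 / S := by
        gcongr ?_ / S
        have : (α - 1) * (α - 1) ≤ α * (α - 1) := by gcongr; linarith
        nlinarith [mul_le_mul_of_nonneg_right this (sq_nonneg q)]

lemma logTerm_add_log_ge {α q : ℝ} (hα : 1 < α) (hq : 0 < q) (hqα : 1 < 4 * α * q) :
    1 / 5 ≤ logTerm q α + Real.log (q * α) := by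
  have hθ : 0 < α - 1 := by linarith
  have hA : 0 < q * (α - 1) := mul_pos hq hθ
  rw [logTerm, ← Real.log_mul (by positivity) (by positivity)]
  have h1 : 5 / 4 ≤ (1 + 1 / (q * (α - 1))) * (q * α) := by
    have : 1 ≤ 1 / (q * (α - 1)) * (q * α) := by
      rw [one_div, ← div_eq_inv_mul, le_div_iff₀ hA]
      nlinarith
    nlinarith
  have h2 := Real.one_sub_inv_le_log_of_pos (by linarith : 0 < (1 + 1 / (q * (α - 1))) * (q * α))
  have h3 : ((1 + 1 / (q * (α - 1))) * (q * α))⁻¹ ≤ (5 / 4)⁻¹ := by gcongr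
  linarith

/-- The Chernoff term for large densities, in the range of orders where `q α > 1 / 4`. -/
lemma upper_tail_le_of_large {α q S : ℝ} (hα : 1 < α) (hq : 0 < q) (hq0 : q ≤ 1 / 2000)
    (hS : 16 < S) (hqα : 1 < 4 * α * q)
    (h2 : α * (logTerm q α + Real.log (q * α)) + Real.log (5 * S) ≤ logTerm q α ^ 2 * S / 2) :
    Real.exp (2 * (q * (α - 1))) * (α * q) ^ α *
      Real.exp (α * logTerm q α - 3 / 4 * S * logTerm q α ^ 2) ≤
    7 * (α * (α - 1)) * q ^ 2 / S := by
  have h5 := logTerm_add_log_ge hα hq hqα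
  have hα500 : 500 ≤ α := by nlinarith
  have hlog : 0 ≤ Real.log (5 * S) := Real.log_nonneg (by linarith)
  have hpow : (α * q) ^ α = Real.exp (α * Real.log (q * α)) := by
    rw [mul_comm α q, mul_comm α, Real.exp_mul, Real.exp_log (by positivity)]
  rw [hpow, ← Real.exp_add, ← Real.exp_add]
  -- The hypothesis uses ½ℓ²S of the available ¾ℓ²S. It also gives ¼ℓ²S ≥ α/10, and this surplus
  -- absorbs 2q(α-1).
  calc _ ≤ Real.exp (-Real.log (5 * S)) := by
        gcongr
        have h6 : α * (1 / 5) ≤ α * (logTerm q α + Real.log (q * α)) := by gcongr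
        have h7 : q * (α - 1) ≤ 1 / 2000 * (α - 1) := by gcongr
        nlinarith
    _ = 1 / (5 * S) := by rw [Real.exp_neg, Real.exp_log (by linarith), one_div]
    _ ≤ _ := by
        rw [div_le_div_iff₀ (by positivity) (by positivity), one_mul]
        have h8 : 1 ≤ 16 * (α * q) ^ 2 := by nlinarith
        have h9 : (α * q) ^ 2 ≤ 2 * (α * (α - 1)) * q ^ 2 := by
          rw [mul_pow]; gcongr; nlinarith
        nlinarith

/-- The Chernoff term for small densities. -/
lemma lower_tail_le {α q S : ℝ} (hα : 1 < α) (hq : 0 < q) (hq0 : q ≤ 1 / 2000)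
    (hS : 16 < S) (hqα : 1 < 4 * α * q)
    (h2 : α * (logTerm q α + Real.log (q * α)) + Real.log (5 * S) ≤ logTerm q α ^ 2 * S / 2) :
    6 * Real.exp (2 * (q * (α - 1))) *
      Real.exp (-(9 / 16 * S * (1 / (4 * α * q)) ^ 2) + (1 / (4 * α * q)) / 4) ≤
    800 * (α * (α - 1)) * q ^ 2 / S := by
  have h5 := logTerm_add_log_ge hα hq hqα
  have hα500 : 500 ≤ α := by nlinarith
  have hθ : 0 < α - 1 := by linarith
  have hA : 0 < q * (α - 1) := mul_pos hq hθ
  have hlog : 0 ≤ Real.log (5 * S) := Real.log_nonneg (by linarith)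
  have hqα0 : 0 < α * q := by positivity
  obtain ⟨R, hR⟩ : ∃ R, R = S / (α * q) ^ 2 := ⟨_, rfl⟩
  have hR0 : 0 < R := by rw [hR]; positivity
  have hℓ0 : 0 ≤ logTerm q α := Real.log_nonneg (by
    have : 0 < 1 / (q * (α - 1)) := by positivity
    linarith)
  have hℓ : logTerm q α ≤ 2 / (α * q) := by
    have h6 := Real.log_le_sub_one_of_pos (x := 1 + 1 / (q * (α - 1))) (by positivity)
    have h7 : 1 / (q * (α - 1)) ≤ 2 / (α * q) := by
      rw [div_le_div_iff₀ hA hqα0]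
      nlinarith
    rw [logTerm]
    linarith
  have hRα : α / 10 ≤ R := by
    have h6 : α * (1 / 5) ≤ α * (logTerm q α + Real.log (q * α)) := by gcongr
    have h7 : logTerm q α ^ 2 * S / 2 ≤ (2 / (α * q)) ^ 2 * S / 2 := by gcongr
    have h8 : (2 / (α * q)) ^ 2 * S / 2 = 2 * R := by rw [hR]; ring
    linarith
  have hsq : 9 / 16 * S * (1 / (4 * α * q)) ^ 2 = 9 / 256 * R := by
    rw [hR]; field_simp; norm_num
  have hκ : 1 / (4 * α * q) ≤ 1 := by rw [div_le_one (by positivity)]; exact hqα.le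
  have h7 : q * (α - 1) ≤ 1 / 2000 * α := by gcongr; linarith
  rw [hsq, mul_assoc, ← Real.exp_add]
  -- The threshold condition forced R ≥ α/10, so the positive terms cost little of the decay in R.
  -- Then e^(-R/50) ≤ 50/R converts the decay into the required order (αq)²/S.
  have hexp : Real.exp (2 * (q * (α - 1)) + (-(9 / 256 * R) + 1 / (4 * α * q) / 4)) ≤
      Real.exp (1 / 4) * (50 / R) := by
    calc _ ≤ Real.exp (1 / 4 + -(R / 50)) := Real.exp_le_exp.2 (by linarith)
      _ = Real.exp (1 / 4) * Real.exp (-(R / 50)) := Real.exp_add _ _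
      _ ≤ _ := by
          gcongr
          rw [Real.exp_neg, inv_le_comm₀ (Real.exp_pos _) (by positivity), inv_div]
          linarith [Real.add_one_le_exp (R / 50)]
  have hquarter : Real.exp (1 / 4) ≤ 4 / 3 := by
    have h8 : Real.exp (1 / 4) ^ 4 = Real.exp 1 := by
      rw [← Real.exp_nat_mul]; norm_num
    by_contra hcon
    push Not at hcon
    have : (4 / 3 : ℝ) ^ 4 < Real.exp (1 / 4) ^ 4 := by gcongr
    have he := Real.exp_one_lt_d9
    norm_num at this
    norm_num at h8
    linarith
  calc _ ≤ 6 * (4 / 3 * (50 / R)) := by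
        gcongr
        exact hexp.trans (by gcongr)
    _ = 400 * (α * q) ^ 2 / S := by rw [hR]; field_simp; norm_num
    _ ≤ _ := by
        gcongr ?_ / S
        have h9 : (α * q) ^ 2 ≤ 2 * (α * (α - 1)) * q ^ 2 := by
          rw [mul_pow]; gcongr; nlinarith
        nlinarith

end Numerics

/-! ### The subsampled Gaussian mechanism -/

section Subsampled

variable {E : Type*} [NormedAddCommGroup E] [InnerProductSpace ℝ E] [FiniteDimensional ℝ E]
  [MeasurableSpace E] [BorelSpace E]

/-- The Rényi moment of the subsampled Gaussian mechanism under replacement. -/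
theorem lintegral_subsampled_le {α q S δ : ℝ} (hα : 1 < α) (hq : 0 < q) (hq0 : q ≤ 1 / 2000)
    (hS : 16 < S) (hδ : δ ^ 2 = 2 / (3 * S))
    (h1 : α ≤ logTerm q α * S / 2 - Real.log S)
    (h2 : 1 < 4 * α * q → α * (logTerm q α + Real.log (q * α)) + Real.log (5 * S) ≤
      logTerm q α ^ 2 * S / 2) {v v' : E} (hv : ‖v‖ ≤ δ) (hv' : ‖v'‖ ≤ δ) :
    ∫⁻ z, ENNReal.ofReal ((1 - q + q * shiftDensity v z) ^ α *
      (1 - q + q * shiftDensity v' z) ^ (1 - α)) ∂(stdGaussian E) ≤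
    ENNReal.ofReal (Real.exp (1000 * (α * (α - 1)) * q ^ 2 / S)) := by
  have hθ : 0 < α - 1 := by linarith
  have hS0 : 0 < S := by linarith
  have hlogS : 0 ≤ Real.log S := Real.log_nonneg (by linarith)
  have hℓ : 0 ≤ logTerm q α := Real.log_nonneg (by
    have : 0 < 1 / (q * (α - 1)) := by positivity
    linarith)
  have hδ1 : δ ^ 2 ≤ 1 := by rw [hδ, div_le_one (by positivity)]; linarith
  set κ := 1 / (4 * α * q) with hκ
  have hκ0 : 0 < κ := by positivity
  have hB : α ≤ 3 / 2 * S * logTerm q α := by nlinarith [mul_nonneg hS0.le hℓ]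
  -- With δ² = 2/(3S), B minimizes -Bℓ + B²/(3S), with value -¾Sℓ². The choice of `lam` is half the
  -- corresponding minimizer and still gains 9/16 Sκ². The three contributions add up to 32 + 13 +
  -- 800 ≤ 1000.
  refine (lintegral_mixture_rpow_mul_rpow_le (B := 3 / 2 * S * logTerm q α)
    (lam := 3 / 4 * S * κ) hα hq (by linarith) hδ1 hB (by positivity) hv hv').trans ?_
  refine ENNReal.ofReal_le_ofReal ?_
  have hQ : 0 ≤ α * (α - 1) * q ^ 2 / S := by positivity
  have hfirst : 48 * (α * (α - 1)) * q ^ 2 * δ ^ 2 = 32 * (α * (α - 1) * q ^ 2 / S) := by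
    rw [hδ]; field_simp; norm_num
  have hup : Real.exp (2 * (q * (α - 1))) * (α * q) ^ α *
      Real.exp (-((3 / 2 * S * logTerm q α - α) * logTerm q α)) *
        Real.exp (3 / 2 * S * logTerm q α * (3 / 2 * S * logTerm q α - 1) * δ ^ 2 / 2) ≤
      13 * (α * (α - 1) * q ^ 2 / S) := by
    have he : -((3 / 2 * S * logTerm q α - α) * logTerm q α) +
        3 / 2 * S * logTerm q α * (3 / 2 * S * logTerm q α - 1) * δ ^ 2 / 2 ≤
        α * logTerm q α - 3 / 4 * S * logTerm q α ^ 2 := by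
      have : 3 / 2 * S * logTerm q α * (3 / 2 * S * logTerm q α - 1) * δ ^ 2 / 2 =
          3 / 4 * S * logTerm q α ^ 2 - logTerm q α / 2 := by
        rw [hδ]; field_simp; ring
      rw [this]
      nlinarith
    calc _ = Real.exp (2 * (q * (α - 1))) * (α * q) ^ α *
          Real.exp (-((3 / 2 * S * logTerm q α - α) * logTerm q α) +
            3 / 2 * S * logTerm q α * (3 / 2 * S * logTerm q α - 1) * δ ^ 2 / 2) := by
          rw [Real.exp_add]; ring
      _ ≤ Real.exp (2 * (q * (α - 1))) * (α * q) ^ α *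
          Real.exp (α * logTerm q α - 3 / 4 * S * logTerm q α ^ 2) := by gcongr
      _ ≤ 13 * (α * (α - 1)) * q ^ 2 / S := by
          rcases le_or_gt (4 * α * q) 1 with h | h
          · exact upper_tail_le_of_small hα hq hS h h1
          · refine (upper_tail_le_of_large hα hq hq0 hS h (h2 h)).trans ?_
            gcongr
            norm_num
      _ = _ := by ring
  have hlow : (if 1 < 4 * α * q then 6 * Real.exp (2 * (q * (α - 1))) *
        Real.exp (-(3 / 4 * S * κ * κ)) else 0) *
        Real.exp (3 / 4 * S * κ * (3 / 4 * S * κ + 1) * δ ^ 2 / 2) ≤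
      800 * (α * (α - 1) * q ^ 2 / S) := by
    split_ifs with h
    · have he : -(3 / 4 * S * κ * κ) + 3 / 4 * S * κ * (3 / 4 * S * κ + 1) * δ ^ 2 / 2 =
          -(9 / 16 * S * κ ^ 2) + κ / 4 := by
        rw [hδ]; field_simp; ring
      calc _ = 6 * Real.exp (2 * (q * (α - 1))) *
            Real.exp (-(3 / 4 * S * κ * κ) +
              3 / 4 * S * κ * (3 / 4 * S * κ + 1) * δ ^ 2 / 2) := by rw [Real.exp_add]; ring
        _ ≤ 800 * (α * (α - 1)) * q ^ 2 / S := by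
            rw [he]
            exact lower_tail_le hα hq hq0 hS h (h2 h)
        _ = _ := by ring
    · rw [zero_mul]
      positivity
  have hexp := Real.add_one_le_exp (1000 * (α * (α - 1)) * q ^ 2 / S)
  have hlast : 1000 * (α * (α - 1)) * q ^ 2 / S = 1000 * (α * (α - 1) * q ^ 2 / S) := by ring
  rw [hfirst]
  linarith

end Subsampled

/-! ### Contraction of gradient steps on a convex domain -/

section GradientStep

open scoped RealInnerProductSpace
open Set

lemma le_of_forall_le_add_mul {a b c : ℝ} (h : ∀ t ∈ Ioc (0 : ℝ) 1, a ≤ b + t * c) : a ≤ b := by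
  have h1 : Filter.Tendsto (fun t : ℝ => b + t * c) (nhdsWithin 0 (Ioi 0)) (nhds (b + 0 * c)) :=
    Filter.Tendsto.mono_left (Continuous.tendsto (by fun_prop) 0) nhdsWithin_le_nhds
  rw [zero_mul, add_zero] at h1
  refine ge_of_tendsto h1 ?_
  filter_upwards [Ioc_mem_nhdsGT (zero_lt_one' ℝ)] with t ht
  exact h t ht

variable {E : Type*} [NormedAddCommGroup E] [InnerProductSpace ℝ E] {m M : ℝ}

/-- The hypothesis puts e in the ball with diameter [mΔ, MΔ]. The map e ↦ Δ - ηe sends it to the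
ball with diameter from (1-ηm)Δ to (1-ηM)Δ, whose centre is a multiple of Δ, so the norm is largest
at one of these endpoints. -/
lemma norm_sub_smul_le_of_inner_nonneg {Δ e : E} {η c : ℝ}
    (h : 0 ≤ ⟪e - m • Δ, M • Δ - e⟫) (hm : |1 - η * m| ≤ c) (hM : |1 - η * M| ≤ c) :
    ‖Δ - η • e‖ ≤ c * ‖Δ‖ := by
  have hc : 0 ≤ c := (abs_nonneg _).trans hm
  rcases eq_or_ne η 0 with rfl | hη
  · simp only [zero_mul, sub_zero, abs_one] at hm
    simp only [zero_smul, sub_zero]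
    nlinarith [norm_nonneg Δ]
  set p := Δ - η • e with hp
  obtain ⟨l₁, hl₁⟩ : ∃ l, l = 1 - η * m := ⟨_, rfl⟩
  obtain ⟨l₂, hl₂⟩ : ∃ l, l = 1 - η * M := ⟨_, rfl⟩
  have h1 : η • (e - m • Δ) = l₁ • Δ - p := by rw [hp, hl₁]; module
  have h2 : η • (M • Δ - e) = p - l₂ • Δ := by rw [hp, hl₂]; module
  have h3 : 0 ≤ ⟪l₁ • Δ - p, p - l₂ • Δ⟫ := by
    rw [← h1, ← h2, inner_smul_left, inner_smul_right]
    simp only [conj_trivial]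
    rw [← mul_assoc]
    exact mul_nonneg (mul_self_nonneg η) h
  rw [← hl₁] at hm
  rw [← hl₂] at hM
  have h4 : ‖p - ((l₁ + l₂) / 2) • Δ‖ ≤ |(l₁ - l₂) / 2| * ‖Δ‖ := by
    refine le_of_sq_le_sq ?_ (by positivity)
    rw [norm_sub_sq_real, norm_smul, mul_pow, mul_pow, Real.norm_eq_abs, sq_abs, sq_abs,
      inner_smul_right]
    simp only [inner_sub_left, inner_sub_right, inner_smul_left, inner_smul_right,
      real_inner_self_eq_norm_sq, conj_trivial, real_inner_comm p Δ] at h3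
    linarith
  calc ‖p‖ = ‖(p - ((l₁ + l₂) / 2) • Δ) + ((l₁ + l₂) / 2) • Δ‖ := by rw [sub_add_cancel]
    _ ≤ |(l₁ - l₂) / 2| * ‖Δ‖ + |(l₁ + l₂) / 2| * ‖Δ‖ := by
        refine (norm_add_le _ _).trans (add_le_add h4 ?_)
        rw [norm_smul, Real.norm_eq_abs]
    _ = (|(l₁ - l₂) / 2| + |(l₁ + l₂) / 2|) * ‖Δ‖ := by ring
    _ ≤ c * ‖Δ‖ := by
        gcongr
        rw [abs_le] at hm hM
        rcases abs_cases ((l₁ - l₂) / 2) with h | h <;>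
          rcases abs_cases ((l₁ + l₂) / 2) with h' | h' <;> linarith

variable [CompleteSpace E] {K : Set E} {f : E → ℝ} {g : E → E}

lemma hasDerivWithinAt_segment (hK : Convex ℝ K) (hg : ∀ w ∈ K, HasGradientWithinAt f (g w) K w)
    {x y : E} (hx : x ∈ K) (hy : y ∈ K) {t : ℝ} (ht : t ∈ Icc (0 : ℝ) 1) :
    HasDerivWithinAt (fun s : ℝ => f (x + s • (y - x))) ⟪g (x + t • (y - x)), y - x⟫
      (Icc 0 1) t := by
  have hmaps : MapsTo (fun s : ℝ => x + s • (y - x)) (Icc 0 1) K := fun s hs =>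
    hK.add_smul_sub_mem hx hy hs
  have h1 := (hg _ (hmaps ht)).hasFDerivWithinAt
  have h2 : HasDerivWithinAt (fun s : ℝ => x + s • (y - x)) (y - x) (Icc 0 1) t := by
    simpa using (((hasDerivAt_id t).smul_const (y - x)).const_add x).hasDerivWithinAt
  have h3 := h1.comp_hasDerivWithinAt t h2 hmaps
  rw [InnerProductSpace.toDual_apply_apply] at h3
  exact h3

lemma strongConvexOn_gradient_le (hf : StrongConvexOn K m f)
    (hg : ∀ w ∈ K, HasGradientWithinAt f (g w) K w) {x y : E} (hx : x ∈ K) (hy : y ∈ K) :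
    f x + ⟪g x, y - x⟫ + m / 2 * ‖y - x‖ ^ 2 ≤ f y := by
  have hd := hasDerivWithinAt_segment hf.1 hg hx hy (t := 0) (by simp)
  rw [hasDerivWithinAt_iff_tendsto_slope] at hd
  simp only [zero_smul, add_zero] at hd
  have hle : ∀ t ∈ Icc (0 : ℝ) 1 \ {0}, slope (fun s : ℝ => f (x + s • (y - x))) 0 t ≤
      f y - f x - (1 - t) * (m / 2 * ‖y - x‖ ^ 2) := by
    rintro t ⟨⟨ht0, ht1⟩, hne⟩
    have htpos : 0 < t := lt_of_le_of_ne ht0 (Ne.symm hne)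
    have h1 := hf.2 hx hy (show 0 ≤ 1 - t by linarith) ht0 (by ring)
    have h2 : (1 - t) • x + t • y = x + t • (y - x) := by module
    rw [h2, norm_sub_rev] at h1
    simp only [smul_eq_mul] at h1
    rw [slope_def_field]
    simp only [zero_smul, add_zero, sub_zero]
    rw [div_le_iff₀ htpos]
    nlinarith
  have hlim : Filter.Tendsto (fun t : ℝ => f y - f x - (1 - t) * (m / 2 * ‖y - x‖ ^ 2))
      (nhdsWithin 0 (Icc (0 : ℝ) 1 \ {0})) (nhds (f y - f x - (1 - 0) * (m / 2 * ‖y - x‖ ^ 2))) :=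
    Filter.Tendsto.mono_left (Continuous.tendsto (by fun_prop) 0) nhdsWithin_le_nhds
  have hne : (nhdsWithin (0 : ℝ) (Icc 0 1 \ {0})).NeBot := by
    have : Icc (0 : ℝ) 1 \ {0} = Ioc 0 1 := by
      rw [Icc_sdiff_left]
    rw [this]
    exact left_nhdsWithin_Ioc_neBot zero_lt_one
  have := le_of_tendsto_of_tendsto hd hlim (Filter.eventually_of_mem self_mem_nhdsWithin hle)
  linarith

lemma le_add_inner_gradient_add (hK : Convex ℝ K)
    (hg : ∀ w ∈ K, HasGradientWithinAt f (g w) K w)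
    (hM : ∀ w ∈ K, ∀ w' ∈ K, ‖g w - g w'‖ ≤ M * ‖w - w'‖) {x y : E} (hx : x ∈ K) (hy : y ∈ K) :
    f y ≤ f x + ⟪g x, y - x⟫ + M / 2 * ‖y - x‖ ^ 2 := by
  set ψ : ℝ → ℝ := fun t => f (x + t • (y - x)) - (t * ⟪g x, y - x⟫ + M / 2 * ‖y - x‖ ^ 2 * t ^ 2)
  have hd : ∀ t ∈ Icc (0 : ℝ) 1, HasDerivWithinAt ψ (⟪g (x + t • (y - x)), y - x⟫ -
      (1 * ⟪g x, y - x⟫ + M / 2 * ‖y - x‖ ^ 2 * (2 * t))) (Icc 0 1) t := by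
    intro t ht
    refine (hasDerivWithinAt_segment hK hg hx hy ht).sub (HasDerivAt.hasDerivWithinAt ?_)
    refine ((hasDerivAt_id t).mul_const _).add (HasDerivAt.const_mul _ ?_)
    simpa using hasDerivAt_pow 2 t
  have hanti : AntitoneOn ψ (Icc 0 1) := by
    refine antitoneOn_of_hasDerivWithinAt_nonpos (convex_Icc 0 1)
      (fun t ht => (hd t ht).continuousWithinAt)
      (fun t ht => (hd t (interior_subset ht)).mono interior_subset) ?_
    intro t ht
    have ht' := interior_subset ht
    have hmem : x + t • (y - x) ∈ K := hK.add_smul_sub_mem hx hy ht'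
    have h1 : ⟪g (x + t • (y - x)) - g x, y - x⟫ ≤ M * (t * ‖y - x‖) * ‖y - x‖ := by
      refine (real_inner_le_norm _ _).trans ?_
      have h2 := hM _ hmem _ hx
      rw [add_sub_cancel_left, norm_smul, Real.norm_of_nonneg ht'.1] at h2
      gcongr
    rw [inner_sub_left] at h1
    nlinarith
  have h := hanti (left_mem_Icc.2 zero_le_one) (right_mem_Icc.2 zero_le_one) zero_le_one
  simp only [ψ, one_smul, zero_smul, add_zero, add_sub_cancel] at h
  linarith

/-- Two-point form of cocoercivity; the auxiliary points have to lie in the domain. -/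
lemma inner_gradient_nonneg (hf : StrongConvexOn K m f)
    (hg : ∀ w ∈ K, HasGradientWithinAt f (g w) K w)
    (hM : ∀ w ∈ K, ∀ w' ∈ K, ‖g w - g w'‖ ≤ M * ‖w - w'‖) (hmM : m < M) {x y u : E}
    (hx : x ∈ K) (hy : y ∈ K) (hu : (M - m) • u = g y - g x - m • (y - x))
    (hyu : y - u ∈ K) (hxu : x + u ∈ K) :
    0 ≤ ⟪g y - g x - m • (y - x), M • (y - x) - (g y - g x)⟫ := by
  have hΛ : 0 < M - m := by linarith
  have a₁ := strongConvexOn_gradient_le hf hg hx hyu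
  have a₂ := le_add_inner_gradient_add hf.1 hg hM hy hyu
  have a₃ := strongConvexOn_gradient_le hf hg hy hxu
  have a₄ := le_add_inner_gradient_add hf.1 hg hM hx hxu
  have e₁ : y - u - x = (y - x) - u := by abel
  have e₂ : y - u - y = -u := by abel
  have e₃ : x + u - y = -((y - x) - u) := by abel
  have e₄ : x + u - x = u := by abel
  rw [e₁] at a₁
  rw [e₂, norm_neg, inner_neg_right] at a₂
  rw [e₃, norm_neg, inner_neg_right] at a₃
  rw [e₄] at a₄
  have he : g y - g x = (M - m) • u + m • (y - x) := by rw [hu]; abel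
  generalize y - x = Δ at *
  -- The pairs a₁, a₂ and a₃, a₄ eliminate the values of f at y - u and x + u; adding them
  -- eliminates f x and f y.
  have hsum : ⟪g y - g x, Δ - u⟫ + M * ‖u‖ ^ 2 ≥ m * ‖Δ - u‖ ^ 2 + ⟪g y - g x, u⟫ := by
    rw [inner_sub_left, inner_sub_left]
    linarith
  rw [he, norm_sub_sq_real] at hsum
  simp only [inner_add_left, inner_sub_right, inner_smul_left, real_inner_self_eq_norm_sq,
    conj_trivial, real_inner_comm u Δ] at hsum
  have hfin : (M - m) * ‖u‖ ^ 2 ≤ (M - m) * ⟪u, Δ⟫ := by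
    linarith
  have hfin' : ‖u‖ ^ 2 ≤ ⟪u, Δ⟫ := le_of_mul_le_mul_left hfin hΛ
  rw [← hu, he]
  have : M • Δ - ((M - m) • u + m • Δ) = (M - m) • (Δ - u) := by module
  rw [this, inner_smul_left, inner_smul_right, inner_sub_right, real_inner_self_eq_norm_sq]
  simp only [conj_trivial]
  have : 0 ≤ ⟪u, Δ⟫ - ‖u‖ ^ 2 := by linarith
  positivity

/-- A gradient step is a contraction between points of the interior. -/
lemma norm_gradient_step_le_interior (hf : StrongConvexOn K m f)
    (hg : ∀ w ∈ K, HasGradientWithinAt f (g w) K w)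
    (hM : ∀ w ∈ K, ∀ w' ∈ K, ‖g w - g w'‖ ≤ M * ‖w - w'‖) (hm0 : 0 ≤ m) (hmM : m < M)
    {η c : ℝ} (hcm : |1 - η * m| ≤ c) (hcM : |1 - η * M| ≤ c) {x y : E}
    (hx : x ∈ interior K) (hy : y ∈ interior K) :
    ‖(y - x) - η • (g y - g x)‖ ≤ c * ‖y - x‖ := by
  have hΛ : 0 < M - m := by linarith
  have hseg : segment ℝ x y ⊆ interior K := hf.1.interior.segment_subset hx hy
  have hcomp : IsCompact (segment ℝ x y) := by
    rw [segment_eq_image_lineMap]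
    exact isCompact_Icc.image (AffineMap.lineMap_continuous)
  obtain ⟨ε, hε, hthick⟩ := hcomp.exists_thickening_subset_open isOpen_interior hseg
  -- Subdivision into N pieces makes ‖u‖ < ε on each piece, so the auxiliary points stay in K. Since
  -- Δ - ηΔg telescopes along collinear points, the contractions of the pieces add up without loss.
  obtain ⟨N, hN⟩ := exists_nat_gt ((M + m) / (M - m) * ‖y - x‖ / ε)
  have hN0 : (0 : ℝ) < N := lt_of_le_of_lt (div_nonneg (mul_nonneg
    (div_nonneg (by linarith) hΛ.le) (norm_nonneg _)) hε.le) hN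
  set z : ℕ → E := fun i => x + ((i : ℝ) / N) • (y - x) with hz
  have hzdiff : ∀ i, z (i + 1) - z i = (1 / (N : ℝ)) • (y - x) := by
    intro i
    simp only [hz]
    push_cast
    rw [add_sub_add_left_eq_sub, ← sub_smul]
    congr 1
    ring
  have hzmem : ∀ i, i ≤ N → z i ∈ segment ℝ x y := by
    intro i hi
    rw [segment_eq_image']
    refine ⟨(i : ℝ) / N, ⟨by positivity, ?_⟩, rfl⟩
    rw [div_le_one hN0]
    exact_mod_cast hi
  have hstep : ∀ i, i < N → ‖(z (i + 1) - z i) - η • (g (z (i + 1)) - g (z i))‖ ≤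
      c * (1 / N * ‖y - x‖) := by
    intro i hi
    have h0 := hzmem i hi.le
    have h1 := hzmem (i + 1) hi
    have k0 := interior_subset (hseg h0)
    have k1 := interior_subset (hseg h1)
    set u := (M - m)⁻¹ • (g (z (i + 1)) - g (z i) - m • (z (i + 1) - z i)) with hu
    have hnorm : ‖z (i + 1) - z i‖ = 1 / N * ‖y - x‖ := by
      rw [hzdiff, norm_smul, Real.norm_of_nonneg (by positivity)]
    have hun : ‖u‖ < ε := by
      have h2 : ‖g (z (i + 1)) - g (z i) - m • (z (i + 1) - z i)‖ ≤
          (M + m) * (1 / N * ‖y - x‖) := by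
        refine (norm_sub_le _ _).trans ?_
        have h3 := hM _ k1 _ k0
        rw [norm_smul, Real.norm_of_nonneg hm0]
        rw [hnorm] at *
        linarith
      rw [hu, norm_smul, norm_inv, Real.norm_of_nonneg hΛ.le]
      calc (M - m)⁻¹ * ‖g (z (i + 1)) - g (z i) - m • (z (i + 1) - z i)‖
          ≤ (M - m)⁻¹ * ((M + m) * (1 / N * ‖y - x‖)) := by gcongr
        _ = ((M + m) / (M - m) * ‖y - x‖ / ε) * (ε / N) := by field_simp
        _ < N * (ε / N) := by gcongr
        _ = ε := by field_simp
    have hmem : ∀ p ∈ segment ℝ x y, ∀ q, dist q p < ε → q ∈ K := fun p hp q hq =>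
      interior_subset (hthick (Metric.mem_thickening_iff.2 ⟨p, hp, hq⟩))
    have key := inner_gradient_nonneg hf hg hM hmM k0 k1 (u := u)
      (by rw [hu, smul_smul, mul_inv_cancel₀ hΛ.ne', one_smul])
      (hmem _ h1 _ (by rw [dist_eq_norm, sub_sub_cancel_left, norm_neg]; exact hun))
      (hmem _ h0 _ (by rw [dist_eq_norm, add_sub_cancel_left]; exact hun))
    have := norm_sub_smul_le_of_inner_nonneg key hcm hcM
    rwa [hnorm] at this
  have hz0 : z 0 = x := by simp [hz]
  have hzN : z N = y := by simp [hz, div_self hN0.ne']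
  have hsum : (y - x) - η • (g y - g x) =
      ∑ i ∈ Finset.range N, ((z (i + 1) - z i) - η • (g (z (i + 1)) - g (z i))) := by
    rw [Finset.sum_sub_distrib, ← Finset.smul_sum, Finset.sum_range_sub,
      Finset.sum_range_sub (fun i => g (z i)), hz0, hzN]
  rw [hsum]
  calc _ ≤ ∑ i ∈ Finset.range N, c * (1 / N * ‖y - x‖) :=
        norm_sum_le_of_le _ fun i hi => hstep i (Finset.mem_range.1 hi)
    _ = c * ‖y - x‖ := by
        rw [Finset.sum_const, Finset.card_range, nsmul_eq_mul]
        field_simp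

/-- A gradient step of a strongly convex and smooth function is a contraction on its domain. -/
theorem norm_gradient_step_le (hf : StrongConvexOn K m f)
    (hg : ∀ w ∈ K, HasGradientWithinAt f (g w) K w)
    (hM : ∀ w ∈ K, ∀ w' ∈ K, ‖g w - g w'‖ ≤ M * ‖w - w'‖) (hm0 : 0 ≤ m) (hmM : m ≤ M)
    (hint : (interior K).Nonempty) {η : ℝ} (hη : 0 ≤ η) {x y : E} (hx : x ∈ K) (hy : y ∈ K) :
    ‖(y - x) - η • (g y - g x)‖ ≤ contractionFactor η m M * ‖y - x‖ := by
  set c := contractionFactor η m M with hc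
  have hcm : |1 - η * m| ≤ c := le_max_left _ _
  have hcM : |1 - η * M| ≤ c := le_max_right _ _
  have hinterior : ∀ x ∈ interior K, ∀ y ∈ interior K,
      ‖(y - x) - η • (g y - g x)‖ ≤ c * ‖y - x‖ := by
    intro x hx y hy
    -- Replacing M by M + t secures strict inequality m < M + t; then t → 0.
    refine le_of_forall_le_add_mul (c := η * ‖y - x‖) fun t ht => ?_
    have hM' : ∀ w ∈ K, ∀ w' ∈ K, ‖g w - g w'‖ ≤ (M + t) * ‖w - w'‖ := fun w hw w' hw' =>
      (hM w hw w' hw').trans (by gcongr; linarith [ht.1])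
    have hηt : 0 ≤ η * t := mul_nonneg hη ht.1.le
    have h1 := norm_gradient_step_le_interior hf hg hM' hm0 (by linarith [ht.1]) (η := η)
      (c := c + η * t) (by linarith) (by
        calc |1 - η * (M + t)| = |(1 - η * M) + -(η * t)| := by ring_nf
          _ ≤ |1 - η * M| + |-(η * t)| := abs_add_le _ _
          _ ≤ c + η * t := by rw [abs_neg, abs_of_nonneg hηt]; gcongr) hx hy
    calc _ ≤ _ := h1
      _ = _ := by ring
  obtain ⟨x₀, hx₀⟩ := hint
  have hM0 : 0 ≤ M := hm0.trans hmM
  -- Boundary points are pushed a fraction t towards an interior point, which moves the step by O(t)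
  -- because g is Lipschitz on K.
  refine le_of_forall_le_add_mul (c := (1 + η * M) * (‖x₀ - x‖ + ‖x₀ - y‖)) fun t ht => ?_
  have hxt := hf.1.add_smul_sub_mem_interior hx hx₀ ht
  have hyt := hf.1.add_smul_sub_mem_interior hy hx₀ ht
  have h1 := hinterior _ hxt _ hyt
  have hmove : ∀ w ∈ K, ∀ w' : E, w' = w + t • (x₀ - w) → w' ∈ interior K →
      ‖(w - w') - η • (g w - g w')‖ ≤ (1 + η * M) * (t * ‖x₀ - w‖) := by
    intro w hw w' he hw'
    have h2 := hM w hw w' (interior_subset hw')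
    have h3 : ‖w - w'‖ = t * ‖x₀ - w‖ := by
      rw [he, sub_add_cancel_left, norm_neg, norm_smul, Real.norm_of_nonneg ht.1.le]
    calc _ ≤ ‖w - w'‖ + ‖η • (g w - g w')‖ := norm_sub_le _ _
      _ ≤ ‖w - w'‖ + η * (M * ‖w - w'‖) := by
          rw [norm_smul, Real.norm_of_nonneg hη]; gcongr
      _ = _ := by rw [h3]; ring
  have h4 := hmove x hx _ rfl hxt
  have h5 := hmove y hy _ rfl hyt
  have h6 : ‖y + t • (x₀ - y) - (x + t • (x₀ - x))‖ ≤ ‖y - x‖ := by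
    have : y + t • (x₀ - y) - (x + t • (x₀ - x)) = (1 - t) • (y - x) := by module
    rw [this, norm_smul, Real.norm_of_nonneg (by linarith [ht.2])]
    nlinarith [ht.1, norm_nonneg (y - x)]
  have hc0 : 0 ≤ c := (abs_nonneg _).trans hcm
  generalize y + t • (x₀ - y) = y' at *
  generalize x + t • (x₀ - x) = x' at *
  have hdecomp : (y - x) - η • (g y - g x) = ((y' - x') - η • (g y' - g x')) +
      (((y - y') - η • (g y - g y')) - ((x - x') - η • (g x - g x'))) := by module
  rw [hdecomp]
  calc _ ≤ c * ‖y' - x'‖ + ((1 + η * M) * (t * ‖x₀ - y‖) + (1 + η * M) * (t * ‖x₀ - x‖)) :=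
        (norm_add_le _ _).trans (add_le_add h1 ((norm_sub_le _ _).trans (add_le_add h5 h4)))
    _ ≤ c * ‖y - x‖ + ((1 + η * M) * (t * ‖x₀ - y‖) + (1 + η * M) * (t * ‖x₀ - x‖)) := by
        gcongr
    _ = _ := by ring

/-- The gradient of a Lipschitz function is bounded. -/
lemma norm_gradient_le (hK : Convex ℝ K) (hg : ∀ w ∈ K, HasGradientWithinAt f (g w) K w)
    (hM : ∀ w ∈ K, ∀ w' ∈ K, ‖g w - g w'‖ ≤ M * ‖w - w'‖) {L : ℝ} (hL0 : 0 ≤ L)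
    (hL : ∀ w ∈ K, ∀ w' ∈ K, |f w - f w'| ≤ L * ‖w - w'‖) (hint : (interior K).Nonempty)
    {x : E} (hx : x ∈ K) : ‖g x‖ ≤ L := by
  have hinterior : ∀ y ∈ interior K, ‖g y‖ ≤ L := by
    intro y hy
    have hnhds := mem_interior_iff_mem_nhds.1 hy
    have h1 := (hg y (interior_subset hy)).hasFDerivWithinAt.hasFDerivAt hnhds
    have h2 := h1.le_of_lip' hL0 (Filter.eventually_of_mem hnhds fun w hw => by
      rw [Real.norm_eq_abs]
      exact hL w hw y (interior_subset hy))
    simpa using h2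
  obtain ⟨x₀, hx₀⟩ := hint
  refine le_of_forall_le_add_mul (c := M * ‖x₀ - x‖) fun t ht => ?_
  have hxt := hK.add_smul_sub_mem_interior hx hx₀ ht
  have h1 := hM x hx _ (interior_subset hxt)
  rw [sub_add_cancel_left, norm_neg, norm_smul, Real.norm_of_nonneg ht.1.le] at h1
  calc ‖g x‖ ≤ ‖g (x + t • (x₀ - x))‖ + ‖g x - g (x + t • (x₀ - x))‖ := norm_le_norm_add_norm_sub' _ _
    _ ≤ L + M * (t * ‖x₀ - x‖) := add_le_add (hinterior _ hxt) h1
    _ = _ := by ring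

end GradientStep

/-! ### Projection onto K and normal directions -/

section Projection

open scoped RealInnerProductSpace

variable {d : ℕ} {K : Set (EuclideanSpace ℝ (Fin d))}

lemma proj_spec (hK : IsClosed K) (hne : K.Nonempty) (x : EuclideanSpace ℝ (Fin d)) :
    proj K x ∈ K ∧ ∀ z ∈ K, dist x (proj K x) ≤ dist x z := by
  obtain ⟨y, hy, hd⟩ := hK.exists_infDist_eq_dist hne x
  have : ∃ y, y ∈ K ∧ ∀ z ∈ K, dist x y ≤ dist x z :=
    ⟨y, hy, fun z hz => hd ▸ Metric.infDist_le_dist_of_mem hz⟩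
  exact Classical.epsilon_spec this

lemma proj_inner_le_zero (hc : Convex ℝ K) (hK : IsClosed K) (hne : K.Nonempty)
    (x : EuclideanSpace ℝ (Fin d)) {z : EuclideanSpace ℝ (Fin d)} (hz : z ∈ K) :
    ⟪x - proj K x, z - proj K x⟫ ≤ 0 := by
  obtain ⟨hp, hmin⟩ := proj_spec hK hne x
  have : Nonempty K := hne.to_subtype
  refine (norm_eq_iInf_iff_real_inner_le_zero hc hp).1 (le_antisymm ?_ ?_) z hz
  · refine le_ciInf fun w => ?_
    simpa [dist_eq_norm] using hmin w w.2
  · exact ciInf_le (f := fun w : K => ‖x - w‖) ⟨0, by rintro _ ⟨w, rfl⟩; exact norm_nonneg _⟩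
      ⟨proj K x, hp⟩

lemma norm_proj_sub_le (hc : Convex ℝ K) (hK : IsClosed K) (hne : K.Nonempty)
    (x y : EuclideanSpace ℝ (Fin d)) : ‖proj K x - proj K y‖ ≤ ‖x - y‖ := by
  have h1 := proj_inner_le_zero hc hK hne x (proj_spec hK hne y).1
  have h2 := proj_inner_le_zero hc hK hne y (proj_spec hK hne x).1
  set p := proj K x
  set r := proj K y
  have h3 : ⟪x - y, p - r⟫ = -⟪x - p, r - p⟫ - ⟪y - r, p - r⟫ + ‖p - r‖ ^ 2 := by
    rw [← real_inner_self_eq_norm_sq]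
    simp only [inner_sub_left, inner_sub_right]
    ring
  have h4 := real_inner_le_norm (x - y) (p - r)
  rcases (norm_nonneg (p - r)).eq_or_lt with h | h
  · rw [← h]; positivity
  · refine le_of_mul_le_mul_right ?_ h
    nlinarith

lemma lipschitzWith_proj (hc : Convex ℝ K) (hK : IsClosed K) (hne : K.Nonempty) :
    LipschitzWith 1 (proj K) :=
  LipschitzWith.of_dist_le_mul fun x y => by
    simpa [dist_eq_norm] using norm_proj_sub_le hc hK hne x y

lemma proj_of_mem (hK : IsClosed K) {x : EuclideanSpace ℝ (Fin d)} (hx : x ∈ K) :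
    proj K x = x := by
  have := (proj_spec hK ⟨x, hx⟩ x).2 x hx
  rw [dist_self] at this
  exact (dist_le_zero.1 this).symm

/-- The projection onto `K` ignores displacements orthogonal to the differences of points of
`K`. -/
lemma proj_add_of_orthogonal (hc : Convex ℝ K) (hK : IsClosed K) (hne : K.Nonempty)
    (x : EuclideanSpace ℝ (Fin d)) {v : EuclideanSpace ℝ (Fin d)}
    (hv : ∀ y ∈ K, ∀ z ∈ K, ⟪v, y - z⟫ = 0) : proj K (x + v) = proj K x := by
  have hp := (proj_spec hK hne x).1
  have hr := (proj_spec hK hne (x + v)).1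
  have h1 := proj_inner_le_zero hc hK hne x hr
  have h2 := proj_inner_le_zero hc hK hne (x + v) hp
  have h3 := hv _ hp _ hr
  set p := proj K x
  set r := proj K (x + v)
  have h4 : ‖r - p‖ ^ 2 = ⟪x - p, r - p⟫ + ⟪x + v - r, p - r⟫ - ⟪v, p - r⟫ := by
    rw [← real_inner_self_eq_norm_sq]
    simp only [inner_sub_left, inner_sub_right, inner_add_left]
    ring
  have h5 : ‖r - p‖ ^ 2 ≤ 0 := by linarith
  have h6 : ‖r - p‖ = 0 := by
    have := norm_nonneg (r - p)
    nlinarith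
  exact sub_eq_zero.1 (norm_eq_zero.1 h6)

/-- The orthogonal projection onto the directions of `K`. -/
noncomputable def tangentProj (K : Set (EuclideanSpace ℝ (Fin d))) :
    EuclideanSpace ℝ (Fin d) →L[ℝ] EuclideanSpace ℝ (Fin d) :=
  (vectorSpan ℝ K).starProjection

lemma inner_tangentProj_sub_eq_zero (x : EuclideanSpace ℝ (Fin d)) :
    ∀ y ∈ K, ∀ z ∈ K, ⟪x - tangentProj K x, y - z⟫ = 0 := by
  intro y hy z hz
  exact Submodule.starProjection_inner_eq_zero x _ (vsub_mem_vectorSpan ℝ hy hz)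

end Projection

/-! ### Losses on lower-dimensional domains -/

section Tangent

open scoped RealInnerProductSpace

variable {d : ℕ} {K : Set (EuclideanSpace ℝ (Fin d))} {L m M : ℝ}
  {f : EuclideanSpace ℝ (Fin d) → ℝ} {g : EuclideanSpace ℝ (Fin d) → EuclideanSpace ℝ (Fin d)}

/-- A convex set has interior relative to its affine hull. Viewed in its direction space, K meets
the interior hypothesis of the gradient lemmas. -/
lemma interior_preimage_vectorSpan_nonempty (hc : Convex ℝ K) {w₀ : EuclideanSpace ℝ (Fin d)}
    (hw₀ : w₀ ∈ K) : (interior {v : vectorSpan ℝ K | w₀ + (v : EuclideanSpace ℝ (Fin d)) ∈ K}).Nonempty := by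
  set K' : Set (vectorSpan ℝ K) := {v | w₀ + (v : EuclideanSpace ℝ (Fin d)) ∈ K} with hK'
  set A : vectorSpan ℝ K →ᵃ[ℝ] EuclideanSpace ℝ (Fin d) :=
    AffineMap.const ℝ _ w₀ + (vectorSpan ℝ K).subtype.toAffineMap with hA
  have hAv : ∀ v, A v = w₀ + (v : EuclideanSpace ℝ (Fin d)) := fun v => rfl
  have hconv : Convex ℝ K' := hc.affine_preimage A
  have h0 : (0 : vectorSpan ℝ K) ∈ K' := by simpa [hK'] using hw₀
  have himage : A '' K' = K := by
    ext x
    constructor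
    · rintro ⟨v, hv, rfl⟩
      exact hv
    · intro hx
      have hmem : x - w₀ ∈ vectorSpan ℝ K := vsub_mem_vectorSpan ℝ hx hw₀
      refine ⟨⟨x - w₀, hmem⟩, ?_, ?_⟩
      · simpa [hK'] using hx
      · simp [hAv]
  rw [hconv.interior_nonempty_iff_affineSpan_eq_top,
    AffineSubspace.affineSpan_eq_top_iff_vectorSpan_eq_top_of_nonempty ℝ _ _ ⟨0, h0⟩]
  have hmap := AffineMap.map_vectorSpan A (s := K')
  rw [himage] at hmap
  have hlin : A.linear = (vectorSpan ℝ K).subtype := by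
    simp [hA]
  rw [hlin] at hmap
  refine Submodule.map_injective_of_injective (vectorSpan ℝ K).injective_subtype ?_
  rw [hmap, Submodule.map_top, Submodule.range_subtype]

/-- The tangential part of the gradient of a loss is bounded by the Lipschitz constant, and the
tangential gradient step is a contraction. -/
theorem IsLoss.tangential (h : IsLoss K L m M f g) (hc : Convex ℝ K) (hne : K.Nonempty)
    (hL : 0 ≤ L) (hm : 0 ≤ m) (hmM : m ≤ M) {η : ℝ} (hη : 0 ≤ η) :
    (∀ w ∈ K, ‖tangentProj K (g w)‖ ≤ L) ∧ ∀ x ∈ K, ∀ y ∈ K,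
      ‖(y - x) - η • (tangentProj K (g y) - tangentProj K (g x))‖ ≤
        contractionFactor η m M * ‖y - x‖ := by
  obtain ⟨w₀, hw₀⟩ := hne
  set V := vectorSpan ℝ K with hV
  -- The loss is restricted to the direction space. The gradient of the restriction is the
  -- orthogonal projection of g; normal components of g are not constrained by f, so only this part
  -- inherits the bound L.
  set K' : Set V := {v | w₀ + (v : EuclideanSpace ℝ (Fin d)) ∈ K} with hK'
  set f' : V → ℝ := fun v => f (w₀ + v) with hf'
  set g' : V → V := fun v => V.orthogonalProjectionOnto (g (w₀ + v)) with hg'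
  have hint : (interior K').Nonempty := interior_preimage_vectorSpan_nonempty hc hw₀
  have hcoe : ∀ x ∈ K, ∃ v ∈ K', x = w₀ + (v : EuclideanSpace ℝ (Fin d)) := by
    intro x hx
    refine ⟨⟨x - w₀, vsub_mem_vectorSpan ℝ hx hw₀⟩, ?_, ?_⟩
    · simpa [hK'] using hx
    · simp
  have hgrad : ∀ v ∈ K', HasGradientWithinAt f' (g' v) K' v := by
    intro v hv
    have h1 := (h.hasGradient _ hv).hasFDerivWithinAt
    have h2 : HasFDerivWithinAt (fun v : V => w₀ + (v : EuclideanSpace ℝ (Fin d))) V.subtypeL K' v :=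
      (V.subtypeL.hasFDerivWithinAt).const_add w₀
    have h3 := h1.comp v h2 (fun u hu => hu)
    rw [hasGradientWithinAt_iff_hasFDerivWithinAt]
    have e : InnerProductSpace.toDual ℝ V (g' v) =
        (InnerProductSpace.toDual ℝ _ (g (w₀ + v))).comp V.subtypeL := by
      ext u
      simp [hg']
    rw [e]
    exact h3
  have hconv : StrongConvexOn K' m f' := by
    refine ⟨?_, ?_⟩
    · exact hc.affine_preimage (AffineMap.const ℝ _ w₀ + V.subtype.toAffineMap)
    · intro u hu v hv a b ha hb hab
      have h1 := h.stronglyConvex.2 hu hv ha hb hab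
      have h2 : a • (w₀ + (u : EuclideanSpace ℝ (Fin d))) + b • (w₀ + (v : EuclideanSpace ℝ (Fin d)))
          = w₀ + ((a • u + b • v : V) : EuclideanSpace ℝ (Fin d)) := by
        have : w₀ = (a + b) • w₀ := by rw [hab, one_smul]
        conv_rhs => rw [this]
        push_cast
        module
      rw [h2, add_sub_add_left_eq_sub, ← Submodule.coe_sub] at h1
      exact h1
  have hnormP : ∀ x : EuclideanSpace ℝ (Fin d), ‖V.orthogonalProjectionOnto x‖ ≤ ‖x‖ := fun x =>
    Submodule.norm_orthogonalProjectionOnto_apply_le V x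
  have hsmooth : ∀ u ∈ K', ∀ v ∈ K', ‖g' u - g' v‖ ≤ M * ‖u - v‖ := by
    intro u hu v hv
    have h1 := h.smooth _ hu _ hv
    rw [add_sub_add_left_eq_sub, ← Submodule.coe_sub] at h1
    rw [hg', ← map_sub]
    exact (hnormP _).trans h1
  have hlip : ∀ u ∈ K', ∀ v ∈ K', |f' u - f' v| ≤ L * ‖u - v‖ := by
    intro u hu v hv
    have h1 := h.lipschitz _ hu _ hv
    rw [add_sub_add_left_eq_sub, ← Submodule.coe_sub] at h1
    exact h1
  have hQ : ∀ v : V, tangentProj K (g (w₀ + v)) = (g' v : EuclideanSpace ℝ (Fin d)) := fun v => rfl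
  constructor
  · intro w hw
    obtain ⟨v, hv, rfl⟩ := hcoe w hw
    rw [hQ]
    exact norm_gradient_le hconv.1 hgrad hsmooth hL hlip hint hv
  · intro x hx y hy
    obtain ⟨u, hu, rfl⟩ := hcoe x hx
    obtain ⟨v, hv, rfl⟩ := hcoe y hy
    have := norm_gradient_step_le hconv hgrad hsmooth hm hmM hint hη hu hv
    rw [hQ, hQ, add_sub_add_left_eq_sub]
    exact this

end Tangent

/-! ### The Gaussian mechanism without subsampling -/

section FullBatch

open scoped RealInnerProductSpace

variable {E : Type*} [NormedAddCommGroup E] [InnerProductSpace ℝ E]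

/-- Completing the square leaves a constant times another shift density, whose integral is 1. -/
lemma shiftDensity_rpow_mul_rpow (v v' z : E) (α : ℝ) :
    shiftDensity v z ^ α * shiftDensity v' z ^ (1 - α) =
      Real.exp (α * (α - 1) * ‖v - v'‖ ^ 2 / 2) * shiftDensity (α • v + (1 - α) • v') z := by
  rw [shiftDensity, shiftDensity, shiftDensity, ← Real.exp_mul, ← Real.exp_mul, ← Real.exp_add,
    ← Real.exp_add, norm_sub_sq_real, norm_add_sq_real, norm_smul, norm_smul, mul_pow, mul_pow,
    Real.norm_eq_abs, Real.norm_eq_abs, sq_abs, sq_abs]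
  simp only [inner_add_left, inner_smul_left, inner_smul_right, RCLike.conj_to_real]
  congr 1
  ring

variable [FiniteDimensional ℝ E] [MeasurableSpace E] [BorelSpace E]

lemma lintegral_shiftDensity_rpow_mul_rpow_le {α δ : ℝ} (hα : 1 < α) {v v' : E} (hv : ‖v‖ ≤ δ)
    (hv' : ‖v'‖ ≤ δ) :
    ∫⁻ z, ENNReal.ofReal (shiftDensity v z ^ α * shiftDensity v' z ^ (1 - α)) ∂(stdGaussian E) ≤
      ENNReal.ofReal (Real.exp (2 * (α * (α - 1)) * δ ^ 2)) := by
  have h1 := lintegral_shiftDensity_rpow (α • v + (1 - α) • v') 1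
  simp only [Real.rpow_one, sub_self, mul_zero, zero_mul, zero_div, Real.exp_zero,
    ENNReal.ofReal_one] at h1
  simp only [shiftDensity_rpow_mul_rpow, ENNReal.ofReal_mul (Real.exp_pos _).le]
  rw [lintegral_const_mul _ (by fun_prop), h1, mul_one]
  have h2 : ‖v - v'‖ ≤ 2 * δ := (norm_sub_le v v').trans (by linarith)
  have h3 : ‖v - v'‖ ^ 2 ≤ (2 * δ) ^ 2 := pow_le_pow_left₀ (norm_nonneg _) h2 2
  have h4 : 0 < α * (α - 1) := mul_pos (by linarith) (by linarith)
  refine ENNReal.ofReal_le_ofReal (Real.exp_le_exp.2 ?_)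
  nlinarith

end FullBatch

/-! ### Batch gradient steps -/

section Batches

variable {d n : ℕ} {K : Set (EuclideanSpace ℝ (Fin d))} {L m M η : ℝ}

/-- The gradient step with batch `B` of size `b`, with the gradients replaced by their tangential
parts and extended to the whole space by means of the projection. -/
noncomputable def batchStep (K : Set (EuclideanSpace ℝ (Fin d))) (η : ℝ) (b : ℕ)
    (g : Fin n → EuclideanSpace ℝ (Fin d) → EuclideanSpace ℝ (Fin d)) (B : Finset (Fin n))
    (w : EuclideanSpace ℝ (Fin d)) : EuclideanSpace ℝ (Fin d) :=
  proj K w - (η * (b : ℝ)⁻¹) • ∑ i ∈ B, tangentProj K (g i (proj K w))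

variable {b : ℕ} {f f' : Fin n → EuclideanSpace ℝ (Fin d) → ℝ}
  {g g' : Fin n → EuclideanSpace ℝ (Fin d) → EuclideanSpace ℝ (Fin d)}

/-- The batch step is the average of b single-loss tangential steps at the projected points; each
contracts, and the projection is nonexpansive. -/
lemma norm_batchStep_sub_le (hc : Convex ℝ K) (hK : IsClosed K) (hne : K.Nonempty)
    (hL : 0 ≤ L) (hm : 0 ≤ m) (hmM : m ≤ M) (hη : 0 ≤ η) (hb : 1 ≤ b)
    (hg : ∀ i, IsLoss K L m M (f i) (g i)) {B : Finset (Fin n)} (hB : B.card = b)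
    (x y : EuclideanSpace ℝ (Fin d)) :
    ‖batchStep K η b g B x - batchStep K η b g B y‖ ≤ contractionFactor η m M * ‖x - y‖ := by
  have hb0 : (0 : ℝ) < b := by exact_mod_cast hb
  have hc0 : 0 ≤ contractionFactor η m M := (abs_nonneg _).trans (le_max_left _ _)
  set p := proj K x
  set r := proj K y
  have hp : p ∈ K := (proj_spec hK hne x).1
  have hr : r ∈ K := (proj_spec hK hne y).1
  have h1 : batchStep K η b g B x - batchStep K η b g B y =
      (b : ℝ)⁻¹ • ∑ i ∈ B, ((p - r) - η • (tangentProj K (g i p) - tangentProj K (g i r))) := by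
    rw [Finset.sum_sub_distrib, Finset.sum_const, hB, ← Nat.cast_smul_eq_nsmul ℝ, smul_sub,
      smul_smul, inv_mul_cancel₀ hb0.ne', one_smul, ← Finset.smul_sum, Finset.sum_sub_distrib,
      smul_smul, mul_comm _ η, smul_sub, batchStep, batchStep]
    abel
  rw [h1, norm_smul, Real.norm_of_nonneg (by positivity)]
  have h2 : ‖∑ i ∈ B, ((p - r) - η • (tangentProj K (g i p) - tangentProj K (g i r)))‖ ≤
      b * (contractionFactor η m M * ‖x - y‖) := by
    refine (norm_sum_le_of_le _ fun i _ => ?_).trans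
      (b := ∑ _i ∈ B, contractionFactor η m M * ‖x - y‖) ?_
    · refine (((hg i).tangential hc hne hL hm hmM hη).2 r hr p hp).trans ?_
      exact mul_le_mul_of_nonneg_left (norm_proj_sub_le hc hK hne x y) hc0
    · rw [Finset.sum_const, hB, nsmul_eq_mul]
  calc (b : ℝ)⁻¹ * _ ≤ (b : ℝ)⁻¹ * (b * (contractionFactor η m M * ‖x - y‖)) :=
        mul_le_mul_of_nonneg_left h2 (by positivity)
    _ = _ := by field_simp

/-- Measurability comes from the Lipschitz bound, as nothing is known about g off K. -/
lemma measurable_batchStep (hc : Convex ℝ K) (hK : IsClosed K) (hne : K.Nonempty)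
    (hL : 0 ≤ L) (hm : 0 ≤ m) (hmM : m ≤ M) (hη : 0 ≤ η) (hb : 1 ≤ b)
    (hg : ∀ i, IsLoss K L m M (f i) (g i)) {B : Finset (Fin n)} (hB : B.card = b) :
    Measurable (batchStep K η b g B) :=
  (LipschitzWith.of_dist_le_mul (K := (contractionFactor η m M).toNNReal) fun x y => by
    have hc0 : 0 ≤ contractionFactor η m M := (abs_nonneg _).trans (le_max_left _ _)
    rw [dist_eq_norm, dist_eq_norm, Real.coe_toNNReal _ hc0]
    exact norm_batchStep_sub_le hc hK hne hL hm hmM hη hb hg hB x y).continuous.measurable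

/-- Two batches that share all gradients but one lead to close gradient steps. -/
lemma norm_batchStep_insert_sub_le (hc : Convex ℝ K) (hK : IsClosed K) (hne : K.Nonempty)
    (hL : 0 ≤ L) (hm : 0 ≤ m) (hmM : m ≤ M) (hη : 0 ≤ η)
    (hg : ∀ i, IsLoss K L m M (f i) (g i)) (hg' : ∀ i, IsLoss K L m M (f' i) (g' i))
    {A : Finset (Fin n)} (hA : ∀ i ∈ A, g i = g' i) {i j : Fin n} (hi : i ∉ A) (hj : j ∉ A)
    (x : EuclideanSpace ℝ (Fin d)) :
    ‖batchStep K η b g (insert i A) x - batchStep K η b g' (insert j A) x‖ ≤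
      2 * L * η / b := by
  have hp : proj K x ∈ K := (proj_spec hK hne x).1
  have h1 : batchStep K η b g (insert i A) x - batchStep K η b g' (insert j A) x =
      (η * (b : ℝ)⁻¹) • (tangentProj K (g' j (proj K x)) - tangentProj K (g i (proj K x))) := by
    rw [batchStep, batchStep, Finset.sum_insert hi, Finset.sum_insert hj,
      Finset.sum_congr rfl fun k hk => by rw [hA k hk]]
    module
  rw [h1, norm_smul, Real.norm_of_nonneg (by positivity)]
  have h2 := ((hg i).tangential hc hne hL hm hmM hη).1 _ hp
  have h3 := ((hg' j).tangential hc hne hL hm hmM hη).1 _ hp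
  calc η * (b : ℝ)⁻¹ * _ ≤ η * (b : ℝ)⁻¹ * (L + L) :=
        mul_le_mul_of_nonneg_left ((norm_sub_le _ _).trans (add_le_add h3 h2)) (by positivity)
    _ = _ := by ring

lemma batchStep_congr {A : Finset (Fin n)} (hA : ∀ i ∈ A, g i = g' i) :
    batchStep K η b g A = batchStep K η b g' A := by
  funext x
  rw [batchStep, batchStep, Finset.sum_congr rfl fun k hk => by rw [hA k hk]]

/-- The discarded normal parts of the gradients are orthogonal to all differences of points of K,
hence invisible to the projection. -/
lemma update_eq_proj_batchStep (hc : Convex ℝ K) (hK : IsClosed K) (B : Finset (Fin n))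
    {w : EuclideanSpace ℝ (Fin d)} (hw : w ∈ K) (z : EuclideanSpace ℝ (Fin d)) :
    update K η b g B w z = proj K (batchStep K η b g B w - η • z) := by
  have h1 : w - η • ((b : ℝ)⁻¹ • ∑ i ∈ B, g i w + z) = (batchStep K η b g B w - η • z) +
      (-(η * (b : ℝ)⁻¹)) • ∑ i ∈ B, (g i w - tangentProj K (g i w)) := by
    rw [batchStep, proj_of_mem hK hw, Finset.sum_sub_distrib]
    module
  rw [update, h1]
  refine proj_add_of_orthogonal hc hK ⟨w, hw⟩ _ fun y hy z hz => ?_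
  rw [real_inner_smul_left, sum_inner, Finset.sum_eq_zero, mul_zero]
  exact fun i _ => inner_tangentProj_sub_eq_zero _ y hy z hz

/-- The law of the next iterate, for the extended gradient steps. -/
noncomputable def batchLaw (K : Set (EuclideanSpace ℝ (Fin d))) (η τ : ℝ) (b : ℕ)
    (g : Fin n → EuclideanSpace ℝ (Fin d) → EuclideanSpace ℝ (Fin d))
    (μ : Measure (EuclideanSpace ℝ (Fin d))) : Measure (EuclideanSpace ℝ (Fin d)) :=
  ((n.choose b : ℝ≥0∞)⁻¹) • ∑ B ∈ Finset.powersetCard b (Finset.univ : Finset (Fin n)),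
    (μ.prod (stdGaussian (EuclideanSpace ℝ (Fin d)))).map
      fun p => proj K (batchStep K η b g B p.1 - τ • p.2)

lemma measurable_proj_batchStep (hc : Convex ℝ K) (hK : IsClosed K) (hne : K.Nonempty)
    (hL : 0 ≤ L) (hm : 0 ≤ m) (hmM : m ≤ M) (hη : 0 ≤ η) (hb : 1 ≤ b)
    (hg : ∀ i, IsLoss K L m M (f i) (g i)) {B : Finset (Fin n)} (hB : B.card = b) (τ : ℝ) :
    Measurable fun p : EuclideanSpace ℝ (Fin d) × EuclideanSpace ℝ (Fin d) =>
      proj K (batchStep K η b g B p.1 - τ • p.2) :=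
  (lipschitzWith_proj hc hK hne).continuous.measurable.comp
    (((measurable_batchStep hc hK hne hL hm hmM hη hb hg hB).comp measurable_fst).sub
      (measurable_snd.const_smul τ))

/-- The coupling needs maps that contract on the whole space; on a law carried by K they agree
almost surely with the algorithm. The stepsize is absorbed into the noise scale. -/
lemma step_eq_batchLaw (hc : Convex ℝ K) (hK : IsClosed K) (hne : K.Nonempty)
    (hL : 0 ≤ L) (hm : 0 ≤ m) (hmM : m ≤ M) (hη : 0 ≤ η) (hb : 1 ≤ b)
    (hg : ∀ i, IsLoss K L m M (f i) (g i)) (σ : ℝ) {μ : Measure (EuclideanSpace ℝ (Fin d))}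
    [IsProbabilityMeasure μ] (hμ : ∀ᵐ w ∂μ, w ∈ K) :
    step K η σ b g μ = batchLaw K η (η * σ) b g μ := by
  rw [step, batchLaw]
  congr 1
  refine Finset.sum_congr rfl fun B hB => ?_
  have hB' := (Finset.mem_powersetCard.1 hB).2
  have h1 : μ.prod (gaussian d σ) =
      (μ.prod (stdGaussian (EuclideanSpace ℝ (Fin d)))).map (Prod.map id fun z => σ • z) := by
    have h := Measure.map_prod_map μ (stdGaussian (EuclideanSpace ℝ (Fin d)))
      (measurable_id) (by fun_prop : Measurable fun z : EuclideanSpace ℝ (Fin d) => σ • z)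
    rwa [Measure.map_id] at h
  have h2 : (fun p : EuclideanSpace ℝ (Fin d) × EuclideanSpace ℝ (Fin d) =>
      update K η b g B p.1 p.2) =ᵐ[μ.prod (gaussian d σ)]
      fun p => proj K (batchStep K η b g B p.1 - η • p.2) := by
    have : SFinite (gaussian d σ) := by unfold gaussian; infer_instance
    have h3 : ∀ᵐ p ∂(μ.prod (gaussian d σ)), p.1 ∈ K :=
      Measure.quasiMeasurePreserving_fst.ae hμ
    filter_upwards [h3] with p hp
    exact update_eq_proj_batchStep hc hK B hp p.2
  rw [Measure.map_congr h2, h1, Measure.map_map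
    (measurable_proj_batchStep hc hK hne hL hm hmM hη hb hg hB' η) (by fun_prop)]
  congr 1
  funext p
  simp [smul_smul]

lemma choose_mul_inv_cancel {n b : ℕ} (hbn : b ≤ n) :
    ((n.choose b : ℝ≥0∞)) * (n.choose b : ℝ≥0∞)⁻¹ = 1 :=
  ENNReal.mul_inv_cancel (by exact_mod_cast (Nat.choose_pos hbn).ne') (by simp)

lemma isProbabilityMeasure_batchLaw (hc : Convex ℝ K) (hK : IsClosed K) (hne : K.Nonempty)
    (hL : 0 ≤ L) (hm : 0 ≤ m) (hmM : m ≤ M) (hη : 0 ≤ η) (hb : 1 ≤ b) (hbn : b ≤ n)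
    (hg : ∀ i, IsLoss K L m M (f i) (g i)) (τ : ℝ) (μ : Measure (EuclideanSpace ℝ (Fin d)))
    [IsProbabilityMeasure μ] : IsProbabilityMeasure (batchLaw K η τ b g μ) := by
  constructor
  rw [batchLaw, Measure.smul_apply, Measure.finsetSum_apply, Finset.sum_congr rfl
    (g := fun _ => 1), Finset.sum_const, Finset.card_powersetCard, Finset.card_univ,
    Fintype.card_fin, nsmul_eq_mul, mul_one, smul_eq_mul, mul_comm, choose_mul_inv_cancel hbn]
  intro B hB
  have := Measure.isProbabilityMeasure_map (μ := μ.prod (stdGaussian (EuclideanSpace ℝ (Fin d))))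
    (measurable_proj_batchStep hc hK hne hL hm hmM hη hb hg
      (Finset.mem_powersetCard.1 hB).2 τ).aemeasurable
  exact measure_univ

lemma ae_mem_batchLaw (hc : Convex ℝ K) (hK : IsClosed K) (hne : K.Nonempty)
    (hL : 0 ≤ L) (hm : 0 ≤ m) (hmM : m ≤ M) (hη : 0 ≤ η) (hb : 1 ≤ b)
    (hg : ∀ i, IsLoss K L m M (f i) (g i)) (τ : ℝ) (μ : Measure (EuclideanSpace ℝ (Fin d))) :
    ∀ᵐ w ∂(batchLaw K η τ b g μ), w ∈ K := by
  rw [ae_iff, batchLaw, Measure.smul_apply, Measure.finsetSum_apply, Finset.sum_eq_zero, smul_zero]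
  intro B hB
  change (Measure.map _ _) Kᶜ = 0
  rw [Measure.map_apply (measurable_proj_batchStep hc hK hne hL hm hmM hη hb hg
      (Finset.mem_powersetCard.1 hB).2 τ) hK.measurableSet.compl]
  convert measure_empty (μ := μ.prod (stdGaussian (EuclideanSpace ℝ (Fin d))))
  ext p
  simpa using (proj_spec hK hne _).1

lemma noisySGD_zero (σ : ℝ) (w₀ : EuclideanSpace ℝ (Fin d)) :
    noisySGD K η σ b g w₀ 0 = Measure.dirac w₀ := by
  rw [noisySGD, Function.iterate_zero_apply]

lemma noisySGD_succ (σ : ℝ) (w₀ : EuclideanSpace ℝ (Fin d)) (T : ℕ) :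
    noisySGD K η σ b g w₀ (T + 1) = step K η σ b g (noisySGD K η σ b g w₀ T) := by
  rw [noisySGD, noisySGD, Function.iterate_succ_apply']

theorem noisySGD_eq_iterate_batchLaw (hc : Convex ℝ K) (hK : IsClosed K)
    (hL : 0 ≤ L) (hm : 0 ≤ m) (hmM : m ≤ M) (hη : 0 ≤ η) (hb : 1 ≤ b) (hbn : b ≤ n)
    (hg : ∀ i, IsLoss K L m M (f i) (g i)) (σ : ℝ) {w₀ : EuclideanSpace ℝ (Fin d)}
    (hw₀ : w₀ ∈ K) (T : ℕ) :
    noisySGD K η σ b g w₀ T = (batchLaw K η (η * σ) b g)^[T] (Measure.dirac w₀) ∧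
      IsProbabilityMeasure (noisySGD K η σ b g w₀ T) ∧ ∀ᵐ w ∂(noisySGD K η σ b g w₀ T), w ∈ K := by
  have hne : K.Nonempty := ⟨w₀, hw₀⟩
  induction T with
  | zero =>
    rw [noisySGD_zero, Function.iterate_zero_apply]
    refine ⟨rfl, Measure.dirac.isProbabilityMeasure, ?_⟩
    exact (ae_dirac_iff hK.measurableSet).2 hw₀
  | succ T ih =>
    obtain ⟨h1, h2, h3⟩ := ih
    have h4 : noisySGD K η σ b g w₀ (T + 1) =
        batchLaw K η (η * σ) b g (noisySGD K η σ b g w₀ T) := by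
      rw [noisySGD_succ, step_eq_batchLaw hc hK hne hL hm hmM hη hb hg σ h3]
    refine ⟨?_, ?_, ?_⟩
    · rw [h4, h1, Function.iterate_succ_apply']
    · rw [h4]
      exact isProbabilityMeasure_batchLaw hc hK hne hL hm hmM hη hb hbn hg _ _
    · rw [h4]
      exact ae_mem_batchLaw hc hK hne hL hm hmM hη hb hg _ _

end Batches

/-! ### Uniform batches by replacing one element -/

section Counting

variable {ι V : Type*} [DecidableEq ι] [AddCommMonoid V]

/-- The ways to extend a `k`-element subset of `U` by an element of `U`. -/
def extensions (k : ℕ) (U : Finset ι) : Finset (Σ _ : Finset ι, ι) :=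
  (Finset.powersetCard k U).sigma fun C => U \ C

lemma mem_extensions {k : ℕ} {U : Finset ι} {p : Σ _ : Finset ι, ι} :
    p ∈ extensions k U ↔ (p.1 ⊆ U ∧ p.1.card = k) ∧ p.2 ∈ U ∧ p.2 ∉ p.1 := by
  rw [extensions, Finset.mem_sigma, Finset.mem_powersetCard, Finset.mem_sdiff]

/-- Double counting: a set of size k + 1 arises from k + 1 pairs, one for each choice of its added
element. -/
lemma sum_extensions_insert (k : ℕ) (U : Finset ι) (H : Finset ι → V) :
    ∑ p ∈ extensions k U, H (insert p.2 p.1) =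
      (k + 1) • ∑ A ∈ Finset.powersetCard (k + 1) U, H A := by
  have h1 : (k + 1) • ∑ A ∈ Finset.powersetCard (k + 1) U, H A =
      ∑ p ∈ (Finset.powersetCard (k + 1) U).sigma fun A => A, H p.1 := by
    rw [Finset.sum_sigma, Finset.smul_sum]
    refine Finset.sum_congr rfl fun A hA => ?_
    change _ = ∑ _j ∈ A, H A
    rw [Finset.sum_const, (Finset.mem_powersetCard.1 hA).2]
  rw [h1]
  refine Finset.sum_bij' (fun p _ => ⟨insert p.2 p.1, p.2⟩) (fun p _ => ⟨p.1.erase p.2, p.2⟩)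
    ?_ ?_ ?_ ?_ ?_
  · rintro ⟨C, j⟩ h
    obtain ⟨⟨h1, h2⟩, h3, h4⟩ := mem_extensions.1 h
    simp only [Finset.mem_sigma, Finset.mem_powersetCard, Finset.mem_insert_self, and_true]
    exact ⟨Finset.insert_subset h3 h1, by rw [Finset.card_insert_of_notMem h4, h2]⟩
  · rintro ⟨A, j⟩ h
    simp only [Finset.mem_sigma, Finset.mem_powersetCard] at h
    obtain ⟨⟨h1, h2⟩, h3⟩ := h
    refine mem_extensions.2 ⟨⟨(Finset.erase_subset _ _).trans h1, ?_⟩, h1 h3,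
      Finset.notMem_erase _ _⟩
    simp only [Finset.card_erase_of_mem h3, h2, Nat.add_sub_cancel]
  · rintro ⟨C, j⟩ h
    obtain ⟨_, _, h4⟩ := mem_extensions.1 h
    simp only [Finset.erase_insert h4]
  · rintro ⟨A, j⟩ h
    simp only [Finset.mem_sigma, Finset.mem_powersetCard] at h
    simp only [Finset.insert_erase h.2]
  · rintro ⟨C, j⟩ _
    rfl

lemma sum_extensions_fst (k : ℕ) (U : Finset ι) (H : Finset ι → V) :
    ∑ p ∈ extensions k U, H p.1 = (U.card - k) • ∑ C ∈ Finset.powersetCard k U, H C := by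
  rw [extensions, Finset.sum_sigma, Finset.smul_sum]
  refine Finset.sum_congr rfl fun C hC => ?_
  obtain ⟨h1, h2⟩ := Finset.mem_powersetCard.1 hC
  change ∑ _j ∈ U \ C, H C = _
  rw [Finset.sum_const, Finset.card_sdiff_of_subset h1, h2]

lemma card_extensions (k : ℕ) (U : Finset ι) :
    (extensions k U).card = U.card.choose k * (U.card - k) := by
  have := sum_extensions_fst k U (fun _ => 1)
  simpa [mul_comm] using this

lemma sum_powersetCard_insert {i : ι} {U : Finset ι} (hi : i ∉ U) (k : ℕ) (H : Finset ι → V) :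
    ∑ B ∈ Finset.powersetCard (k + 1) (insert i U), H B =
      ∑ A ∈ Finset.powersetCard (k + 1) U, H A + ∑ C ∈ Finset.powersetCard k U, H (insert i C) := by
  rw [Finset.powersetCard_succ_insert hi, Finset.sum_union, Finset.sum_image]
  · intro C hC C' hC' h
    have h1 : i ∉ C := fun h => hi ((Finset.mem_powersetCard.1 hC).1 h)
    have h2 : i ∉ C' := fun h => hi ((Finset.mem_powersetCard.1 hC').1 h)
    rw [← Finset.erase_insert h1, h, Finset.erase_insert h2]
  · rw [Finset.disjoint_left]
    intro A hA hA'
    obtain ⟨C, _, rfl⟩ := Finset.mem_image.1 hA'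
    exact hi ((Finset.mem_powersetCard.1 hA).1 (Finset.mem_insert_self _ _))

/-- A uniform batch of size `k + 1` arises as follows: draw a uniform batch that avoids `i`, and
with probability `(k + 1) / n` replace one of its elements, chosen uniformly, by `i`. -/
lemma smul_sum_powersetCard_eq [Module ℝ≥0∞ V] {i : ι} {U : Finset ι} (hi : i ∉ U) {k : ℕ}
    (hk : k + 1 ≤ U.card) (H : Finset ι → V) :
    ((U.card + 1).choose (k + 1) : ℝ≥0∞)⁻¹ • ∑ B ∈ Finset.powersetCard (k + 1) (insert i U), H B =
      ∑ p ∈ extensions k U, ((extensions k U).card : ℝ≥0∞)⁻¹ •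
        (ENNReal.ofReal (1 - ((k + 1 : ℕ) : ℝ) / (U.card + 1 : ℕ)) • H (insert p.2 p.1) +
          ENNReal.ofReal (((k + 1 : ℕ) : ℝ) / (U.card + 1 : ℕ)) • H (insert i p.1)) := by
  set N := U.card with hN
  have hNk : (k : ℝ) + 1 ≤ N := by exact_mod_cast hk
  have hchoose : ((N + 1 : ℕ) : ℝ) * N.choose k = (N + 1).choose (k + 1) * ((k + 1 : ℕ) : ℝ) := by
    exact_mod_cast Nat.add_one_mul_choose_eq N k
  have hpos : (0 : ℝ) < N.choose k := by exact_mod_cast Nat.choose_pos (by omega)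
  have hpos' : (0 : ℝ) < (N + 1).choose (k + 1) := by exact_mod_cast Nat.choose_pos (by omega)
  have hcard : (((extensions k U).card : ℕ) : ℝ) = N.choose k * (N - k) := by
    rw [card_extensions, Nat.cast_mul, Nat.cast_sub (by omega)]
  have hNk' : (0 : ℝ) < N - k := by linarith
  have hcast : ∀ m : ℕ, 0 < (m : ℝ) → ((m : ℝ≥0∞))⁻¹ = ENNReal.ofReal (m : ℝ)⁻¹ := by
    intro m hm
    rw [ENNReal.ofReal_inv_of_pos hm, ENNReal.ofReal_natCast]
  have hcardpos : 0 < (((extensions k U).card : ℕ) : ℝ) := by rw [hcard]; positivity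
  have hnat : ∀ (m : ℕ) (v : V), m • v = ENNReal.ofReal (m : ℝ) • v := by
    intro m v
    rw [ENNReal.ofReal_natCast, Nat.cast_smul_eq_nsmul]
  have hk0 : (0 : ℝ) < ((k + 1 : ℕ) : ℝ) := by positivity
  have hN0 : (0 : ℝ) < ((N + 1 : ℕ) : ℝ) := by positivity
  have hq : 0 ≤ 1 - ((k + 1 : ℕ) : ℝ) / (N + 1 : ℕ) := by
    rw [sub_nonneg, div_le_one hN0]
    push_cast
    linarith
  have hq' : 0 ≤ ((k + 1 : ℕ) : ℝ) / (N + 1 : ℕ) := by positivity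
  rw [← Finset.smul_sum, Finset.sum_add_distrib, ← Finset.smul_sum, ← Finset.smul_sum,
    sum_extensions_insert, sum_extensions_fst k U fun C => H (insert i C), ← hN,
    sum_powersetCard_insert hi, hnat, hnat, hcast _ hpos', hcast _ hcardpos, smul_add, smul_add,
    smul_smul, smul_smul, smul_smul, smul_smul, ← ENNReal.ofReal_mul (by positivity),
    ← ENNReal.ofReal_mul (by positivity), ← ENNReal.ofReal_mul (by positivity),
    ← ENNReal.ofReal_mul (by positivity), hcard, Nat.cast_sub (by omega)]
  have hne : (((N + 1).choose (k + 1) : ℕ) : ℝ)⁻¹ =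
      ((k + 1 : ℕ) : ℝ) / (((N + 1 : ℕ) : ℝ) * N.choose k) := by
    rw [hchoose]
    field_simp
  congr 3
  · rw [hne]
    field_simp
    push_cast
    ring
  · rw [hne]
    field_simp

end Counting

/-! ### Noisy-SGD as a chain of mixtures -/

section Coupling

variable {d n : ℕ} {K : Set (EuclideanSpace ℝ (Fin d))} {L m M η σ : ℝ} {b : ℕ}
  {f f' : Fin n → EuclideanSpace ℝ (Fin d) → ℝ}
  {g g' : Fin n → EuclideanSpace ℝ (Fin d) → EuclideanSpace ℝ (Fin d)} {i₀ : Fin n}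

/-- The bound on the dual Rényi constant of one noisy step at distance `a`. -/
noncomputable def stepBound (α τ κ a : ℝ) : ℝ≥0∞ :=
  ENNReal.ofReal (Real.exp (2 * (α - 1) * a ^ 2 / τ ^ 2) * Real.exp κ ^ (1 / α))

/-- The degenerate coin: the label is the whole batch and the shift is always applied. -/
lemma batchLaw_eq_mixStep_full (τ : ℝ) {ψ v : Finset (Fin n) → EuclideanSpace ℝ (Fin d) →
      EuclideanSpace ℝ (Fin d)} (hψv : ∀ B x, B.card = b → ψ B x + v B x = batchStep K η b g B x) :
    batchLaw K η τ b g = mixStep (stdGaussian (EuclideanSpace ℝ (Fin d)))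
      (Finset.univ : Finset (Finset.powersetCard b (Finset.univ : Finset (Fin n))))
      (n.choose b : ℝ≥0∞)⁻¹ (ENNReal.ofReal (1 - 1)) (ENNReal.ofReal 1) (proj K) τ
      (fun B => ψ B) (fun B => v B) := by
  funext μ
  rw [batchLaw, mixStep, mixMap, ← Finset.smul_sum, ← Finset.sum_coe_sort]
  congr 1
  refine Finset.sum_congr rfl fun B _ => ?_
  rw [sub_self, ENNReal.ofReal_zero, zero_smul, zero_add, ENNReal.ofReal_one, one_smul]
  simp only [hψv _ _ (Finset.mem_powersetCard.1 B.2).2]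

/-- The label (C, j) gives the batch C ∪ {j}, which avoids i₀, and the coin decides whether j is
replaced by i₀. Only the coin thus exposes the index where the datasets may differ. -/
lemma batchLaw_eq_mixStep_extensions {k : ℕ} (hk : k + 1 < n) (τ : ℝ) (i₀ : Fin n)
    {ψ v : (Σ _ : Finset (Fin n), Fin n) → EuclideanSpace ℝ (Fin d) → EuclideanSpace ℝ (Fin d)}
    (hψ : ∀ p ∈ extensions k (Finset.univ.erase i₀), ∀ x,
      ψ p x = batchStep K η (k + 1) g (insert p.2 p.1) x)
    (hψv : ∀ p ∈ extensions k (Finset.univ.erase i₀), ∀ x,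
      ψ p x + v p x = batchStep K η (k + 1) g (insert i₀ p.1) x) :
    batchLaw K η τ (k + 1) g = mixStep (stdGaussian (EuclideanSpace ℝ (Fin d)))
      (Finset.univ : Finset (extensions k ((Finset.univ : Finset (Fin n)).erase i₀)))
      ((extensions k ((Finset.univ : Finset (Fin n)).erase i₀)).card : ℝ≥0∞)⁻¹
      (ENNReal.ofReal (1 - ((k + 1 : ℕ) : ℝ) / n)) (ENNReal.ofReal (((k + 1 : ℕ) : ℝ) / n))
      (proj K) τ (fun p => ψ p) (fun p => v p) := by
  funext μ
  set U := (Finset.univ : Finset (Fin n)).erase i₀ with hU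
  have hcard : U.card + 1 = n := by
    rw [hU, Finset.card_erase_add_one (Finset.mem_univ _), Finset.card_univ, Fintype.card_fin]
  have h := smul_sum_powersetCard_eq (i := i₀) (U := U) (Finset.notMem_erase _ _) (k := k)
    (by omega) fun B => (μ.prod (stdGaussian (EuclideanSpace ℝ (Fin d)))).map
      fun p => proj K (batchStep K η (k + 1) g B p.1 - τ • p.2)
  rw [hcard, Finset.insert_erase (Finset.mem_univ _)] at h
  rw [batchLaw, h, mixStep, mixMap, ← Finset.sum_coe_sort]
  refine Finset.sum_congr rfl fun p _ => ?_
  simp only [hψ p p.2, ← hψv p p.2]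

/-- Calibration: exchanging one gradient moves the step by 2Lη/b; in units of the standard deviation
ησ√3/2 left after the noise split this is δ with δ² = 2/(3S). -/
lemma step_radius_eq (hL : 0 < L) (hη : 0 < η) (hσ : 0 < σ) (hb : 1 ≤ b) {S : ℝ}
    (hS : S = ((b : ℝ) * σ / (2 * √2 * L)) ^ 2) :
    2 * L * η / b = η * σ * (√3 / 2) * √(2 / (3 * S)) := by
  have hb0 : (0 : ℝ) < b := by exact_mod_cast hb
  have h2 : √2 ^ 2 = (2 : ℝ) := Real.sq_sqrt (by norm_num)
  have h3 : √3 ^ 2 = (3 : ℝ) := Real.sq_sqrt (by norm_num)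
  have hS0 : 0 < S := by rw [hS]; positivity
  refine (sq_eq_sq₀ (by positivity) (by positivity)).1 ?_
  rw [mul_pow _ (√(2 / (3 * S))), Real.sq_sqrt (by positivity), mul_pow, div_pow √3, h3, hS,
    div_pow, div_pow, mul_pow (2 * √2), mul_pow 2 √2, h2]
  field_simp

/-- Small q uses subsampling, with the steps of batches avoiding i₀ as the common part `ψ` of both
chains. Large q treats the whole difference between the batch steps as the shift. The constant
8000000 covers both regimes. -/
theorem holderBound_iterate_batchLaw (hc : Convex ℝ K) (hK : IsClosed K) (hne : K.Nonempty)
    (hL : 0 < L) (hm : 0 ≤ m) (hmM : m ≤ M) (hη : 0 < η) (hσ : 0 < σ) (hb : 1 ≤ b) (hbn : b ≤ n)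
    (hg : ∀ i, IsLoss K L m M (f i) (g i)) (hg' : ∀ i, IsLoss K L m M (f' i) (g' i))
    (hgg' : ∀ i, i ≠ i₀ → g i = g' i) {α q S : ℝ} (hα : 1 < α) (hq : q = (b : ℝ) / n)
    (hS : S = ((b : ℝ) * σ / (2 * √2 * L)) ^ 2) (hS16 : 16 < S)
    (h1 : α ≤ logTerm q α * S / 2 - Real.log S)
    (h2 : q ≤ 1 / 2000 → 1 < 4 * α * q →
      α * (logTerm q α + Real.log (q * α)) + Real.log (5 * S) ≤ logTerm q α ^ 2 * S / 2)
    {π₀ : Measure (EuclideanSpace ℝ (Fin d) × EuclideanSpace ℝ (Fin d))} [IsProbabilityMeasure π₀]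
    {r : ℝ} (hπ₀ : ∀ᵐ x ∂π₀, ‖x.1 - x.2‖ ≤ r) (T : ℕ) :
    HolderBound α ((batchLaw K η (η * σ) b g)^[T + 1] (π₀.map Prod.fst))
      ((batchLaw K η (η * σ) b g')^[T + 1] (π₀.map Prod.snd))
      (stepBound α (η * σ) (8000000 * (α * (α - 1)) * q ^ 2 / S) 0 ^ T *
        stepBound α (η * σ) (8000000 * (α * (α - 1)) * q ^ 2 / S)
          (contractionFactor η m M ^ (T + 1) * r)) := by
  have hb0 : (0 : ℝ) < b := by exact_mod_cast hb
  have hn0 : (0 : ℝ) < n := by exact_mod_cast (hb.trans hbn)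
  have hq0 : 0 < q := by rw [hq]; positivity
  have hS0 : 0 < S := by linarith
  have hαα : 0 < α * (α - 1) := mul_pos (by linarith) (by linarith)
  have hc0 : 0 ≤ contractionFactor η m M := (abs_nonneg _).trans (le_max_left _ _)
  have hδ : √(2 / (3 * S)) ^ 2 = 2 / (3 * S) := Real.sq_sqrt (by positivity)
  have hρ := step_radius_eq hL hη hσ hb hS
  have hmeas : ∀ {B : Finset (Fin n)}, B.card = b → Measurable (batchStep K η b g B) :=
    fun hB => measurable_batchStep hc hK hne hL.le hm hmM hη.le hb hg hB
  have hmeas' : ∀ {B : Finset (Fin n)}, B.card = b → Measurable (batchStep K η b g' B) :=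
    fun hB => measurable_batchStep hc hK hne hL.le hm hmM hη.le hb hg' hB
  have hρ0 : 0 ≤ 2 * L * η / b := by positivity
  rcases lt_or_ge (1 / 2000) q with hq1 | hq1
  · have hdiff : ∀ (B : Finset (Fin n)) x, B.card = b →
        ‖batchStep K η b g B x - batchStep K η b g' B x‖ ≤ 2 * L * η / b := by
      intro B x hB
      by_cases hi : i₀ ∈ B
      · have := norm_batchStep_insert_sub_le (b := b) hc hK hne hL.le hm hmM hη.le hg hg'
          (A := B.erase i₀) (fun i hi => hgg' i (Finset.ne_of_mem_erase hi))
          (Finset.notMem_erase _ _) (Finset.notMem_erase _ _) x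
        rwa [Finset.insert_erase hi] at this
      · rw [batchStep_congr (g' := g') fun i h => hgg' i fun h' => hi (h' ▸ h), sub_self, norm_zero]
        exact hρ0
    rw [batchLaw_eq_mixStep_full (g := g) (ψ := batchStep K η b g')
        (v := fun B x => batchStep K η b g B x - batchStep K η b g' B x) (η * σ)
        (fun B x _ => add_sub_cancel _ _),
      batchLaw_eq_mixStep_full (g := g') (ψ := batchStep K η b g') (v := fun _ _ => 0) (η * σ)
        (fun B x _ => add_zero _)]
    refine holderBound_iterate_mixStep (ρ := 2 * L * η / b) hα ?_ ?_ (lipschitzWith_proj hc hK hne)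
      (fun B => hmeas' (Finset.mem_powersetCard.1 B.2).2)
      (fun B => (hmeas (Finset.mem_powersetCard.1 B.2).2).sub
        (hmeas' (Finset.mem_powersetCard.1 B.2).2))
      (fun _ => measurable_const) hc0
      (fun B => norm_batchStep_sub_le hc hK hne hL.le hm hmM hη.le hb hg'
        (Finset.mem_powersetCard.1 B.2).2)
      (fun B x => hdiff _ x (Finset.mem_powersetCard.1 B.2).2) (fun _ _ => by simpa using hρ0)
      (stepBound α (η * σ) _) ?_ hπ₀ T
    · rw [Finset.card_univ, Fintype.card_coe, Finset.card_powersetCard, Finset.card_univ,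
        Fintype.card_fin]
      exact choose_mul_inv_cancel hbn
    · simp
    · intro a x y u u' hu hu' hxy h hh
      rw [hρ] at hu hu'
      refine lintegral_noisy_step_le hα zero_le_one le_rfl (Real.exp_pos _).le (by positivity)
        (fun v v' hv hv' => ?_) hu hu' hxy hh
      simp only [sub_self, one_mul, zero_add]
      refine (lintegral_shiftDensity_rpow_mul_rpow_le hα hv hv').trans
        (ENNReal.ofReal_le_ofReal (Real.exp_le_exp.2 ?_))
      rw [hδ, ← mul_div_assoc, div_le_div_iff₀ (by positivity) hS0]
      -- The unsampled exponent is 4/3 · α(α-1)/S; since q² exceeds 1/4000000, the target is more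
      -- than 2α(α-1)/S.
      have hq2 : 1 / 4000000 < q ^ 2 := by nlinarith
      have : 0 < α * (α - 1) * S := by positivity
      nlinarith
  · obtain ⟨k, rfl⟩ : ∃ k, b = k + 1 := ⟨b - 1, by omega⟩
    -- A small sampling rate excludes b = n, so there are batches that avoid i₀.
    have hk : k + 1 < n := by
      have : ((k + 1 : ℕ) : ℝ) < n := by
        rw [hq, div_le_iff₀ hn0] at hq1
        linarith
      exact_mod_cast this
    set U := (Finset.univ : Finset (Fin n)).erase i₀ with hU
    have hcardU : U.card + 1 = n := by
      rw [hU, Finset.card_erase_add_one (Finset.mem_univ _), Finset.card_univ, Fintype.card_fin]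
    have hcard : ∀ p ∈ extensions k U, (insert p.2 p.1).card = k + 1 := by
      intro p hp
      obtain ⟨⟨_, h2⟩, _, h4⟩ := mem_extensions.1 hp
      rw [Finset.card_insert_of_notMem h4, h2]
    have hi₀ : ∀ p ∈ extensions k U, i₀ ∉ p.1 := fun p hp h =>
      Finset.notMem_erase i₀ _ ((mem_extensions.1 hp).1.1 h)
    have hcard₀ : ∀ p ∈ extensions k U, (insert i₀ p.1).card = k + 1 := by
      intro p hp
      rw [Finset.card_insert_of_notMem (hi₀ p hp), (mem_extensions.1 hp).1.2]
    have hcongr : ∀ p ∈ extensions k U, ∀ i ∈ insert p.2 p.1, g i = g' i := by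
      intro p hp i hi
      refine hgg' i (Finset.ne_of_mem_erase (s := Finset.univ) ?_)
      rcases Finset.mem_insert.1 hi with rfl | hi
      · exact (mem_extensions.1 hp).2.1
      · exact (mem_extensions.1 hp).1.1 hi
    rw [batchLaw_eq_mixStep_extensions hk (g := g) (i₀ := i₀) (η * σ)
        (ψ := fun p => batchStep K η (k + 1) g (insert p.2 p.1))
        (v := fun p x => batchStep K η (k + 1) g (insert i₀ p.1) x -
          batchStep K η (k + 1) g (insert p.2 p.1) x)
        (fun p _ x => rfl) (fun p _ x => add_sub_cancel _ _),
      batchLaw_eq_mixStep_extensions hk (g := g') (i₀ := i₀) (η * σ)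
        (ψ := fun p => batchStep K η (k + 1) g (insert p.2 p.1))
        (v := fun p x => batchStep K η (k + 1) g' (insert i₀ p.1) x -
          batchStep K η (k + 1) g (insert p.2 p.1) x)
        (fun p hp x => by rw [batchStep_congr (hcongr p hp)])
        (fun p _ x => add_sub_cancel _ _), ← hq]
    refine holderBound_iterate_mixStep (ι := extensions k U)
      (ρ := 2 * L * η / (k + 1 : ℕ)) hα ?_ ?_
      (lipschitzWith_proj hc hK hne)
      (fun p => hmeas (hcard p.1 p.2))
      (fun p => (hmeas (hcard₀ p.1 p.2)).sub (hmeas (hcard p.1 p.2)))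
      (fun p => (hmeas' (hcard₀ p.1 p.2)).sub (hmeas (hcard p.1 p.2))) hc0
      (fun p => norm_batchStep_sub_le hc hK hne hL.le hm hmM hη.le hb hg (hcard p.1 p.2))
      (fun p x => norm_batchStep_insert_sub_le hc hK hne hL.le hm hmM hη.le hg hg
        (fun _ _ => rfl) (hi₀ p.1 p.2) (mem_extensions.1 p.2).2.2 x)
      (fun p x => norm_batchStep_insert_sub_le hc hK hne hL.le hm hmM hη.le hg' hg
        (fun i hi => (hcongr p.1 p.2 i (Finset.mem_insert_of_mem hi)).symm) (hi₀ p.1 p.2)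
        (mem_extensions.1 p.2).2.2 x)
      (stepBound α (η * σ) _) ?_ hπ₀ T
    · rw [Finset.card_univ, Fintype.card_coe]
      refine ENNReal.mul_inv_cancel ?_ (by simp)
      rw [card_extensions]
      have h3 := (Nat.choose_pos (show k ≤ U.card by omega)).ne'
      have h4 : U.card - k ≠ 0 := by omega
      exact_mod_cast mul_ne_zero h3 h4
    · rw [← ENNReal.ofReal_add (by linarith) hq0.le, sub_add_cancel, ENNReal.ofReal_one]
    · intro a x y u u' hu hu' hxy h hh
      rw [hρ] at hu hu'
      refine lintegral_noisy_step_le hα hq0.le (by linarith) (Real.exp_pos _).le (by positivity)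
        (fun v v' hv hv' => ?_) hu hu' hxy hh
      refine (lintegral_subsampled_le hα hq0 hq1 hS16 hδ h1 (h2 hq1) hv hv').trans
        (ENNReal.ofReal_le_ofReal (Real.exp_le_exp.2 ?_))
      gcongr
      norm_num

end Coupling

/-! ### Orders below the threshold -/

section Threshold

variable {q α β : ℝ}

lemma logTerm_pos (hq : 0 < q) (hα : 1 < α) : 0 < logTerm q α := by
  have h0 : 0 < α - 1 := by linarith
  have : 0 < 1 / (q * (α - 1)) := by positivity
  exact Real.log_pos (by linarith)

lemma logTerm_anti (hq : 0 < q) (hα : 1 < α) (hαβ : α ≤ β) : logTerm q β ≤ logTerm q α := by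
  have h0 : 0 < α - 1 := by linarith
  have h1 : 0 < β - 1 := by linarith
  have h2 : 0 < 1 / (q * (β - 1)) := by positivity
  refine Real.log_le_log (by linarith) ?_
  gcongr

lemma logTerm_add_log (hq : 0 < q) (hα : 1 < α) :
    logTerm q α + Real.log (q * α) = Real.log (q * α + 1 + 1 / (α - 1)) := by
  have h0 : 0 < α - 1 := by linarith
  have h1 : 0 < α := by linarith
  rw [logTerm, ← Real.log_mul (by positivity) (by positivity)]
  congr 1
  field_simp
  ring

lemma logTerm_add_log_pos (hq : 0 < q) (hα : 1 < α) : 0 < logTerm q α + Real.log (q * α) := by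
  have h0 : 0 < α - 1 := by linarith
  have h1 : 0 < 1 / (α - 1) := by positivity
  have h2 : 0 < q * α := by positivity
  rw [logTerm_add_log hq hα]
  exact Real.log_pos (by linarith)

/-- The sum is log(qα + 1 + 1/(α-1)). Passing to β, the loss in 1/(α-1) is at most the gain q(β-α)
once q(α-1)(β-1) ≥ 1; here 4αq > 1 and small q force α > 500, which suffices. -/
lemma logTerm_add_log_mono (hq : 0 < q) (hq0 : q ≤ 1 / 2000) (hα : 1 < α) (hαβ : α ≤ β)
    (hαq : 1 < 4 * α * q) : logTerm q α + Real.log (q * α) ≤ logTerm q β + Real.log (q * β) := by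
  have h0 : 0 < α - 1 := by linarith
  have h1 : 0 < β - 1 := by linarith
  rw [logTerm_add_log hq hα, logTerm_add_log hq (by linarith)]
  have h2 : 0 < 1 / (α - 1) := by positivity
  have h3 : 0 < q * α := by positivity
  refine Real.log_le_log (by linarith) ?_
  have h4 : 1 / (α - 1) - 1 / (β - 1) = (β - α) / ((α - 1) * (β - 1)) := by
    field_simp
    ring
  have h5 : 1 ≤ q * ((α - 1) * (β - 1)) := by
    have h6 : 500 < α := by nlinarith
    have h7 : 1 ≤ 5 * (q * (α - 1)) := by nlinarith
    nlinarith
  have h6 : (β - α) / ((α - 1) * (β - 1)) ≤ q * (β - α) := by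
    rw [div_le_iff₀ (by positivity)]
    nlinarith
  linarith

lemma continuousAt_logTerm (hq : 0 < q) (hα : 1 < α) : ContinuousAt (logTerm q) α := by
  have h0 : 0 < α - 1 := by linarith
  unfold logTerm
  refine ContinuousAt.log (continuousAt_const.add (continuousAt_const.div ?_ (by positivity)))
    (by positivity)
  fun_prop

/-- Orders up to the threshold satisfy the two defining inequalities, cleared of denominators; the
second one under side conditions which make it monotone in the order. -/
theorem le_of_le_alphaStar {s : ℝ} (hq : 0 < q) (hs : 0 < s) (hα : 1 < α)
    (h : α ≤ alphaStar q s) :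
    α ≤ logTerm q α * s ^ 2 / 2 - Real.log (s ^ 2) ∧
      (q ≤ 1 / 2000 → 1 < 4 * α * q → α * (logTerm q α + Real.log (q * α)) +
        Real.log (5 * s ^ 2) ≤ logTerm q α ^ 2 * s ^ 2 / 2) := by
  have hs2 : 0 < s ^ 2 := by positivity
  have hlt : ∀ γ, 1 < γ → γ < α → γ ≤ logTerm q γ * s ^ 2 / 2 - Real.log (s ^ 2) ∧
      (q ≤ 1 / 2000 → 1 < 4 * γ * q → γ * (logTerm q γ + Real.log (q * γ)) +
        Real.log (5 * s ^ 2) ≤ logTerm q γ ^ 2 * s ^ 2 / 2) := by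
    intro γ hγ hγα
    -- An empty set has supremum 0 by convention, incompatible with 1 < α ≤ `alphaStar q s`.
    have hne : {α : ℝ | 1 < α ∧ α ≤ logTerm q α * s ^ 2 / 2 - Real.log (s ^ 2) ∧
        α ≤ (logTerm q α ^ 2 * s ^ 2 / 2 - Real.log (5 * s ^ 2)) /
          (logTerm q α + Real.log (q * α) + 1 / (2 * s ^ 2))}.Nonempty := by
      by_contra hcon
      rw [alphaStar, Set.not_nonempty_iff_eq_empty.1 hcon, Real.sSup_empty] at h
      linarith
    obtain ⟨β, ⟨hβ, hβ1, hβ2⟩, hγβ⟩ := exists_lt_of_lt_csSup hne (hγα.trans_le h)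
    have hanti := logTerm_anti hq hγ hγβ.le
    have hpos := logTerm_pos hq hβ
    refine ⟨?_, fun hq0 hγq => ?_⟩
    · have : logTerm q β * s ^ 2 ≤ logTerm q γ * s ^ 2 := by gcongr
      linarith
    · have h1 := logTerm_add_log_pos hq hβ
      have h2 : 0 < 1 / (2 * s ^ 2) := by positivity
      rw [le_div_iff₀ (by linarith)] at hβ2
      have h3 := logTerm_add_log_mono hq hq0 hγ hγβ.le hγq
      have h4 := logTerm_add_log_pos hq hγ
      have h5 : γ * (logTerm q γ + Real.log (q * γ)) ≤ β * (logTerm q β + Real.log (q * β)) := by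
        gcongr
      have h6 : logTerm q β ^ 2 * s ^ 2 ≤ logTerm q γ ^ 2 * s ^ 2 := by gcongr
      have h7 : 0 < β * (1 / (2 * s ^ 2)) := by positivity
      nlinarith
  -- For γ < α some admissible β > γ exists, from which the inequalities descend. At α itself no
  -- such β need exist, so they follow by continuity from the left.
  have hcont := continuousAt_logTerm hq hα
  have hev : ∀ᶠ γ in nhdsWithin α (Set.Iio α), 1 < γ ∧ γ < α :=
    Filter.Eventually.and (nhdsWithin_le_nhds (lt_mem_nhds hα)) self_mem_nhdsWithin
  constructor
  · have h1 : ContinuousAt (fun γ => logTerm q γ * s ^ 2 / 2 - Real.log (s ^ 2) - γ) α := by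
      fun_prop
    have := ge_of_tendsto (h1.mono_left nhdsWithin_le_nhds : Filter.Tendsto _
      (nhdsWithin α (Set.Iio α)) _) (b := 0) (hev.mono fun γ hγ => by
        linarith [(hlt γ hγ.1 hγ.2).1])
    linarith
  · intro hq0 hαq
    have hlog : ContinuousAt (fun γ => Real.log (q * γ)) α :=
      ContinuousAt.log (by fun_prop) (by positivity)
    have h1 : ContinuousAt (fun γ => logTerm q γ ^ 2 * s ^ 2 / 2 -
        (γ * (logTerm q γ + Real.log (q * γ)) + Real.log (5 * s ^ 2))) α := by
      fun_prop
    have hev' : ∀ᶠ γ in nhdsWithin α (Set.Iio α), 1 < 4 * γ * q := by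
      refine nhdsWithin_le_nhds ?_
      exact ContinuousAt.eventually_lt (f := fun _ => 1) (g := fun γ => 4 * γ * q) (by fun_prop)
        (by fun_prop) hαq
    have := ge_of_tendsto (h1.mono_left nhdsWithin_le_nhds : Filter.Tendsto _
      (nhdsWithin α (Set.Iio α)) _) (b := 0) ((hev.and hev').mono fun γ hγ => by
        linarith [(hlt γ hγ.1.1 hγ.1.2).2 hq0 hγ.2])
    linarith

end Threshold

/-! ### The burn-in time -/

section BurnIn

variable {n D L η c m M : ℝ}

lemma contractionFactor_lt_one (hm : 0 < m) (hmM : m ≤ M) (hη : 0 < η) (hηM : η < 2 / M) :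
    contractionFactor η m M < 1 := by
  have hM : 0 < M := by linarith
  rw [lt_div_iff₀ hM] at hηM
  have h1 : η * m ≤ η * M := by gcongr
  have h2 : 0 < η * m := by positivity
  refine max_lt (abs_lt.2 ⟨?_, ?_⟩) (abs_lt.2 ⟨?_, ?_⟩) <;> linarith

/-- After the burn-in time the contraction has made up for the diameter. -/
lemma exists_burnIn_eq (hc0 : 0 ≤ c) (hc1 : c < 1) :
    ∃ k : ℕ, burnIn n D L η c = ((k + 1 : ℕ) : ℝ) ∧
      (n * D / (η * L)) ^ 2 * (c ^ (k + 1)) ^ 2 ≤ ((k + 1 : ℕ) : ℝ) := by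
  rcases hc0.eq_or_lt with rfl | hc
  · exact ⟨0, by simp [burnIn], by simp⟩
  set X := (n * D / (η * L)) ^ 2 with hX
  set l := Real.log (1 / c) with hl
  have hX0 : 0 ≤ X := sq_nonneg _
  have hl0 : 0 < l := Real.log_pos (by rw [lt_div_iff₀ hc]; linarith)
  set y := 1 / l * max 1 (Real.log (X * l)) with hy
  have hmax1 : 1 ≤ max 1 (Real.log (X * l)) := le_max_left _ _
  have hy0 : 0 < y := by positivity
  obtain ⟨k, hk⟩ : ∃ k : ℕ, ⌈y⌉ = ((k + 1 : ℕ) : ℤ) := by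
    have := Int.ceil_pos.2 hy0
    exact ⟨(⌈y⌉ - 1).toNat, by omega⟩
  have hb : burnIn n D L η c = ((k + 1 : ℕ) : ℝ) := by
    rw [burnIn, if_neg hc.ne', ← hX, ← hl, ← hy, hk]
    rfl
  refine ⟨k, hb, ?_⟩
  set t : ℝ := ((k + 1 : ℕ) : ℝ) with ht
  have hyt : y ≤ t := by
    have := Int.le_ceil y
    rw [hk] at this
    exact_mod_cast this
  have hlt : max 1 (Real.log (X * l)) ≤ l * t := by
    rw [hy, one_div, inv_mul_le_iff₀ hl0] at hyt
    exact hyt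
  have hct : c ^ (k + 1) = Real.exp (-(l * t)) := by
    have h1 : c = Real.exp (-l) := by rw [hl, one_div, Real.log_inv, neg_neg, Real.exp_log hc]
    conv_lhs => rw [h1]
    rw [← Real.exp_nat_mul]
    congr 1
    rw [ht]
    ring
  have ht0 : 0 < t := by positivity
  rcases hX0.eq_or_lt with h | hXpos
  · rw [← h, zero_mul]
    exact ht0.le
  have h1 : X * l ≤ Real.exp (l * t) := by
    rw [← Real.log_le_iff_le_exp (by positivity)]
    exact (le_max_right _ _).trans hlt
  have h2 : 1 ≤ l * t := (le_max_left _ _).trans hlt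
  have h3 : X * l * c ^ (k + 1) ≤ 1 := by
    rw [hct, Real.exp_neg, ← div_eq_mul_inv, div_le_one (Real.exp_pos _)]
    exact h1
  have h4 : c ^ (k + 1) ≤ 1 := pow_le_one₀ hc.le hc1.le
  have h5 : 0 < c ^ (k + 1) := by positivity
  -- One factor c^(k+1) already compensates X l; the other is merely at most 1. The 1 in the maximum
  -- of the burn-in gives 1 ≤ l t.
  have h6 : X * l * c ^ (k + 1) * c ^ (k + 1) ≤ 1 := by nlinarith
  have h7 : X * (c ^ (k + 1)) ^ 2 * l ≤ t * l := by nlinarith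
  exact le_of_mul_le_mul_right h7 hl0

/-- Here c = 1 - u with u = ηm, and l = log(1/c) ≥ u may be much larger than u. The excess enters
the logarithm as log(l/u) ≤ l/u - 1, and the prefactor 1/l reduces it to 1/u. With the ceiling this
gives Y/u + 1/u + 1 ≤ 3Y/u. -/
lemma burnIn_le (hL : 0 < L) (hm : 0 < m) (hmM : m ≤ M) (hη : 0 < η) (hηM : η ≤ 1 / M) :
    burnIn n D L η (contractionFactor η m M) ≤
      3 * (1 / (η * m) * max 1 (Real.log (n ^ 2 * D ^ 2 * m / (η * L ^ 2)))) := by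
  have hM : 0 < M := by linarith
  rw [le_div_iff₀ hM] at hηM
  have h1 : η * m ≤ η * M := by gcongr
  set u := η * m with hu
  have hu0 : 0 < u := by positivity
  have hcf : contractionFactor η m M = 1 - u := by
    rw [contractionFactor, abs_of_nonneg (by linarith), abs_of_nonneg (by linarith)]
    exact max_eq_left (by linarith)
  set Y := max 1 (Real.log (n ^ 2 * D ^ 2 * m / (η * L ^ 2))) with hY
  have hY1 : 1 ≤ Y := le_max_left _ _
  have hu1 : 1 ≤ 1 / u := by rw [le_div_iff₀ hu0]; linarith
  have huY : 1 / u ≤ 1 / u * Y := le_mul_of_one_le_right (by positivity) hY1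
  rw [hcf, burnIn]
  split_ifs with hc
  · linarith
  have hc' : 0 < 1 - u := lt_of_le_of_ne (by linarith) (Ne.symm hc)
  set l := Real.log (1 / (1 - u)) with hl
  have hlu : u ≤ l := by
    have := Real.log_le_sub_one_of_pos hc'
    rw [hl, one_div, Real.log_inv]
    linarith
  have hl0 : 0 < l := by linarith
  set X := (n * D / (η * L)) ^ 2 with hX
  have hmax : max 1 (Real.log (X * l)) ≤ Y + l / u - 1 := by
    have hlu1 : 1 ≤ l / u := by rwa [le_div_iff₀ hu0, one_mul]
    refine max_le (by linarith) ?_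
    -- The degenerate case includes D = 0: `Real.log 0 = 0` leaves the maximum equal to 1, as the
    -- convention requires.
    rcases (sq_nonneg (n * D / (η * L))).eq_or_lt with h | hXpos
    · rw [hX, ← h, zero_mul, Real.log_zero]
      linarith
    · have h2 : X * l = n ^ 2 * D ^ 2 * m / (η * L ^ 2) * (l / u) := by
        rw [hX, hu]
        field_simp
      have h3 : 0 < n ^ 2 * D ^ 2 * m / (η * L ^ 2) := by
        have : n ^ 2 * D ^ 2 * m / (η * L ^ 2) = (n * D / (η * L)) ^ 2 * u := by
          rw [hu]
          field_simp
        rw [this]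
        positivity
      rw [h2, Real.log_mul h3.ne' (by positivity)]
      have h4 := Real.log_le_sub_one_of_pos (show 0 < l / u by positivity)
      have h5 : Real.log (n ^ 2 * D ^ 2 * m / (η * L ^ 2)) ≤ Y := le_max_right _ _
      linarith
  have hceil := (Int.ceil_lt_add_one (1 / l * max 1 (Real.log (X * l)))).le
  have h6 : 1 / l * max 1 (Real.log (X * l)) ≤ 1 / u * Y + 1 / u := by
    calc 1 / l * max 1 (Real.log (X * l)) ≤ 1 / l * (Y + l / u - 1) := by gcongr
      _ ≤ 1 / l * (Y + l / u) := by gcongr; linarith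
      _ = 1 / l * Y + 1 / u := by field_simp
      _ ≤ 1 / u * Y + 1 / u := by gcongr
  linarith

end BurnIn

/-! ### Assembling the privacy bound -/

section Privacy

variable {d n : ℕ} {K : Set (EuclideanSpace ℝ (Fin d))} {L m M η σ : ℝ} {b : ℕ}
  {f f' : Fin n → EuclideanSpace ℝ (Fin d) → ℝ}
  {g g' : Fin n → EuclideanSpace ℝ (Fin d) → EuclideanSpace ℝ (Fin d)} {i₀ : Fin n}

lemma stepBound_pow_mul (α τ κ a : ℝ) (k : ℕ) :
    stepBound α τ κ 0 ^ k * stepBound α τ κ a =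
      ENNReal.ofReal (Real.exp (2 * (α - 1) * a ^ 2 / τ ^ 2 + ((k + 1 : ℕ) : ℝ) * (κ / α))) := by
  rw [stepBound, stepBound, ← ENNReal.ofReal_pow (by positivity),
    ← ENNReal.ofReal_mul (by positivity), ← Real.exp_mul, ← Real.exp_add, ← Real.exp_add,
    ← Real.exp_nat_mul, ← Real.exp_add]
  congr 2
  push_cast
  ring

/-- Privacy of `k + 1` steps from coupled starting points at distance at most `r`, if the
contraction over these steps makes up for `r`. -/
theorem renyiDiv_iterate_batchLaw_le (hc : Convex ℝ K) (hK : IsClosed K) (hne : K.Nonempty)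
    (hL : 0 < L) (hm : 0 ≤ m) (hmM : m ≤ M) (hη : 0 < η) (hσ : 8 * √2 * L / b < σ) (hb : 1 ≤ b)
    (hbn : b ≤ n) (hg : ∀ i, IsLoss K L m M (f i) (g i)) (hg' : ∀ i, IsLoss K L m M (f' i) (g' i))
    (hgg' : ∀ i, i ≠ i₀ → g i = g' i) {α : ℝ} (hα : 1 < α)
    (hα' : α ≤ alphaStar ((b : ℝ) / n) (b * σ / (2 * √2 * L)))
    {π₀ : Measure (EuclideanSpace ℝ (Fin d) × EuclideanSpace ℝ (Fin d))} [IsProbabilityMeasure π₀]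
    {r : ℝ} (hπ₀ : ∀ᵐ x ∂π₀, ‖x.1 - x.2‖ ≤ r) {k : ℕ}
    (hr : (n * r / (η * L)) ^ 2 * (contractionFactor η m M ^ (k + 1)) ^ 2 ≤ ((k + 1 : ℕ) : ℝ)) :
    renyiDiv α ((batchLaw K η (η * σ) b g)^[k + 1] (π₀.map Prod.fst))
      ((batchLaw K η (η * σ) b g')^[k + 1] (π₀.map Prod.snd)) ≤
      ((64000002 * (α * L ^ 2 / ((n : ℝ) ^ 2 * σ ^ 2)) * ((k + 1 : ℕ) : ℝ) : ℝ) : EReal) := by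
  have hb0 : (0 : ℝ) < b := by exact_mod_cast hb
  have hn0 : (0 : ℝ) < n := by exact_mod_cast (hb.trans hbn)
  have hσ0 : 0 < σ := lt_trans (by positivity) hσ
  have hα0 : 0 < α := by linarith
  set s := b * σ / (2 * √2 * L) with hs
  have h2 : √2 ^ 2 = (2 : ℝ) := Real.sq_sqrt (by norm_num)
  have hs4 : 4 < s := by
    rw [hs, lt_div_iff₀ (by positivity)]
    rw [div_lt_iff₀ hb0] at hσ
    linarith
  obtain ⟨h3, h4⟩ := le_of_le_alphaStar (by positivity) (by positivity) hα hα'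
  have hprob : IsProbabilityMeasure (π₀.map Prod.fst) :=
    Measure.isProbabilityMeasure_map measurable_fst.aemeasurable
  have hprob' : IsProbabilityMeasure (π₀.map Prod.snd) :=
    Measure.isProbabilityMeasure_map measurable_snd.aemeasurable
  have key : ∀ j : ℕ, IsProbabilityMeasure ((batchLaw K η (η * σ) b g)^[j] (π₀.map Prod.fst)) ∧
      IsProbabilityMeasure ((batchLaw K η (η * σ) b g')^[j] (π₀.map Prod.snd)) := by
    intro j
    induction j with
    | zero => exact ⟨hprob, hprob'⟩
    | succ j ih =>
      obtain ⟨ih1, ih2⟩ := ih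
      rw [Function.iterate_succ_apply', Function.iterate_succ_apply']
      exact ⟨isProbabilityMeasure_batchLaw hc hK hne hL.le hm hmM hη.le hb hbn hg _ _,
        isProbabilityMeasure_batchLaw hc hK hne hL.le hm hmM hη.le hb hbn hg' _ _⟩
  obtain ⟨_, _⟩ := key (k + 1)
  refine HolderBound.renyiDiv_le hα ?_
  intro h hh
  refine (holderBound_iterate_batchLaw hc hK hne hL hm hmM hη hσ0 hb hbn hg hg' hgg' hα rfl rfl
    (by rw [← hs]; nlinarith) h3 h4 hπ₀ k h hh).trans ?_
  gcongr
  rw [stepBound_pow_mul]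
  refine ENNReal.ofReal_le_ofReal (Real.exp_le_exp.2 ?_)
  set a := contractionFactor η m M ^ (k + 1) * r with ha
  set t : ℝ := ((k + 1 : ℕ) : ℝ)
  have hr' : a ^ 2 / η ^ 2 ≤ t * (L ^ 2 / n ^ 2) := by
    have h5 : (n * r / (η * L)) ^ 2 * (contractionFactor η m M ^ (k + 1)) ^ 2 =
        a ^ 2 / η ^ 2 / (L ^ 2 / n ^ 2) := by
      rw [ha]
      field_simp
    rw [h5] at hr
    exact (div_le_iff₀ (by positivity)).1 hr
  have h6 : 2 * (α - 1) * a ^ 2 / (η * σ) ^ 2 ≤ 2 * (α - 1) * (t * (L ^ 2 / n ^ 2)) / σ ^ 2 := by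
    have : 2 * (α - 1) * a ^ 2 / (η * σ) ^ 2 = 2 * (α - 1) * (a ^ 2 / η ^ 2) / σ ^ 2 := by
      field_simp
    rw [this]
    have : 0 ≤ 2 * (α - 1) := by linarith
    gcongr
  -- Since q²/s² = 8L²/(n²σ²), the batch size cancels. The final constant is 64000000 from the
  -- mechanisms plus 2 from hiding the remaining distance.
  have h7 : 8000000 * (α * (α - 1)) * ((b : ℝ) / n) ^ 2 / s ^ 2 =
      α * (64000000 * (α - 1) * (L ^ 2 / n ^ 2) / σ ^ 2) := by
    rw [hs, div_pow, div_pow, mul_pow (2 * √2), mul_pow 2 √2, h2]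
    field_simp
    ring
  rw [h7, mul_div_cancel_left₀ _ hα0.ne']
  refine (add_le_add_left h6 _).trans (le_of_eq ?_)
  field_simp
  ring

/-- Up to the burn-in both chains start at the same point, so r = 0. Beyond it, only the last k + 1
steps count: the laws at the earlier time are coupled independently, at distance at most the
diameter. -/
theorem renyiDiv_noisySGD_le (hc : Convex ℝ K) (hK : IsClosed K) (hbd : Bornology.IsBounded K)
    {w₀ : EuclideanSpace ℝ (Fin d)} (hw₀ : w₀ ∈ K)
    (hL : 0 < L) (hm : 0 < m) (hmM : m ≤ M) (hη : 0 < η) (hηM : η < 2 / M)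
    (hσ : 8 * √2 * L / b < σ) (hb : 1 ≤ b)
    (hbn : b ≤ n) (hg : ∀ i, IsLoss K L m M (f i) (g i)) (hg' : ∀ i, IsLoss K L m M (f' i) (g' i))
    (hgg' : ∀ i, i ≠ i₀ → g i = g' i) {α : ℝ} (hα : 1 < α)
    (hα' : α ≤ alphaStar ((b : ℝ) / n) (b * σ / (2 * √2 * L))) (T : ℕ) :
    renyiDiv α (noisySGD K η σ b g w₀ T) (noisySGD K η σ b g' w₀ T) ≤
      ((64000002 * (α * L ^ 2 / ((n : ℝ) ^ 2 * σ ^ 2)) *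
        min (T : ℝ) (burnIn n (Metric.diam K) L η (contractionFactor η m M)) : ℝ) : EReal) := by
  have hne : K.Nonempty := ⟨w₀, hw₀⟩
  obtain ⟨k, hk, hkX⟩ := exists_burnIn_eq (n := n) (D := Metric.diam K) (L := L) (η := η)
    (c := contractionFactor η m M)
    ((abs_nonneg _).trans (le_max_left _ _)) (contractionFactor_lt_one hm hmM hη hηM)
  have hiter := fun T =>
    noisySGD_eq_iterate_batchLaw hc hK hL.le hm.le hmM hη.le hb hbn hg σ hw₀ T
  have hiter' := fun T =>
    noisySGD_eq_iterate_batchLaw hc hK hL.le hm.le hmM hη.le hb hbn hg' σ hw₀ T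
  rw [hk]
  rcases le_or_gt T (k + 1) with hT | hT
  · rw [min_eq_left (by exact_mod_cast hT)]
    -- The coupling bound covers at least one step, so T = 0 is treated apart.
    rcases T with _ | T
    · rw [noisySGD_zero, noisySGD_zero]
      refine HolderBound.renyiDiv_le hα ?_
      simpa using holderBound_self (μ := Measure.dirac w₀) hα
    · rw [(hiter _).1, (hiter' _).1]
      have h := renyiDiv_iterate_batchLaw_le (π₀ := (Measure.dirac w₀).prod (Measure.dirac w₀))
        (r := 0) (k := T) hc hK hne hL hm.le hmM hη hσ hb hbn hg hg' hgg' hα hα'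
        (by
          rw [Measure.dirac_prod_dirac]
          refine (ae_dirac_iff (measurableSet_le (by fun_prop) (by fun_prop))).2 ?_
          simp)
        (by
          rw [mul_zero, zero_div, zero_pow two_ne_zero, zero_mul]
          positivity)
      rwa [Measure.map_fst_prod, Measure.map_snd_prod, measure_univ, one_smul] at h
  · rw [min_eq_right (by exact_mod_cast hT.le)]
    obtain ⟨j, rfl⟩ : ∃ j, T = (k + 1) + j := ⟨T - (k + 1), by omega⟩
    obtain ⟨h1, h2, h3⟩ := hiter j
    obtain ⟨h1', h2', h3'⟩ := hiter' j
    rw [(hiter _).1, (hiter' _).1, Function.iterate_add_apply _ (k + 1) j,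
      Function.iterate_add_apply _ (k + 1) j,
      ← h1, ← h1']
    have h := renyiDiv_iterate_batchLaw_le
      (π₀ := (noisySGD K η σ b g w₀ j).prod (noisySGD K η σ b g' w₀ j))
      (r := Metric.diam K) (k := k) hc hK hne hL hm.le hmM hη hσ hb hbn hg hg' hgg' hα hα'
      (by
        filter_upwards [Measure.quasiMeasurePreserving_fst.ae h3,
          Measure.quasiMeasurePreserving_snd.ae h3'] with p hp hp'
        rw [← dist_eq_norm]
        exact Metric.dist_le_diam_of_mem hbd hp hp') hkX
    rwa [Measure.map_fst_prod, Measure.map_snd_prod, measure_univ, measure_univ, one_smul,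
      one_smul] at h

end Privacy

end NoisySGD

/-! ### The theorem -/

theorem theorem5p1 :
    ∃ C : ℝ, 0 < C ∧
      ∀ (d n b T : ℕ) (K : Set (EuclideanSpace ℝ (Fin d))) (w₀ : EuclideanSpace ℝ (Fin d))
        (D L m M η σ α : ℝ) (𝒳 : Type*)
        (f : 𝒳 → EuclideanSpace ℝ (Fin d) → ℝ)
        (g : 𝒳 → EuclideanSpace ℝ (Fin d) → EuclideanSpace ℝ (Fin d)),
        Convex ℝ K → IsClosed K → Bornology.IsBounded K → Metric.diam K = D → w₀ ∈ K →
        0 < L → 0 < m → m ≤ M →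
        (∀ x : 𝒳, NoisySGD.IsLoss K L m M (f x) (g x)) →
        1 ≤ b → b ≤ n →
        0 < η → η < 2 / M →
        8 * √2 * L / b < σ →
        1 < α → α ≤ NoisySGD.alphaStar ((b : ℝ) / n) (b * σ / (2 * √2 * L)) →
        NoisySGD.contractionFactor η m M < 1 ∧
        NoisySGD.IsRDP (fun X : Fin n → 𝒳 => NoisySGD.noisySGD K η σ b (fun i => g (X i)) w₀ T) α
          (C * (α * L ^ 2 / ((n : ℝ) ^ 2 * σ ^ 2)) *
            min (T : ℝ) (NoisySGD.burnIn n D L η (NoisySGD.contractionFactor η m M))) ∧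
        (η ≤ 1 / M →
          NoisySGD.burnIn n D L η (NoisySGD.contractionFactor η m M) ≤
            C * (1 / (η * m) * max 1 (Real.log ((n : ℝ) ^ 2 * D ^ 2 * m / (η * L ^ 2))))) := by
  refine ⟨64000002, by norm_num, ?_⟩
  intro d n b T K w₀ D L m M η σ α 𝒳 f g hc hK hbd hD hw₀ hL hm hmM hloss hb hbn hη hηM hσ hα hα'
  refine ⟨NoisySGD.contractionFactor_lt_one hm hmM hη hηM, ?_, fun hηM' => ?_⟩
  · rintro X X' ⟨i₀, hX⟩
    rw [← hD]
    exact NoisySGD.renyiDiv_noisySGD_le (f := fun i => f (X i)) (f' := fun i => f (X' i))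
      (g := fun i => g (X i)) (g' := fun i => g (X' i)) (i₀ := i₀) hc hK hbd hw₀ hL hm hmM hη hηM hσ
      hb hbn (fun i => hloss _) (fun i => hloss _) (fun i hi => by rw [hX i hi]) hα hα' T
  · refine (NoisySGD.burnIn_le hL hm hmM hη hηM').trans ?_
    have : 0 ≤ 1 / (η * m) * max 1 (Real.log ((n : ℝ) ^ 2 * D ^ 2 * m / (η * L ^ 2))) :=
      mul_nonneg (by positivity) (zero_le_one.trans (le_max_left _ _))
    linarith
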